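/- Setting. Let $d\ge 2$, $N\ge 1$, let $\mathcal H$ be a complex Hilbert space and $H\ge 0$ a (possibly unbounded) self-adjoint operator on $\mathcal H$ with a unit vector $\Omega$ such that $H\Omega=0$ and $H\ge 1$ on $\Omega^\perp$. On $\bigotimes_{\mathbf i\in\{1,\dots,N\}^d}\mathcal H$ let $H_{\mathbf i}$ and $P_{\Omega_{\mathbf i}}$ be the operators acting as $H$ and as the orthogonal projection onto $\mathbb C\Omega$ on the factor $\mathbf i$. For $\mathbf k\in\mathbb N_0^d$ and $\mathbf q$ with $1\le q_j$ and $q_j+k_j\le N$ let $J_{\mathbf k,\mathbf q}=\{\mathbf i:\ q_j\le i_j\le q_j+k_j\ \forall j\}$, a rectangle of size $|\mathbf k|=\sum_j k_j$; for a rectangle $J$ put $$H^0_J=\sum_{\mathbf i\in J}H_{\mathbf i},\qquad \pi_J=\sum_{\mathbf i\in J}(1-P_{\Omega_{\mathbf i}}),\qquad P^{(-)}_J=\prod_{\mathbf i\in J}P_{\Omega_{\mathbf i}},\qquad P^{(+)}_J=1-P^{(-)}_J,$$ $[X]_1=X+1$ and $\|V\|_{H^0}=\|[H^0_J]_1^{-1/2}V[H^0_J]_1^{-1/2}\|$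 for an operator (or quadratic form) $V$ belonging to $J$. Rectangles are totally ordered: $(\mathbf k',\mathbf q')\succ(\mathbf k,\mathbf q)$ if $|\mathbf k'|>|\mathbf k|$; or $|\mathbf k'|=|\mathbf k|$ and, at the first $j$ with $k_j\neq k'_j$, $k'_j<k_j$; or $\mathbf k'=\mathbf k$ and, at the last $j$ with $q_j\ne q'_j$, $q'_j>q_j$. Write $s_{-1}$ for the predecessor of $s$. For every $J$ of size $1$ let $V_J$ be a symmetric form on $D((H^0_J)^{1/2})$, acting as the identity on the factors outside $J$, with $|\langle\phi,V_J\phi\rangle|\le\frac12\langle\phi,(H^0_J+1)\phi\rangle$. Let $t\ge 0$. The effective potentials $V^{(s)}_J$, for rectangles $J$ and steps $s$, are forms on $D((H^0_J)^{1/2})$ defined recursively. Before the first step (that is, for the last rectangle $s$ of size $0$) they are $H_{\mathbf i}$ if $J=\{\mathbf i\}$, $V_J$ if $J$ has size $1$, and $0$ if $J$ is larger. For a rectangle $K$ of size at least $1$ put $$G_K=H^0_K+t\sum_{J\subsetneq K,\ |J|\ge 1}V_J^{(K_{-1})},\qquad E_K=\Big\langle\bigotimes\Omega,\,G_K\bigotimes\Omega\Big\rangle,$$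 where $|J|$ is the size of $J$. With $V=V^{(K_{-1})}_K$ let $(V)_1=V$, $S_j=(G_K-E_K)^{-1}P_K^{(+)}(V)_jP_K^{(-)}-\mathrm{h.c.}$, for $j\ge2$ $$(V)_j=\sum_{p\ge2,\ r_1+\dots+r_p=j}\tfrac1{p!}\,\mathrm{ad}S_{r_1}(\cdots\mathrm{ad}S_{r_p}(G_K))+\sum_{p\ge1,\ r_1+\dots+r_p=j-1}\tfrac1{p!}\,\mathrm{ad}S_{r_1}(\cdots\mathrm{ad}S_{r_p}(V))\qquad(r_i\ge1),$$ and $S_K=\sum_{j\ge1}t^jS_j$, where $\mathrm{ad}A(B)=AB-BA$. In step $K$ one sets: $V^{(K)}_K=\sum_{j\ge1}t^{j-1}\big(P^{(+)}_K(V)_jP^{(+)}_K+P^{(-)}_K(V)_jP^{(-)}_K\big)$; if $K\subsetneq J$, $V^{(K)}_J=V^{(K_{-1})}_J+\sum_{L}\sum_{n\ge1}\frac1{n!}\mathrm{ad}^nS_K(V^{(K_{-1})}_L)$, summed over the rectangles $L\subseteq J$ that meet $K$ and for which $J$ is the smallest rectangle containing $K\cup L$; and $V^{(K)}_J=V^{(K_{-1})}_J$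 in all other cases. (In the recursion, a term whose defining inverse or series does not exist is read as $0$.) For every rectangle $J$ of size $r\ge1$ fix rectangles $J_*$ and $J_{**}$ of sizes $\lfloor r^{1/4}\rfloor$ and $r-\lfloor r^{1/4}\rfloor$. The inductive bounds for $J$ in step $s$ are $$\|V^{(s)}_J\|_{H^0}\le\frac{t^{(r-1)/3}}{r^{22d}}\ \text{ if } s\prec J_*;\qquad \|V^{(s)}_J\|_{H^0}\le 2\,\frac{t^{(r-1)/3}}{r^{22d}}\ \text{ if } J_*\preceq s\prec J_{**};$$ $$\|V^{(s)}_J\|_{H^0}\le 48\,\frac{t^{(r-1)/3}}{r^{20d}}\ \text{ if } J_{**}\preceq s\prec J;\qquad \|V^{(s)}_J\|_{H^0}\le 96\,\frac{t^{(r-1)/3}}{r^{20d}}\ \text{ if } J\preceq s.$$ Lemma. For every $d\ge2$ there are constants $t_d>0$ and $C_d>0$, depending only on $d$, such that the following holds for all $\mathcal H$, $H$, $\Omega$, $N$, $(V_J)$ as above, all $0\le t<t_d$ and all choices of the rectangles $J_*,J_{**}$. Let $K$ be a rectangle of size at least $1$, and suppose that the inductive bounds hold in step $K_{-1}$ for every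 rectangle $J\preceq K$ of size at least $1$. Then there is exactly one bounded operator $T=(G_K-E_K)^{-1}P^{(+)}_KV_K^{(K_{-1})}P^{(-)}_K$, in the sense that $Ty\in D((H^0_K)^{1/2})\cap\operatorname{ran}P_K^{(+)}$ and $\langle z,(G_K-E_K)Ty\rangle=\langle P_K^{(+)}z,\,V^{(K_{-1})}_KP_K^{(-)}y\rangle$ as forms, for all vectors $y$ and all $z\in D((H^0_K)^{1/2})$; and $$\Big\|[H^0_K]_1^{1/2}[\pi_K]_1^{-1/2}\frac1{G_K-E_K}P^{(+)}_KV_K^{(K_{-1})}P^{(-)}_K\Big\|\ \le\ C_d\,\Big\|[\pi_K]_1^{-1/2}[H^0_K]_1^{-1/2}P^{(+)}_KV_K^{(K_{-1})}P^{(-)}_K\Big\|.$$ -/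

import Mathlib

open scoped TensorProduct ENNReal

namespace LieSchwinger

noncomputable section

section HilbertTensor

open scoped ComplexOrder


variable (ι : Type*) (E : Type*) [NormedAddCommGroup E] [InnerProductSpace ℂ E]

/-- The algebraic tensor product `⨂_{i ∈ ι} E`, as a type of its own (Mathlib's `⨂[ℂ] _ : ι, E`
already carries the projective seminorm, which is not the one needed here). -/
def AlgTensor : Type _ := ⨂[ℂ] _ : ι, E

instance : AddCommGroup (AlgTensor ι E) := inferInstanceAs (AddCommGroup (⨂[ℂ] _ : ι, E))
instance : Module ℂ (AlgTensor ι E) := inferInstanceAs (Module ℂ (⨂[ℂ] _ : ι, E))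

variable {ι E}

/-- The elementary tensor `⨂ x i`. -/
def algTprod (x : ι → E) : AlgTensor ι E := PiTensorProduct.tprod ℂ x

lemma exists_sum_algTprod (x : AlgTensor ι E) :
    ∃ (s : Finset (ι → E)) (c : (ι → E) → ℂ), x = ∑ v ∈ s, c v • algTprod v := by
  have hx : x ∈ Submodule.span ℂ (Set.range (algTprod : (ι → E) → AlgTensor ι E)) :=
    (PiTensorProduct.span_tprod_eq_top (R := ℂ) (s := fun _ : ι => E)).ge trivial
  obtain ⟨c, hc⟩ := Finsupp.mem_span_range_iff_exists_finsupp.1 hx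
  exact ⟨c.support, c, hc.symm⟩

lemma algTensor_ext {M : Type*} [AddCommMonoid M] [Module ℂ M] {f g : AlgTensor ι E →ₗ[ℂ] M}
    (h : ∀ x, f (algTprod x) = g (algTprod x)) : f = g :=
  PiTensorProduct.ext (MultilinearMap.ext h)

variable [Fintype ι]

/-- The linear functional `y ↦ ∏ ⟪x i, y i⟫` on the algebraic tensor product. -/
def algInnerLeft (x : ι → E) : AlgTensor ι E →ₗ[ℂ] ℂ :=
  PiTensorProduct.lift ((MultilinearMap.mkPiAlgebra ℂ ι ℂ).compLinearMap
    (fun i => (innerSL ℂ (x i) : E →ₗ[ℂ] ℂ)))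

lemma algInnerLeft_tprod (x y : ι → E) :
    algInnerLeft x (algTprod y) = ∏ i, inner ℂ (x i) (y i) := by
  unfold algInnerLeft algTprod
  erw [PiTensorProduct.lift.tprod]
  simp

lemma prod_inner_update [DecidableEq ι] (x y : ι → E) (i : ι) (c : E) :
    (∏ j, inner ℂ (Function.update x i c j) (y j)) =
      inner ℂ c (y i) * ∏ j ∈ Finset.univ.erase i, inner ℂ (x j) (y j) := by
  rw [← Finset.mul_prod_erase _ _ (Finset.mem_univ i), Function.update_self]
  congr 1
  refine Finset.prod_congr rfl fun j hj => ?_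
  rw [Function.update_of_ne (Finset.ne_of_mem_erase hj)]

/-- `y ↦ conj (∏ ⟪x i, y i⟫)`, conjugate linear in `y` and multilinear in `x`. -/
def algInnerMulti : MultilinearMap ℂ (fun _ : ι => E) (AlgTensor ι E →ₗ⋆[ℂ] ℂ) where
  toFun x := (starLinearEquiv ℂ (A := ℂ) : ℂ →ₗ⋆[ℂ] ℂ).comp (algInnerLeft x)
  map_update_add' x i a b := by
    have h : algInnerLeft (Function.update x i (a + b)) =
        algInnerLeft (Function.update x i a) + algInnerLeft (Function.update x i b) := by
      refine algTensor_ext fun y => ?_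
      simp only [LinearMap.add_apply, algInnerLeft_tprod, prod_inner_update, inner_add_left,
        add_mul]
    ext y
    simp [h]
  map_update_smul' x i c a := by
    have h : algInnerLeft (Function.update x i (c • a)) =
        star c • algInnerLeft (Function.update x i a) := by
      refine algTensor_ext fun y => ?_
      simp only [LinearMap.smul_apply, algInnerLeft_tprod, prod_inner_update, inner_smul_left,
        mul_assoc, smul_eq_mul]
      rfl
    ext y
    simp [h]

/-- The form `⟪y, x⟫ = ∏ ⟪y i, x i⟫` (on elementary tensors), as a map of `x` and then `y`. -/
def algInnerFlip : AlgTensor ι E →ₗ[ℂ] (AlgTensor ι E →ₗ⋆[ℂ] ℂ) :=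
  PiTensorProduct.lift algInnerMulti

lemma algInnerFlip_tprod (x y : ι → E) :
    algInnerFlip (algTprod x) (algTprod y) = ∏ i, inner ℂ (y i) (x i) := by
  have : algInnerFlip (algTprod x) = algInnerMulti x := by
    unfold algInnerFlip algTprod
    exact PiTensorProduct.lift.tprod _
  rw [this]
  change star (algInnerLeft x (algTprod y)) = _
  rw [algInnerLeft_tprod, star_prod]
  exact Finset.prod_congr rfl fun i _ => inner_conj_symm _ _

lemma algInnerFlip_sum (s t : Finset (ι → E)) (c e : (ι → E) → ℂ) (f : (ι → E) → ι → E) :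
    algInnerFlip (∑ v ∈ s, c v • algTprod (f v)) (∑ w ∈ t, e w • algTprod (f w)) =
      ∑ v ∈ s, ∑ w ∈ t, star (e w) * c v * ∏ i, inner ℂ (f w i) (f v i) := by
  rw [map_sum, map_sum, Finset.sum_comm]
  refine Finset.sum_congr rfl fun w _ => ?_
  rw [LinearMap.sum_apply]
  refine Finset.sum_congr rfl fun v _ => ?_
  rw [LinearMap.map_smulₛₗ, LinearMap.map_smul, LinearMap.smul_apply, algInnerFlip_tprod,
    smul_eq_mul, smul_eq_mul, starRingEnd_apply]
  ring

lemma algInnerFlip_sum_id (s t : Finset (ι → E)) (c e : (ι → E) → ℂ) :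
    algInnerFlip (∑ v ∈ s, c v • algTprod v) (∑ w ∈ t, e w • algTprod w) =
      ∑ v ∈ s, ∑ w ∈ t, star (e w) * c v * ∏ i, inner ℂ (w i) (v i) :=
  algInnerFlip_sum s t c e id

lemma posSemidef_prod {n : Type*} [Finite n] (s : Finset ι) (A : ι → Matrix n n ℂ)
    (hA : ∀ i, (A i).PosSemidef) :
    (Matrix.of fun a b => ∏ i ∈ s, A i a b).PosSemidef := by
  classical
  induction s using Finset.induction_on with
  | empty =>
    have h : (Matrix.of fun a b => ∏ i ∈ (∅ : Finset ι), A i a b) =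
        Matrix.vecMulVec (fun _ : n => (1 : ℂ)) (star fun _ : n => (1 : ℂ)) := by
      ext a b
      simp [Matrix.vecMulVec]
    rw [h]
    exact Matrix.posSemidef_vecMulVec_self_star _
  | insert i s hi ih =>
    have h : (Matrix.of fun a b => ∏ i ∈ insert i s, A i a b) =
        (A i).hadamard (Matrix.of fun a b => ∏ i ∈ s, A i a b) := by
      ext a b
      simp [Finset.prod_insert hi, Matrix.hadamard]
    rw [h]
    exact (hA i).hadamard ih

/-- The entrywise product of the Gram matrices of the images under `B i` is dominated by
`∏ ‖B i‖ ^ 2` times that of the original Gram matrices. -/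
lemma posSemidef_prod_sub {n : Type*} [Finite n] (s : Finset ι) (x : n → ι → E)
    (B : ι → E →L[ℂ] E) :
    (Matrix.of fun a b => (∏ i ∈ s, (‖B i‖ ^ 2 : ℝ) • inner ℂ (x a i) (x b i)) -
      ∏ i ∈ s, inner ℂ (B i (x a i)) (B i (x b i))).PosSemidef := by
  classical
  induction s using Finset.induction_on with
  | empty =>
    have h : (Matrix.of fun a b => (∏ i ∈ (∅ : Finset ι), (‖B i‖ ^ 2 : ℝ) •
        inner ℂ (x a i) (x b i)) - ∏ i ∈ (∅ : Finset ι), inner ℂ (B i (x a i)) (B i (x b i))) =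
        (0 : Matrix n n ℂ) := by
      ext a b
      simp
    rw [h]
    exact Matrix.PosSemidef.zero
  | insert i s hi ih =>
    have h1 := (Matrix.posSemidef_opNorm_smul_gram_sub_gram (𝕜 := ℂ) (fun a => x a i)
      (B i)).hadamard
      (posSemidef_prod s (fun i => (‖B i‖ ^ 2 : ℝ) • Matrix.gram ℂ (fun a => x a i))
        fun i => (Matrix.posSemidef_gram ℂ _).smul (by positivity))
    have h2 := (Matrix.posSemidef_gram ℂ (fun a => B i (x a i))).hadamard ih
    have h3 := h1.add h2
    refine (congrArg Matrix.PosSemidef ?_).mp h3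
    ext a b
    simp only [Finset.prod_insert hi, Matrix.hadamard, Matrix.gram, Matrix.add_apply,
      Matrix.of_apply, Matrix.sub_apply, Matrix.smul_apply, Function.comp_apply]
    ring

lemma re_sum_nonneg_of_posSemidef (s : Finset (ι → E)) (c : (ι → E) → ℂ)
    (f : (ι → E) → (ι → E) → ℂ)
    (hM : (Matrix.of fun v w : s => f v w).PosSemidef) :
    0 ≤ (∑ v ∈ s, ∑ w ∈ s, star (c w) * c v * f w v).re := by
  have h := hM.re_dotProduct_nonneg (fun v : s => c v)
  convert h using 1
  simp only [dotProduct, Matrix.mulVec, Finset.mul_sum, Matrix.of_apply, Pi.star_apply]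
  rw [Finset.sum_comm, ← Finset.sum_coe_sort s]
  refine congrArg _ (Finset.sum_congr rfl fun v _ => ?_)
  rw [← Finset.sum_coe_sort s]
  refine Finset.sum_congr rfl fun w _ => ?_
  ring

/-- The inner product `⟪⨂ x i, ⨂ y i⟫ = ∏ ⟪x i, y i⟫` on the algebraic tensor product. -/
@[reducible]
def algTensorCore : PreInnerProductSpace.Core ℂ (AlgTensor ι E) where
  inner x y := algInnerFlip y x
  conj_inner_symm x y := by
    obtain ⟨s, c, rfl⟩ := exists_sum_algTprod x
    obtain ⟨t, e, rfl⟩ := exists_sum_algTprod y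
    rw [algInnerFlip_sum_id s t c e, algInnerFlip_sum_id t s e c, map_sum, Finset.sum_comm]
    simp only [map_sum]
    refine Finset.sum_congr rfl fun v _ => Finset.sum_congr rfl fun w _ => ?_
    simp only [map_mul, map_prod, inner_conj_symm]
    simp only [starRingEnd_apply, star_star]
    ring
  re_inner_nonneg x := by
    obtain ⟨s, c, rfl⟩ := exists_sum_algTprod x
    rw [algInnerFlip_sum_id s s c c]
    exact re_sum_nonneg_of_posSemidef s c (fun v w => ∏ i, inner ℂ (v i) (w i))
      (posSemidef_prod Finset.univ (fun i => Matrix.gram ℂ fun v : s => (v : ι → E) i)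
        fun i => Matrix.posSemidef_gram ℂ _)
  add_left x y z := map_add _ _ _
  smul_left x y r := LinearMap.map_smulₛₗ _ _ _

instance : SeminormedAddCommGroup (AlgTensor ι E) :=
  @InnerProductSpace.Core.toSeminormedAddCommGroup ℂ _ _ _ _ algTensorCore

instance : InnerProductSpace ℂ (AlgTensor ι E) :=
  InnerProductSpace.ofCore algTensorCore

lemma norm_sq_algTensor (x : AlgTensor ι E) : ‖x‖ ^ 2 = (algInnerFlip x x).re :=
  norm_sq_eq_re_inner (𝕜 := ℂ) x

/-- `⨂ B i` on the algebraic tensor product, as a linear map. -/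
def algTensorLin (B : ι → E →L[ℂ] E) : AlgTensor ι E →ₗ[ℂ] AlgTensor ι E :=
  PiTensorProduct.map (fun i => (B i : E →ₗ[ℂ] E))

lemma algTensorLin_tprod (B : ι → E →L[ℂ] E) (x : ι → E) :
    algTensorLin B (algTprod x) = algTprod fun i => B i (x i) :=
  PiTensorProduct.map_tprod _ _

lemma norm_algTensorLin_le (B : ι → E →L[ℂ] E) (x : AlgTensor ι E) :
    ‖algTensorLin B x‖ ≤ (∏ i, ‖B i‖) * ‖x‖ := by
  refine le_of_sq_le_sq ?_ (by positivity)
  obtain ⟨s, c, rfl⟩ := exists_sum_algTprod x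
  rw [map_sum]
  simp only [map_smul, algTensorLin_tprod]
  rw [mul_pow, norm_sq_algTensor, norm_sq_algTensor, algInnerFlip_sum_id s s c c,
    algInnerFlip_sum s s c c fun v i => B i (v i), ← sub_nonneg]
  have h := re_sum_nonneg_of_posSemidef s c (fun v w =>
    (∏ i, (‖B i‖ ^ 2 : ℝ) • inner ℂ (v i) (w i)) - ∏ i, inner ℂ (B i (v i)) (B i (w i)))
    (posSemidef_prod_sub Finset.univ (fun v : s => (v : ι → E)) B)
  refine h.trans_eq ?_
  symm
  rw [← Complex.re_ofReal_mul, ← Complex.sub_re, Finset.mul_sum, ← Finset.sum_sub_distrib]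
  congr 1
  refine Finset.sum_congr rfl fun v _ => ?_
  rw [Finset.mul_sum, ← Finset.sum_sub_distrib]
  refine Finset.sum_congr rfl fun w _ => ?_
  simp only [Complex.real_smul, Finset.prod_mul_distrib]
  push_cast
  rw [← Finset.prod_pow]
  ring

variable (ι E) in
/-- The Hilbert space tensor product `⨂_{i ∈ ι} E`: the completion of the algebraic one. -/
abbrev HTensor : Type _ := UniformSpace.Completion (AlgTensor ι E)

/-- The elementary tensor `⨂ x i` in the Hilbert space tensor product. -/
def htprod (x : ι → E) : HTensor ι E := ((algTprod x : AlgTensor ι E) : HTensor ι E)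

/-- The bounded operator `⨂ B i` on the Hilbert space tensor product. -/
def tensorMap (B : ι → E →L[ℂ] E) : HTensor ι E →L[ℂ] HTensor ι E :=
  ((algTensorLin B).mkContinuous _ (norm_algTensorLin_le B)).completion

/-- The operator acting as `B` on the factor `i` and as the identity on the others. -/
def siteOp [DecidableEq ι] (i : ι) (B : E →L[ℂ] E) : HTensor ι E →L[ℂ] HTensor ι E :=
  tensorMap (Function.update 1 i B)

end HilbertTensor

section OneSite

/-- The one-site data: a non-negative self-adjoint operator `H` on the Hilbert space `𝓗`, possibly
unbounded, with a unit vector `Ω` such that `H Ω = 0` and `H ≥ 1` on the orthogonal complement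
of `Ω`. -/
structure SiteData (𝓗 : Type*) [NormedAddCommGroup 𝓗] [InnerProductSpace ℂ 𝓗]
    [CompleteSpace 𝓗] where
  H : 𝓗 →ₗ.[ℂ] 𝓗
  selfAdjoint : IsSelfAdjoint H
  nonneg : ∀ x : H.domain, 0 ≤ (inner ℂ (H x) (x : 𝓗)).re
  Ω : 𝓗
  norm_Ω : ‖Ω‖ = 1
  Ω_mem : Ω ∈ H.domain
  H_Ω : H ⟨Ω, Ω_mem⟩ = 0
  gap : ∀ x : H.domain, inner ℂ Ω (x : 𝓗) = 0 → ‖(x : 𝓗)‖ ^ 2 ≤ (inner ℂ (H x) (x : 𝓗)).re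

variable {𝓗 : Type*} [NormedAddCommGroup 𝓗] [InnerProductSpace ℂ 𝓗] [CompleteSpace 𝓗]

/-- `R = (H + 1)⁻¹`. -/
def SiteData.IsResolvent (S : SiteData 𝓗) (R : 𝓗 →L[ℂ] 𝓗) : Prop :=
  ∀ x, ∃ h : R x ∈ S.H.domain, S.H ⟨R x, h⟩ + R x = x

open Classical in
/-- The bounded operator `(H + 1)⁻¹`; it exists and is unique because `H` is self-adjoint and
non-negative. -/
def SiteData.resolvent (S : SiteData 𝓗) : 𝓗 →L[ℂ] 𝓗 :=
  if h : ∃ R, S.IsResolvent R then h.choose else 0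

/-- The bounded operator `(H + 1) ^ (-1/2)`, the positive square root of `(H + 1)⁻¹`. -/
def SiteData.invSqrt (S : SiteData 𝓗) : 𝓗 →L[ℂ] 𝓗 := CFC.sqrt S.resolvent

/-- The orthogonal projection onto `ℂ Ω`. -/
def SiteData.projΩ (S : SiteData 𝓗) : 𝓗 →L[ℂ] 𝓗 := (Submodule.span ℂ {S.Ω}).starProjection

end OneSite

section Lattice

variable {ι : Type*} [Fintype ι] [DecidableEq ι]
variable {𝓗 : Type*} [NormedAddCommGroup 𝓗] [InnerProductSpace ℂ 𝓗] [CompleteSpace 𝓗]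

/-- The operator `(H_i + 1) ^ (1/2)` on `⨂ 𝓗`, where `H_i` acts as `H` on the factor `i`: the
(unbounded) inverse of `(H_i + 1) ^ (-1/2)`. -/
def sqrtSite (S : SiteData 𝓗) (i : ι) : HTensor ι 𝓗 →ₗ.[ℂ] HTensor ι 𝓗 :=
  ((siteOp i S.invSqrt : HTensor ι 𝓗 →ₗ[ℂ] HTensor ι 𝓗).toPMap ⊤).inverse

/-- The form domain `D((H⁰_A) ^ (1/2)) = ⋂_{i ∈ A} D((H_i) ^ (1/2))` of `H⁰_A = ∑_{i ∈ A} H_i`. -/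
def formDomain (S : SiteData 𝓗) (A : Finset ι) : Submodule ℂ (HTensor ι 𝓗) :=
  ⨅ i ∈ A, (sqrtSite S i).domain

lemma formDomain_anti (S : SiteData 𝓗) {A B : Finset ι} (h : A ⊆ B) :
    formDomain S B ≤ formDomain S A :=
  biInf_mono fun _ hi => h hi

lemma formDomain_le (S : SiteData 𝓗) {A : Finset ι} {i : ι} (h : i ∈ A) :
    formDomain S A ≤ (sqrtSite S i).domain :=
  iInf₂_le i h

/-- Sesquilinear forms on `D((H⁰_A) ^ (1/2))`, conjugate linear in the first argument: the form of
an operator `V` is `(x, y) ↦ ⟪x, V y⟫`. -/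
abbrev Form (S : SiteData 𝓗) (A : Finset ι) : Type _ :=
  formDomain S A →ₗ⋆[ℂ] formDomain S A →ₗ[ℂ] ℂ

variable {S : SiteData 𝓗} {A B : Finset ι}

open Classical in
/-- The value `v(x, y)` for `x`, `y` in the form domain (and `0` for other vectors). -/
def Form.eval (v : Form S A) (x y : HTensor ι 𝓗) : ℂ :=
  if h : x ∈ formDomain S A ∧ y ∈ formDomain S A then v ⟨x, h.1⟩ ⟨y, h.2⟩ else 0

/-- The form of the identity, `(x, y) ↦ ⟪x, y⟫`. -/
def formOne (S : SiteData 𝓗) (A : Finset ι) : Form S A :=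
  LinearMap.mk₂'ₛₗ (starRingEnd ℂ) (RingHom.id ℂ)
    (fun x y => inner ℂ (x : HTensor ι 𝓗) (y : HTensor ι 𝓗))
    (fun x x' y => by simp [inner_add_left]) (fun c x y => by simp [inner_smul_left])
    (fun x y y' => by simp [inner_add_right]) (fun c x y => by simp [inner_smul_right])

/-- The form of `H_i + 1` on `D((H⁰_A) ^ (1/2))`, for `i ∈ A`. -/
def formSiteAddOne (S : SiteData 𝓗) (A : Finset ι) (i : A) : Form S A :=
  let L : formDomain S A →ₗ[ℂ] HTensor ι 𝓗 :=
    (sqrtSite S (i : ι)).toFun.comp (Submodule.inclusion (formDomain_le S i.2))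
  LinearMap.mk₂'ₛₗ (starRingEnd ℂ) (RingHom.id ℂ) (fun x y => inner ℂ (L x) (L y))
    (fun x x' y => by simp [inner_add_left]) (fun c x y => by simp [inner_smul_left])
    (fun x y y' => by simp [inner_add_right]) (fun c x y => by simp [inner_smul_right])

/-- The form of `H⁰_A = ∑_{i ∈ A} H_i`. -/
def formH0 (S : SiteData 𝓗) (A : Finset ι) : Form S A :=
  ∑ i : A, (formSiteAddOne S A i - formOne S A)

open Classical in
/-- `‖(H⁰_A + 1) ^ (1/2) x‖`, equal to `∞` for `x` outside the domain of `(H⁰_A) ^ (1/2)`. -/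
def weight (S : SiteData 𝓗) (A : Finset ι) (x : HTensor ι 𝓗) : ℝ≥0∞ :=
  if x ∈ formDomain S A then
    ENNReal.ofReal (Real.sqrt (((formH0 S A + formOne S A).eval x x).re))
  else ⊤

/-- `P⁻_A`: the projection onto `Ω` in the factors `i ∈ A`, the identity in the others. -/
def projMinus (S : SiteData 𝓗) (A : Finset ι) : HTensor ι 𝓗 →L[ℂ] HTensor ι 𝓗 :=
  tensorMap fun i => if i ∈ A then S.projΩ else 1

/-- `P⁺_A = 1 - P⁻_A`. -/
def projPlus (S : SiteData 𝓗) (A : Finset ι) : HTensor ι 𝓗 →L[ℂ] HTensor ι 𝓗 :=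
  1 - projMinus S A

/-- The number operator `π_A = ∑_{i ∈ A} (1 - P_{Ω_i})`. -/
def numberOp (S : SiteData 𝓗) (A : Finset ι) : HTensor ι 𝓗 →L[ℂ] HTensor ι 𝓗 :=
  ∑ i ∈ A, (1 - siteOp i S.projΩ)

/-- `(π_A + 1) ^ (-1/2)`, by the continuous functional calculus. -/
def numberWeight (S : SiteData 𝓗) (A : Finset ι) : HTensor ι 𝓗 →L[ℂ] HTensor ι 𝓗 :=
  cfc (fun x : ℝ => (x + 1) ^ (-(1 / 2) : ℝ)) (numberOp S A)

/-- The product vector `⨂ Ω`. -/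
def vacuum (S : SiteData 𝓗) : HTensor ι 𝓗 := htprod fun _ => S.Ω

open Classical in
/-- A form on `D((H⁰_A) ^ (1/2))`, regarded as one on `D((H⁰_B) ^ (1/2))`, for `A ⊆ B`. -/
def Form.extend (B : Finset ι) (v : Form S A) : Form S B :=
  if h : A ⊆ B then
    (v.comp (Submodule.inclusion (formDomain_anti S h))).compl₂
      (Submodule.inclusion (formDomain_anti S h))
  else 0

open Classical in
/-- The form `(x, y) ↦ v(X† x, Y y)` of `X v Y`, for bounded operators `X`, `Y` such that `X†` and
`Y` leave the form domain invariant. -/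
def Form.sandwich (X Y : HTensor ι 𝓗 →L[ℂ] HTensor ι 𝓗) (v : Form S A) : Form S A :=
  if h : (∀ x ∈ formDomain S A, (ContinuousLinearMap.adjoint X : _ →ₗ[ℂ] _) x ∈ formDomain S A) ∧
      ∀ x ∈ formDomain S A, (Y : _ →ₗ[ℂ] _) x ∈ formDomain S A then
    (v.comp ((ContinuousLinearMap.adjoint X : _ →ₗ[ℂ] _).restrict h.1)).compl₂
      ((Y : _ →ₗ[ℂ] _).restrict h.2)
  else 0

/-- The commutator `ad X (v) = X v - v X`. -/
def Form.ad (X : HTensor ι 𝓗 →L[ℂ] HTensor ι 𝓗) (v : Form S A) : Form S A :=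
  v.sandwich X 1 - v.sandwich 1 X

/-- The block-diagonal part `P⁺ v P⁺ + P⁻ v P⁻`. -/
def Form.diag (v : Form S A) : Form S A :=
  v.sandwich (projPlus S A) (projPlus S A) + v.sandwich (projMinus S A) (projMinus S A)

open Classical in
/-- The sum of a series of forms. -/
def Form.tsum (f : ℕ → Form S A) : Form S A :=
  if h : ∀ x y, Summable fun n => f n x y then
    LinearMap.mk₂'ₛₗ (starRingEnd ℂ) (RingHom.id ℂ) (fun x y => ∑' n, f n x y)
      (fun x x' y => by simp only [map_add, LinearMap.add_apply]; exact (h x y).tsum_add (h x' y))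
      (fun c x y => by
        simp only [LinearMap.map_smulₛₗ, LinearMap.smul_apply, smul_eq_mul, tsum_mul_left])
      (fun x y y' => by simp only [map_add]; exact (h x y).tsum_add (h x y'))
      (fun c x y => by simp only [map_smul, smul_eq_mul, tsum_mul_left, RingHom.id_apply])
  else 0

/-- The weighted norm `‖(H⁰_A + 1) ^ (-1/2) v (H⁰_A + 1) ^ (-1/2)‖`, with values in `[0, ∞]`. -/
def Form.normH0 (v : Form S A) : ℝ≥0∞ :=
  sInf {C | ∀ x ∈ formDomain S A, ∀ y ∈ formDomain S A,
    ‖v.eval x y‖ₑ ≤ C * weight S A x * weight S A y}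

/-- `v` is symmetric. -/
def Form.IsSymm (v : Form S A) : Prop := ∀ x y, starRingEnd ℂ (v x y) = v y x

/-- `v` acts as the identity on the factors `j ∉ A`: it commutes with all bounded operators on these
factors. -/
def Form.IsLocal (v : Form S A) : Prop :=
  ∀ j ∉ A, ∀ b : 𝓗 →L[ℂ] 𝓗, ∀ x ∈ formDomain S A, ∀ y ∈ formDomain S A,
    v.eval x (siteOp j b y) = v.eval (ContinuousLinearMap.adjoint (siteOp j b) x) y

/-- The operator `T = (G - E)⁻¹ P⁺_A v P⁻_A`, in terms of the form `g` of `G`: `T y` is the vector in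
the range of `P⁺_A` and in the form domain with `⟪z, (G - E) T y⟫ = v(P⁺_A z, P⁻_A y)`. -/
def IsResolventTerm (g : Form S A) (E : ℂ) (v : Form S A)
    (T : HTensor ι 𝓗 →L[ℂ] HTensor ι 𝓗) : Prop :=
  ∀ y, T y ∈ formDomain S A ∧ projPlus S A (T y) = T y ∧ ∀ z ∈ formDomain S A,
    g.eval z (T y) - E * inner ℂ z (T y) = v.eval (projPlus S A z) (projMinus S A y)

open Classical in
/-- `(G - E)⁻¹ P⁺_A v P⁻_A`. -/
def resolventTerm (g : Form S A) (E : ℂ) (v : Form S A) : HTensor ι 𝓗 →L[ℂ] HTensor ι 𝓗 :=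
  if h : ∃! T, IsResolventTerm g E v T then h.choose else 0

/-- `(G - E)⁻¹ P⁺_A v P⁻_A - h.c.` -/
def antiTerm (g : Form S A) (E : ℂ) (v : Form S A) : HTensor ι 𝓗 →L[ℂ] HTensor ι 𝓗 :=
  resolventTerm g E v - ContinuousLinearMap.adjoint (resolventTerm g E v)

/-- The terms `v_j`, `j ≥ 1`, of the Lie-Schwinger series of `G + t v`: `v_1 = v` and, with
`S_r = (G - E)⁻¹ P⁺ v_r P⁻ - h.c.`,
`v_j = ∑_{p ≥ 2, r_1 + ⋯ + r_p = j} (1 / p!) ad S_{r_1} (⋯ ad S_{r_p} (G)) +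
∑_{p ≥ 1, r_1 + ⋯ + r_p = j - 1} (1 / p!) ad S_{r_1} (⋯ ad S_{r_p} (v))` for `j ≥ 2`. A
`Composition j` is a list of positive integers with sum `j`; the test `r < j`, always true
here, makes the recursion visibly well founded. -/
def seriesV (g : Form S A) (E : ℂ) (v : Form S A) : ℕ → Form S A
  | 0 => 0
  | 1 => v
  | j + 2 =>
    (∑ c : Composition (j + 2), if 2 ≤ c.length then
      ((c.length.factorial : ℂ)⁻¹) • c.blocks.foldr (fun r w =>
        Form.ad (if _h : r < j + 2 then antiTerm g E (seriesV g E v r) else 0) w) g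
      else 0) +
    ∑ c : Composition (j + 1), ((c.length.factorial : ℂ)⁻¹) • c.blocks.foldr (fun r w =>
        Form.ad (if _h : r < j + 2 then antiTerm g E (seriesV g E v r) else 0) w) v
  termination_by j => j

/-- The Lie-Schwinger generator `∑_{j ≥ 1} t ^ j S_j`. -/
def generator (t : ℝ) (g : Form S A) (E : ℂ) (v : Form S A) :
    HTensor ι 𝓗 →L[ℂ] HTensor ι 𝓗 :=
  ∑' j : ℕ, ((t : ℂ) ^ (j + 1)) • antiTerm g E (seriesV g E v (j + 1))

/-- The block-diagonalized potential `∑_{j ≥ 1} t ^ (j - 1) (v_j)^{diag}`. -/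
def diagonalized (t : ℝ) (g : Form S A) (E : ℂ) (v : Form S A) : Form S A :=
  Form.tsum fun j => ((t : ℂ) ^ j) • (seriesV g E v (j + 1)).diag

/-- `∑_{n ≥ 1} (1 / n!) ad^n X (v)`. -/
def adExp (X : HTensor ι 𝓗 →L[ℂ] HTensor ι 𝓗) (v : Form S A) : Form S A :=
  Form.tsum fun n => (((n + 1).factorial : ℂ)⁻¹) • (Form.ad X)^[n + 1] v

/-- `‖(H⁰_A + 1) ^ (1/2) (π_A + 1) ^ (-1/2) T‖`, with values in `[0, ∞]`. -/
def weightedNorm (S : SiteData 𝓗) (A : Finset ι) (T : HTensor ι 𝓗 →L[ℂ] HTensor ι 𝓗) : ℝ≥0∞ :=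
  sInf {C | ∀ y, weight S A (numberWeight S A (T y)) ≤ C * ‖y‖ₑ}

/-- `‖(π_A + 1) ^ (-1/2) (H⁰_A + 1) ^ (-1/2) P⁺_A v P⁻_A‖`, with values in `[0, ∞]`: the supremum of
`|v(P⁺_A (π_A + 1) ^ (-1/2) x, P⁻_A y)|` over `‖(H⁰_A + 1) ^ (1/2) x‖ ≤ 1` and `‖y‖ ≤ 1` (the
two weights commute). -/
def Form.doublyWeightedNorm (v : Form S A) : ℝ≥0∞ :=
  sInf {C | ∀ x ∈ formDomain S A, ∀ y,
    ‖v.eval (projPlus S A (numberWeight S A x)) (projMinus S A y)‖ₑ ≤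
      C * weight S A x * ‖y‖ₑ}

end Lattice

section Rectangles

/-- The sites `(i_1, …, i_d)`, `1 ≤ i_j ≤ N`. -/
abbrev Site (d N : ℕ) : Type := Fin d → Finset.Icc 1 N

/-- The rectangle with corner `q` and side lengths `k` in the lattice `{1, …, N} ^ d`. -/
@[ext]
structure Rect (d N : ℕ) where
  k : Fin d → ℕ
  q : Fin d → ℕ
  one_le : ∀ j, 1 ≤ q j
  le_N : ∀ j, q j + k j ≤ N

namespace Rect

variable {d N : ℕ}

instance : Finite (Rect d N) := by
  refine Finite.of_injective
    (fun J : Rect d N => ((fun j => ⟨J.k j, by have := J.le_N j; omega⟩,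
      fun j => ⟨J.q j, by have := J.le_N j; omega⟩) :
        (Fin d → Fin (N + 1)) × (Fin d → Fin (N + 1)))) fun J L h => ?_
  simp only [Prod.mk.injEq, funext_iff, Fin.mk.injEq] at h
  exact Rect.ext (funext h.1) (funext h.2)

instance : Fintype (Rect d N) := Fintype.ofFinite _

/-- The size `|k| = k_1 + ⋯ + k_d`. -/
def size (J : Rect d N) : ℕ := ∑ j, J.k j

/-- The set of sites of the rectangle. -/
def sites (J : Rect d N) : Finset (Site d N) :=
  {i | ∀ j, J.q j ≤ (i j : ℕ) ∧ (i j : ℕ) ≤ J.q j + J.k j}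

/-- The order on rectangles: by size; then, at the first side length that differs, the larger side
length comes first; then by the last corner coordinate that differs. -/
instance : LT (Rect d N) where
  lt J L := J.size < L.size ∨
    (J.size = L.size ∧ ∃ j, (∀ l < j, L.k l = J.k l) ∧ L.k j < J.k j) ∨
    ((∀ l, L.k l = J.k l) ∧ ∃ j, (∀ l, j < l → L.q l = J.q l) ∧ J.q j < L.q j)

instance : LE (Rect d N) where
  le J L := J = L ∨ J < L

/-- `J` is the smallest rectangle that contains `s` and `L`. -/
def IsHull (s L J : Rect d N) : Prop :=
  ∀ j, J.q j = min (s.q j) (L.q j) ∧ J.q j + J.k j = max (s.q j + s.k j) (L.q j + L.k j)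

/-- The position of the rectangle in the order. -/
def index (J : Rect d N) : ℕ := Nat.card {L : Rect d N // L < J}

end Rect

end Rectangles

section Algorithm

variable {d N : ℕ}
variable {𝓗 : Type*} [NormedAddCommGroup 𝓗] [InnerProductSpace ℂ 𝓗] [CompleteSpace 𝓗]

/-- A potential for every rectangle. -/
abbrev Potentials (S : SiteData 𝓗) (d N : ℕ) : Type _ := ∀ J : Rect d N, Form S J.sites

/-- A nearest-neighbour interaction: the potentials of the rectangles of size 1 are symmetric,
localized, and satisfy `|⟪φ, V_J φ⟫| ≤ (1/2) ⟪φ, (H⁰_J + 1) φ⟫`. (The other values are not used.) -/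
structure IsInteraction {S : SiteData 𝓗} (V : Potentials S d N) : Prop where
  symm : ∀ J : Rect d N, J.size = 1 → (V J).IsSymm
  isLocal : ∀ J : Rect d N, J.size = 1 → (V J).IsLocal
  bound : ∀ J : Rect d N, J.size = 1 → ∀ x ∈ formDomain S J.sites,
    ‖(V J).eval x x‖ ≤ 1 / 2 * ((formH0 S J.sites + formOne S J.sites).eval x x).re

variable {S : SiteData 𝓗}

open Classical in
/-- The form of `G_K = ∑_{i ∈ K} H_i + t ∑_{J ⊂ K, |J| ≥ 1} V_J`. -/
def formG (t : ℝ) (W : Potentials S d N) (K : Rect d N) : Form S K.sites :=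
  formH0 S K.sites +
    (t : ℂ) • ∑ J : Rect d N with J.sites ⊂ K.sites ∧ 1 ≤ J.size, (W J).extend K.sites

/-- `E_K = ⟪⨂ Ω, G_K ⨂ Ω⟫`. -/
def energy (t : ℝ) (W : Potentials S d N) (K : Rect d N) : ℂ :=
  (formG t W K).eval (vacuum S) (vacuum S)

/-- The generator `S_s` of the block-diagonalization of `G_s + t W_s`. -/
def stepGenerator (t : ℝ) (W : Potentials S d N) (s : Rect d N) :
    HTensor (Site d N) 𝓗 →L[ℂ] HTensor (Site d N) 𝓗 :=
  generator t (formG t W s) (energy t W s) (W s)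

/-- The potentials before the first step: `H_i` on the sites, the interaction on the rectangles of
size 1, and zero on the larger ones. -/
def initial (V : Potentials S d N) : Potentials S d N := fun J =>
  if J.size = 0 then formH0 S J.sites else if J.size = 1 then V J else 0

open Classical in
/-- The step of the algorithm that block-diagonalizes the potential of `s`, from the potentials `W`
after the previous step: a potential is unchanged unless its rectangle contains `s`; that of `s`
becomes its block-diagonalization; and to that of `J ⊃ s` one adds
`∑_L ∑_{n ≥ 1} (1 / n!) ad^n S_s (W_L)`, over the rectangles `L` that meet `s` and for which `J`
is the smallest rectangle containing `s` and `L`. -/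
def step (t : ℝ) (s : Rect d N) (W : Potentials S d N) : Potentials S d N := fun J =>
  if J = s then diagonalized t (formG t W J) (energy t W J) (W J)
  else if s.sites ⊂ J.sites then
    W J + ∑ L : Rect d N with L.sites ⊆ J.sites ∧ (s.sites ∩ L.sites).Nonempty ∧ s.IsHull L J,
      adExp (stepGenerator t W s) ((W L).extend J.sites)
  else W J

open Classical in
/-- The potentials after the step number `n`; no step is done at rectangles of size 0. -/
def effectiveAux (t : ℝ) (V : Potentials S d N) : ℕ → Potentials S d N
  | 0 => initial V
  | n + 1 =>
    if h : ∃ s : Rect d N, s.index = n + 1 ∧ 1 ≤ s.size then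
      step t h.choose (effectiveAux t V n)
    else effectiveAux t V n

/-- The effective potentials `V^{(s)}_J` in step `s`. -/
def effective (t : ℝ) (V : Potentials S d N) (s : Rect d N) : Potentials S d N :=
  effectiveAux t V s.index

/-- The inductive bounds on the potential `v` of the rectangle `J` (of size `r ≥ 1`) in step `s`, with
thresholds `a` and `b` between the regimes and `x_d = 20 d`. -/
structure InductiveBounds (t : ℝ) (s J a b : Rect d N) (v : Form S J.sites) : Prop where
  small : s < a → v.normH0 ≤ ENNReal.ofReal
    (t ^ (((J.size : ℝ) - 1) / 3) / (J.size : ℝ) ^ (20 * d + 2 * d))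
  middle : a ≤ s → s < b → v.normH0 ≤ ENNReal.ofReal
    (2 * (t ^ (((J.size : ℝ) - 1) / 3) / (J.size : ℝ) ^ (20 * d + 2 * d)))
  large : b ≤ s → s < J → v.normH0 ≤ ENNReal.ofReal
    (48 * (t ^ (((J.size : ℝ) - 1) / 3) / (J.size : ℝ) ^ (20 * d)))
  final : J ≤ s → v.normH0 ≤ ENNReal.ofReal
    (96 * (t ^ (((J.size : ℝ) - 1) / 3) / (J.size : ℝ) ^ (20 * d)))

end Algorithm

end

end LieSchwinger

/-!
Let `g` be the form of `G_K - E_K`. It is `H⁰_K` plus `t` times the sum over `J ⊂ K` of the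
potentials `V_J`, each shifted by its vacuum expectation value. A rectangle `J ⊂ K` precedes `K`,
so its potential is already block diagonal and bounded by `96 / r ^ (20 d)`, `r = |J|`; since
`H⁰_J ≥ 1` off the vacuum of `J`, the shifted potential is bounded by `3 · 96 / r ^ (20 d)`
relative to `H⁰_J`, without the additional `+ 1`. Summing over the rectangles through a site and
then over the sites gives `|(g - H⁰_K)(x, x)| ≤ 1/2 ⟪x, H⁰_K x⟫` for small `t`. So `g` is coercive
on the range of `P⁺_K`, and the Lax-Milgram argument yields the resolvent term `T`.

For the weighted bound, test the equation of `T y` against `w = [π_K]₁^{-1/2} T y`, weighted once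
more: `g([π_K]₁^{-1/2} w, [π_K]₁^{1/2} w)` is the value of `V_K` to be estimated. It still
dominates `1/2 ⟪w, H⁰_K w⟫`, because `H⁰_K` commutes with `π_K` and a potential of `J` commutes
with `π_{K \ J}`, so that the weights cost only a factor `|J| + 1` for it, which the decay in `r`
absorbs.
-/

open scoped TensorProduct ENNReal

namespace LieSchwinger

noncomputable section

section TensorOperators

variable {ι E : Type*} [Fintype ι] [NormedAddCommGroup E] [InnerProductSpace ℂ E]

variable (ι E) in
/-- The elementary tensors `htprod`, bundled as a multilinear map. -/
def htprodMultilinear : MultilinearMap ℂ (fun _ : ι => E) (HTensor ι E) :=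
  (UniformSpace.Completion.toComplL (𝕜 := ℂ) (E := AlgTensor ι E)).toLinearMap.compMultilinearMap
    (PiTensorProduct.tprod ℂ)

lemma htprodMultilinear_apply (x : ι → E) : htprodMultilinear ι E x = htprod x := rfl

lemma htprod_smul (c : ι → ℂ) (x : ι → E) :
    htprod (fun i => c i • x i) = (∏ i, c i) • htprod x :=
  (htprodMultilinear ι E).map_smul_univ c x

lemma htprod_eq_zero {x : ι → E} {i : ι} (h : x i = 0) : htprod x = 0 :=
  (htprodMultilinear ι E).map_coord_zero i h

lemma inner_htprod (x y : ι → E) :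
    inner ℂ (htprod x) (htprod y) = ∏ i, inner ℂ (x i) (y i) :=
  (UniformSpace.Completion.inner_coe _ _).trans (algInnerFlip_tprod y x)

lemma norm_htprod (x : ι → E) : ‖htprod x‖ = ∏ i, ‖x i‖ := by
  refine (sq_eq_sq₀ (norm_nonneg _) (by positivity)).1 ?_
  rw [← Complex.ofReal_inj, ← Finset.prod_pow]
  push_cast
  simp only [← inner_self_eq_norm_sq_to_K (𝕜 := ℂ), ← Complex.coe_algebraMap, inner_htprod]

lemma continuous_htprod : Continuous (htprod : (ι → E) → HTensor ι E) :=
  ((htprodMultilinear ι E).mkContinuous 1 fun x => by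
    rw [htprodMultilinear_apply, norm_htprod, one_mul]).cont

lemma tensorMap_htprod (B : ι → E →L[ℂ] E) (x : ι → E) :
    tensorMap B (htprod x) = htprod fun i => B i (x i) :=
  (ContinuousLinearMap.completion_apply_coe _ _).trans
    (congrArg ((↑) : AlgTensor ι E → HTensor ι E) (algTensorLin_tprod B x))

variable (ι E) in
lemma dense_span_htprod :
    Dense (Submodule.span ℂ (Set.range (htprod : (ι → E) → HTensor ι E)) : Set (HTensor ι E)) := by
  refine (UniformSpace.Completion.denseRange_coe (α := AlgTensor ι E)).mono ?_
  rintro _ ⟨x, rfl⟩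
  obtain ⟨s, c, rfl⟩ := exists_sum_algTprod x
  rw [← UniformSpace.Completion.coe_toComplL (𝕜 := ℂ), map_sum]
  exact Submodule.sum_mem _ fun v _ => by
    rw [map_smul]
    exact Submodule.smul_mem _ _ (Submodule.subset_span ⟨v, rfl⟩)

lemma htensor_clm_ext {F : Type*} [AddCommMonoid F] [Module ℂ F] [TopologicalSpace F] [T2Space F]
    {f g : HTensor ι E →L[ℂ] F} (h : ∀ x, f (htprod x) = g (htprod x)) : f = g :=
  ContinuousLinearMap.ext_on (dense_span_htprod ι E) (Set.forall_mem_range.2 h)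

lemma inner_ext_htprod {f g : HTensor ι E →L[ℂ] HTensor ι E}
    (h : ∀ x y, inner ℂ (htprod x) (f (htprod y)) = inner ℂ (htprod x) (g (htprod y))) :
    f = g := by
  refine htensor_clm_ext fun y => (innerSL_inj (𝕜 := ℂ)).1 (htensor_clm_ext fun x => ?_)
  rw [innerSL_apply_apply, innerSL_apply_apply, ← inner_conj_symm, h, inner_conj_symm]

lemma tensorMap_mul (B C : ι → E →L[ℂ] E) :
    tensorMap B * tensorMap C = tensorMap fun i => B i * C i :=
  htensor_clm_ext fun x => by
    simp only [mul_apply_eq_comp, tensorMap_htprod]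

lemma tensorMap_one : tensorMap (fun _ : ι => (1 : E →L[ℂ] E)) = 1 :=
  htensor_clm_ext fun x => by simp only [tensorMap_htprod, one_apply_eq_self]

lemma tensorMap_eq_zero {B : ι → E →L[ℂ] E} {i : ι} (h : B i = 0) : tensorMap B = 0 :=
  htensor_clm_ext fun x => by
    rw [tensorMap_htprod]
    exact htprod_eq_zero (i := i) (by simp [h])

lemma siteOp_htprod [DecidableEq ι] (i : ι) (b : E →L[ℂ] E) (x : ι → E) :
    siteOp i b (htprod x) = htprod (Function.update x i (b (x i))) := by
  rw [siteOp, tensorMap_htprod]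
  congr 1
  ext1 j
  rcases eq_or_ne j i with rfl | h
  · simp
  · simp [Function.update_of_ne h]

lemma commute_siteOp_tensorMap [DecidableEq ι] {i : ι} {b : E →L[ℂ] E} {B : ι → E →L[ℂ] E}
    (h : Commute b (B i)) : Commute (siteOp i b) (tensorMap B) := by
  rw [siteOp, Commute, SemiconjBy, tensorMap_mul, tensorMap_mul]
  congr 1
  ext1 j
  rcases eq_or_ne j i with rfl | hj
  · simpa using h.eq
  · simp [Function.update_of_ne hj]

lemma commute_siteOp_of_ne [DecidableEq ι] {i j : ι} (hij : i ≠ j) (b c : E →L[ℂ] E) :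
    Commute (siteOp i b) (siteOp j c) :=
  commute_siteOp_tensorMap (by simp [Function.update_of_ne hij])

variable [CompleteSpace E]

lemma adjoint_tensorMap (B : ι → E →L[ℂ] E) :
    ContinuousLinearMap.adjoint (tensorMap B) =
      tensorMap fun i => ContinuousLinearMap.adjoint (B i) :=
  inner_ext_htprod fun x y => by
    simp only [ContinuousLinearMap.adjoint_inner_right, tensorMap_htprod, inner_htprod]

variable [DecidableEq ι]

/-- The embedding `siteOp i` of the operators on the factor `i`, bundled as a `⋆`-homomorphism. -/
def siteHom (i : ι) : (E →L[ℂ] E) →⋆ₐ[ℂ] (HTensor ι E →L[ℂ] HTensor ι E) where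
  toFun := siteOp i
  map_one' := by rw [siteOp, Function.update_one]; exact tensorMap_one
  map_mul' b c := htensor_clm_ext fun x => by simp [siteOp_htprod]
  map_zero' := tensorMap_eq_zero (i := i) (Function.update_self ..)
  map_add' b c := htensor_clm_ext fun x => by
    simp only [siteOp_htprod, add_apply]
    exact (htprodMultilinear ι E).map_update_add x i (b (x i)) (c (x i))
  commutes' c := htensor_clm_ext fun x => by
    simp only [siteOp_htprod, Algebra.algebraMap_eq_smul_one, smul_apply,
      one_apply_eq_self]
    exact ((htprodMultilinear ι E).map_update_smul x i c (x i)).trans (by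
      rw [Function.update_eq_self]; rfl)
  map_star' b := by
    refine Eq.symm ((adjoint_tensorMap _).trans ?_)
    congr 1
    ext1 j
    rcases eq_or_ne j i with rfl | h
    · simp [ContinuousLinearMap.star_eq_adjoint]
    · simp only [Function.update_of_ne h]
      exact star_one (E →L[ℂ] E)

lemma siteOp_one (i : ι) : siteOp i (1 : E →L[ℂ] E) = 1 := map_one (siteHom i)

lemma siteOp_mul (i : ι) (b c : E →L[ℂ] E) : siteOp i (b * c) = siteOp i b * siteOp i c :=
  map_mul (siteHom i) b c

lemma siteOp_sub (i : ι) (b c : E →L[ℂ] E) : siteOp i (b - c) = siteOp i b - siteOp i c :=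
  map_sub (siteHom i) b c

lemma adjoint_siteOp (i : ι) (b : E →L[ℂ] E) :
    ContinuousLinearMap.adjoint (siteOp i b) = siteOp i (ContinuousLinearMap.adjoint b) :=
  (map_star (siteHom i) b).symm

lemma norm_siteOp_apply_le (i : ι) (b : E →L[ℂ] E) (x : HTensor ι E) :
    ‖siteOp i b x‖ ≤ ‖b‖ * ‖x‖ :=
  (siteOp i b).le_of_opNorm_le (NonUnitalStarAlgHom.norm_apply_le (siteHom i) b) x

lemma injective_siteOp {i : ι} {b : E →L[ℂ] E} (hb : DenseRange (ContinuousLinearMap.adjoint b)) :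
    Function.Injective (siteOp i b) := by
  refine (injective_iff_map_eq_zero _).2 fun x hx => ?_
  have horth : ∀ z : ι → E, inner ℂ x (htprod z) = 0 := fun z => by
    have hrange : ∀ w, inner ℂ x
        (htprod (Function.update z i (ContinuousLinearMap.adjoint b w))) = 0 := fun w => by
      rw [show htprod (Function.update z i (ContinuousLinearMap.adjoint b w)) =
          ContinuousLinearMap.adjoint (siteOp i b) (htprod (Function.update z i w)) by
        simp [adjoint_siteOp, siteOp_htprod], ContinuousLinearMap.adjoint_inner_right, hx,
        inner_zero_left]
    have hcont : Continuous fun w => inner ℂ x (htprod (Function.update z i w)) :=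
      continuous_const.inner (continuous_htprod.comp (continuous_const.update i continuous_id))
    simpa using congrFun (hb.equalizer hcont continuous_const (funext hrange)) (z i)
  have hx0 : innerSL ℂ x = 0 := htensor_clm_ext fun z => by simpa using horth z
  exact innerSL_inj.1 (hx0.trans (map_zero _).symm)

end TensorOperators

lemma re_inner_self {E : Type*} [NormedAddCommGroup E] [InnerProductSpace ℂ E] (x : E) :
    (inner ℂ x x).re = ‖x‖ ^ 2 :=
  inner_self_eq_norm_sq (𝕜 := ℂ) x

section Resolvent

variable {E : Type*} [NormedAddCommGroup E] [InnerProductSpace ℂ E] {A : E →ₗ.[ℂ] E}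

lemma norm_sq_le_re_inner_apply_add (hA : ∀ x : A.domain, 0 ≤ (inner ℂ (A x) (x : E)).re)
    (x : A.domain) : ‖(x : E)‖ ^ 2 ≤ (inner ℂ (A x + (x : E)) (x : E)).re := by
  rw [inner_add_left, Complex.add_re, re_inner_self]
  exact le_add_of_nonneg_left (hA x)

lemma norm_le_norm_apply_add (hA : ∀ x : A.domain, 0 ≤ (inner ℂ (A x) (x : E)).re)
    (x : A.domain) : ‖(x : E)‖ ≤ ‖A x + (x : E)‖ := by
  rcases (norm_nonneg (x : E)).eq_or_lt with hx | hx
  · rw [← hx]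
    exact norm_nonneg _
  · refine le_of_mul_le_mul_right ?_ hx
    rw [← sq]
    exact (norm_sq_le_re_inner_apply_add hA x).trans (re_inner_le_norm (𝕜 := ℂ) _ _)

variable (A) in
/-- The map `(x, A x) ↦ A x + x` on the graph of `A`. The operator `A + 1` is invertible if and only
if this bounded map between Hilbert spaces is. -/
def graphAdd : A.graph →L[ℂ] E :=
  (ContinuousLinearMap.snd ℂ E E + ContinuousLinearMap.fst ℂ E E).comp A.graph.subtypeL

lemma graphAdd_mk (x : A.domain) :
    graphAdd A ⟨((x : E), A x), A.mem_graph x⟩ = A x + (x : E) := rfl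

lemma exists_apply_fst_add_eq_graphAdd (p : A.graph) :
    ∃ h : (p : E × E).1 ∈ A.domain, A ⟨(p : E × E).1, h⟩ + (p : E × E).1 = graphAdd A p := by
  obtain ⟨⟨_, _⟩, hp⟩ := p
  obtain ⟨x, rfl, rfl⟩ := (LinearPMap.mem_graph_iff _).1 hp
  exact ⟨x.2, rfl⟩

lemma norm_le_two_mul_norm_graphAdd (hA : ∀ x : A.domain, 0 ≤ (inner ℂ (A x) (x : E)).re)
    (p : A.graph) : ‖p‖ ≤ 2 * ‖graphAdd A p‖ := by
  obtain ⟨⟨_, _⟩, hp⟩ := p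
  obtain ⟨x, rfl, rfl⟩ := (LinearPMap.mem_graph_iff _).1 hp
  have hx := norm_le_norm_apply_add hA x
  have hAx : ‖A x‖ ≤ ‖A x + (x : E)‖ + ‖(x : E)‖ := by
    simpa using norm_sub_le (A x + (x : E)) x
  rw [graphAdd_mk, Submodule.coe_norm, Prod.norm_def]
  exact max_le (by linarith [norm_nonneg (x : E)]) (by linarith)

variable [CompleteSpace E]

lemma inner_apply_left_of_isSelfAdjoint (hA : IsSelfAdjoint A) (x y : A.domain) :
    inner ℂ (A x) (y : E) = inner ℂ (x : E) (A y) := by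
  have h := LinearPMap.adjoint_isFormalAdjoint hA.dense_domain
  rw [LinearPMap.isSelfAdjoint_def.1 hA] at h
  exact h x y

lemma exists_apply_eq_of_forall_inner (hA : IsSelfAdjoint A) {z w : E}
    (h : ∀ x : A.domain, inner ℂ w (x : E) = inner ℂ z (A x)) :
    ∃ hz : z ∈ A.domain, A ⟨z, hz⟩ = w := by
  have hz : z ∈ A.adjoint.domain := LinearPMap.mem_adjoint_domain_of_exists z ⟨w, h⟩
  have hzw : A.adjoint ⟨z, hz⟩ = w := LinearPMap.adjoint_apply_eq hA.dense_domain ⟨z, hz⟩ h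
  have hAA := LinearPMap.ext_iff.1 (LinearPMap.isSelfAdjoint_def.1 hA)
  exact ⟨hAA.1 ▸ hz, (@hAA.2 z hz (hAA.1 ▸ hz)).symm.trans hzw⟩

lemma orthogonal_range_graphAdd (hA : IsSelfAdjoint A)
    (hA₀ : ∀ x : A.domain, 0 ≤ (inner ℂ (A x) (x : E)).re) : (graphAdd A).rangeᗮ = ⊥ := by
  refine (Submodule.eq_bot_iff _).2 fun z hz => ?_
  obtain ⟨hzA, hz_neg⟩ := exists_apply_eq_of_forall_inner hA (z := z) (w := -z) fun x => by
    have := (Submodule.mem_orthogonal' _ _).1 hz _ ⟨_, graphAdd_mk x⟩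
    rw [inner_add_right] at this
    rw [inner_neg_left, eq_neg_of_add_eq_zero_left this]
  simpa [hz_neg] using norm_le_norm_apply_add hA₀ ⟨z, hzA⟩

lemma graphAdd_bijective (hA : IsSelfAdjoint A)
    (hA₀ : ∀ x : A.domain, 0 ≤ (inner ℂ (A x) (x : E)).re) :
    Function.Bijective (graphAdd A) := by
  have : IsClosed (A.graph : Set (E × E)) := hA.isClosed
  have : CompleteSpace A.graph := this.completeSpace_coe
  rw [ContinuousLinearMap.bijective_iff_dense_range_and_antilipschitz]
  refine ⟨?_, 2, AddMonoidHomClass.antilipschitz_of_bound _ fun p => ?_⟩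
  · rw [Submodule.topologicalClosure_eq_top_iff]
    exact orthogonal_range_graphAdd hA hA₀
  · exact_mod_cast norm_le_two_mul_norm_graphAdd hA₀ p

lemma exists_clm_apply_add_eq (hA : IsSelfAdjoint A)
    (hA₀ : ∀ x : A.domain, 0 ≤ (inner ℂ (A x) (x : E)).re) :
    ∃ R : E →L[ℂ] E, ∀ x, ∃ h : R x ∈ A.domain, A ⟨R x, h⟩ + R x = x := by
  have : IsClosed (A.graph : Set (E × E)) := hA.isClosed
  have : CompleteSpace A.graph := this.completeSpace_coe
  have hbij := graphAdd_bijective hA hA₀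
  let e := ContinuousLinearEquiv.ofBijective (graphAdd A)
    (LinearMap.ker_eq_bot.2 hbij.1) (LinearMap.range_eq_top.2 hbij.2)
  refine ⟨(ContinuousLinearMap.fst ℂ E E).comp
    (A.graph.subtypeL.comp (e.symm : E →L[ℂ] A.graph)), fun x => ?_⟩
  obtain ⟨h, hA⟩ := exists_apply_fst_add_eq_graphAdd (e.symm x)
  exact ⟨h, hA.trans (e.apply_symm_apply x)⟩

end Resolvent

namespace SiteData

variable {𝓗 : Type*} [NormedAddCommGroup 𝓗] [InnerProductSpace ℂ 𝓗] [CompleteSpace 𝓗]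
variable (S : SiteData 𝓗)

lemma isResolvent_resolvent : S.IsResolvent S.resolvent := by
  have h : ∃ R, S.IsResolvent R := exists_clm_apply_add_eq S.selfAdjoint S.nonneg
  rw [resolvent, dif_pos h]
  exact h.choose_spec

/-- `(H + 1)⁻¹ x`, as an element of the domain of `H`. -/
def resolventDom (x : 𝓗) : S.H.domain := ⟨S.resolvent x, (S.isResolvent_resolvent x).1⟩

lemma coe_resolventDom (x : 𝓗) : (S.resolventDom x : 𝓗) = S.resolvent x := rfl

lemma H_resolventDom_add (x : 𝓗) : S.H (S.resolventDom x) + S.resolvent x = x :=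
  (S.isResolvent_resolvent x).2

lemma inner_resolvent_left (x y : 𝓗) :
    inner ℂ (S.resolvent x) y = inner ℂ x (S.resolvent y) := by
  conv_lhs => rw [← S.H_resolventDom_add y]
  conv_rhs => rw [← S.H_resolventDom_add x]
  rw [inner_add_left, inner_add_right, ← coe_resolventDom, ← coe_resolventDom,
    inner_apply_left_of_isSelfAdjoint S.selfAdjoint]

lemma resolvent_nonneg : 0 ≤ S.resolvent := by
  rw [ContinuousLinearMap.nonneg_iff_isPositive]
  refine ⟨S.inner_resolvent_left, fun x => ?_⟩
  change 0 ≤ (inner ℂ (S.resolvent x) x).re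
  have h := norm_sq_le_re_inner_apply_add S.nonneg (S.resolventDom x)
  rw [coe_resolventDom, H_resolventDom_add] at h
  rw [inner_resolvent_left]
  exact (sq_nonneg _).trans h

lemma resolvent_injective : Function.Injective S.resolvent := by
  refine (injective_iff_map_eq_zero _).2 fun x hx => ?_
  rw [← S.H_resolventDom_add x, hx, show S.resolventDom x = 0 from Subtype.ext hx,
    LinearPMap.map_zero, add_zero]

lemma resolvent_Ω : S.resolvent S.Ω = S.Ω := by
  have h := norm_le_norm_apply_add S.nonneg (S.resolventDom S.Ω - ⟨S.Ω, S.Ω_mem⟩)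
  rw [LinearPMap.map_sub, S.H_Ω, sub_zero, Submodule.coe_sub, coe_resolventDom,
    ← add_sub_assoc, H_resolventDom_add, sub_self, norm_zero, norm_le_zero_iff] at h
  exact sub_eq_zero.1 h

lemma re_inner_resolvent_le {x : 𝓗} (hx : inner ℂ S.Ω x = 0) :
    (inner ℂ (S.resolvent x) x).re ≤ 1 / 2 * ‖x‖ ^ 2 := by
  have horth : inner ℂ S.Ω (S.resolventDom x : 𝓗) = 0 := by
    rw [coe_resolventDom, ← inner_resolvent_left, resolvent_Ω, hx]
  have hgap : 2 * ‖S.resolvent x‖ ^ 2 ≤ (inner ℂ x (S.resolvent x)).re := by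
    have hle := S.gap (S.resolventDom x) horth
    rw [coe_resolventDom] at hle
    conv_rhs => rw [← S.H_resolventDom_add x, inner_add_left, Complex.add_re]
    rw [H_resolventDom_add, re_inner_self]
    linarith
  have hle : (inner ℂ (S.resolvent x) x).re ≤ ‖S.resolvent x‖ * ‖x‖ :=
    re_inner_le_norm (𝕜 := ℂ) _ _
  rw [← inner_resolvent_left] at hgap
  nlinarith [sq_nonneg (‖x‖ - 2 * ‖S.resolvent x‖)]

lemma invSqrt_mul_self : S.invSqrt * S.invSqrt = S.resolvent :=
  CFC.sqrt_mul_sqrt_self _ S.resolvent_nonneg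

lemma invSqrt_nonneg : 0 ≤ S.invSqrt := CFC.sqrt_nonneg _

lemma adjoint_invSqrt : ContinuousLinearMap.adjoint S.invSqrt = S.invSqrt :=
  IsSelfAdjoint.of_nonneg S.invSqrt_nonneg

lemma inner_invSqrt_left (x y : 𝓗) :
    inner ℂ (S.invSqrt x) y = inner ℂ x (S.invSqrt y) := by
  rw [← ContinuousLinearMap.adjoint_inner_right, adjoint_invSqrt]

lemma invSqrt_injective : Function.Injective S.invSqrt := by
  refine Function.Injective.of_comp (f := S.invSqrt) ?_
  have h : ⇑S.invSqrt ∘ ⇑S.invSqrt = S.resolvent :=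
    congrArg DFunLike.coe S.invSqrt_mul_self
  exact h ▸ S.resolvent_injective

lemma invSqrt_Ω : S.invSqrt S.Ω = S.Ω := by
  set w := S.invSqrt S.Ω - S.Ω with hw
  have hneg : S.invSqrt w = -w := by
    rw [hw, map_sub, ← mul_apply_eq_comp, invSqrt_mul_self, resolvent_Ω, neg_sub]
  have hpos : 0 ≤ (inner ℂ (S.invSqrt w) w).re :=
    ((ContinuousLinearMap.nonneg_iff_isPositive _).1 S.invSqrt_nonneg).2 w
  rw [hneg, inner_neg_left, Complex.neg_re, re_inner_self, neg_nonneg] at hpos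
  exact sub_eq_zero.1 (by simpa using hpos.antisymm (sq_nonneg _))

lemma projΩ_apply (x : 𝓗) : S.projΩ x = inner ℂ S.Ω x • S.Ω :=
  Submodule.starProjection_unit_singleton ℂ S.norm_Ω x

lemma inner_Ω_self : inner ℂ S.Ω S.Ω = 1 := by
  rw [inner_self_eq_norm_sq_to_K, S.norm_Ω]
  simp

lemma projΩ_Ω : S.projΩ S.Ω = S.Ω := by
  rw [projΩ_apply, inner_Ω_self, one_smul]

lemma isStarProjection_projΩ : IsStarProjection S.projΩ := isStarProjection_starProjection

lemma projΩ_mul_self : S.projΩ * S.projΩ = S.projΩ := S.isStarProjection_projΩ.isIdempotentElem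

lemma adjoint_projΩ : ContinuousLinearMap.adjoint S.projΩ = S.projΩ :=
  S.isStarProjection_projΩ.isSelfAdjoint

lemma invSqrt_mul_projΩ : S.invSqrt * S.projΩ = S.projΩ := by
  ext x
  rw [mul_apply_eq_comp, projΩ_apply, map_smul, invSqrt_Ω]

lemma projΩ_mul_invSqrt : S.projΩ * S.invSqrt = S.projΩ := by
  ext x
  rw [mul_apply_eq_comp, projΩ_apply, projΩ_apply, ← inner_invSqrt_left, invSqrt_Ω]

lemma norm_invSqrt_sq_le {x : 𝓗} (hx : inner ℂ S.Ω x = 0) :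
    ‖S.invSqrt x‖ ^ 2 ≤ 1 / 2 * ‖x‖ ^ 2 := by
  rw [← re_inner_self, inner_invSqrt_left, ← mul_apply_eq_comp, invSqrt_mul_self,
    ← inner_resolvent_left]
  exact S.re_inner_resolvent_le hx

lemma norm_invSqrt_mul_one_sub_projΩ_sq_le : ‖S.invSqrt * (1 - S.projΩ)‖ ^ 2 ≤ 1 / 2 := by
  refine (Real.le_sqrt (norm_nonneg _) (by norm_num)).1 <|
    ContinuousLinearMap.opNorm_le_bound _ (Real.sqrt_nonneg _) fun x => ?_
  have horth : inner ℂ S.Ω ((1 - S.projΩ) x) = 0 := by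
    rw [sub_apply, one_apply_eq_self, inner_sub_right, projΩ_apply, inner_smul_right,
      inner_Ω_self, mul_one, sub_self]
  have hle : ‖(1 - S.projΩ) x‖ ≤ ‖x‖ := by
    simpa using (1 - S.projΩ).le_of_opNorm_le S.isStarProjection_projΩ.one_sub.norm_le x
  refine (sq_le_sq₀ (norm_nonneg _) (by positivity)).1 ?_
  rw [mul_pow, Real.sq_sqrt (by norm_num), mul_apply_eq_comp]
  exact (S.norm_invSqrt_sq_le horth).trans (by gcongr)

end SiteData

section Sectors

variable {ι : Type*} [Fintype ι] [DecidableEq ι]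
variable {𝓗 : Type*} [NormedAddCommGroup 𝓗] [InnerProductSpace ℂ 𝓗] [CompleteSpace 𝓗]
variable (S : SiteData 𝓗)

/-- The projection onto the sector of `A`: the vectors excited (orthogonal to `Ω`) at the sites of
`A`, and equal to `Ω` at all others. -/
def sector (A : Finset ι) : HTensor ι 𝓗 →L[ℂ] HTensor ι 𝓗 :=
  tensorMap fun i => if i ∈ A then 1 - S.projΩ else S.projΩ

lemma sector_mul_self (A : Finset ι) : sector S A * sector S A = sector S A := by
  rw [sector, tensorMap_mul]
  congr 1 with i : 1
  split_ifs
  · exact S.isStarProjection_projΩ.one_sub.isIdempotentElem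
  · exact S.projΩ_mul_self

lemma sector_mul_sector_of_ne {A B : Finset ι} (h : A ≠ B) : sector S A * sector S B = 0 := by
  obtain ⟨i, hi⟩ : ∃ i, ¬(i ∈ A ↔ i ∈ B) := by
    by_contra! hAB
    exact h (Finset.ext hAB)
  rw [sector, sector, tensorMap_mul]
  refine tensorMap_eq_zero (i := i) ?_
  by_cases hA : i ∈ A <;> by_cases hB : i ∈ B
  · exact absurd (iff_of_true hA hB) hi
  · simp only [hA, hB, if_true, if_false, sub_mul, one_mul, S.projΩ_mul_self, sub_self]
  · simp only [hA, hB, if_true, if_false, mul_sub, mul_one, S.projΩ_mul_self, sub_self]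
  · exact absurd (iff_of_false hA hB) hi

lemma sector_mul_sector (A B : Finset ι) :
    sector S A * sector S B = if A = B then sector S A else 0 := by
  split_ifs with h
  · rw [← h, sector_mul_self]
  · exact sector_mul_sector_of_ne S h

lemma adjoint_sector (A : Finset ι) :
    ContinuousLinearMap.adjoint (sector S A) = sector S A := by
  rw [sector, adjoint_tensorMap]
  congr 1 with i : 1
  split_ifs
  · exact S.isStarProjection_projΩ.one_sub.isSelfAdjoint
  · exact S.adjoint_projΩ

variable (ι) in
lemma sum_sector : ∑ A : Finset ι, sector S A = 1 :=
  htensor_clm_ext fun x => by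
    have h := (htprodMultilinear ι 𝓗).map_add_univ (fun i => (1 - S.projΩ) (x i))
      (fun i => S.projΩ (x i))
    rw [show ((fun i => (1 - S.projΩ) (x i)) + fun i => S.projΩ (x i)) = x from
      funext fun i => by simp] at h
    rw [sum_apply, one_apply_eq_self]
    refine (Finset.sum_congr rfl fun A _ => ?_).trans h.symm
    rw [sector, tensorMap_htprod, htprodMultilinear_apply]
    congr 1 with i : 1
    by_cases hi : i ∈ A <;> simp [hi]

lemma sum_sector_apply (x : HTensor ι 𝓗) : ∑ A : Finset ι, sector S A x = x := by
  rw [← sum_apply, sum_sector, one_apply_eq_self]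

lemma siteOp_projΩ_mul_sector (i : ι) (A : Finset ι) :
    siteOp i S.projΩ * sector S A = if i ∈ A then 0 else sector S A := by
  rw [sector, siteOp, tensorMap_mul]
  split_ifs with h
  · exact tensorMap_eq_zero (i := i) (by simp [h, mul_sub, S.projΩ_mul_self])
  · congr 1 with j : 1
    rcases eq_or_ne j i with rfl | hj
    · simp [h, S.projΩ_mul_self]
    · simp [Function.update_of_ne hj]

lemma projMinus_mul_sector (B A : Finset ι) :
    projMinus S B * sector S A = if Disjoint A B then sector S A else 0 := by
  rw [sector, projMinus, tensorMap_mul]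
  split_ifs with h
  · congr 1 with j : 1
    by_cases hB : j ∈ B
    · simp [Finset.disjoint_right.1 h hB, hB, S.projΩ_mul_self]
    · simp [hB]
  · obtain ⟨j, hA, hB⟩ := Finset.not_disjoint_iff.1 h
    exact tensorMap_eq_zero (i := j) (by simp [hA, hB, mul_sub, S.projΩ_mul_self])

/-- The operators equal to a real scalar on every sector, as a `⋆`-algebra of functions of the
sector. -/
def diagHom : (Finset ι → ℝ) →⋆ₐ[ℝ] (HTensor ι 𝓗 →L[ℂ] HTensor ι 𝓗) where
  toFun F := ∑ A, (F A : ℂ) • sector S A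
  map_one' := by simp [sum_sector]
  map_mul' F G := by
    simp [Finset.sum_mul_sum, sector_mul_sector, smul_smul, mul_comm, -Complex.ofReal_mul]
  map_zero' := by simp
  map_add' F G := by simp [add_smul, Finset.sum_add_distrib]
  commutes' c := by
    simp [← Finset.smul_sum, sum_sector, Algebra.algebraMap_eq_smul_one]
  map_star' F := by
    simp [star_sum, ContinuousLinearMap.star_eq_adjoint, adjoint_sector]

/-- The self-adjoint operator equal to the scalar `F A` on the sector of `A`. -/
def diagOp (F : Finset ι → ℝ) : HTensor ι 𝓗 →L[ℂ] HTensor ι 𝓗 := diagHom S F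

lemma diagOp_eq_sum (F : Finset ι → ℝ) : diagOp S F = ∑ A, (F A : ℂ) • sector S A := rfl

lemma diagOp_one : diagOp S (1 : Finset ι → ℝ) = 1 := map_one (diagHom S)

lemma diagOp_mul (F G : Finset ι → ℝ) : diagOp S F * diagOp S G = diagOp S (F * G) :=
  (map_mul (diagHom S) F G).symm

lemma isSelfAdjoint_diagOp (F : Finset ι → ℝ) : IsSelfAdjoint (diagOp S F) :=
  (IsSelfAdjoint.all F).map (diagHom S)

lemma adjoint_diagOp (F : Finset ι → ℝ) :
    ContinuousLinearMap.adjoint (diagOp S F) = diagOp S F :=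
  isSelfAdjoint_diagOp S F

lemma eq_diagOp {X : HTensor ι 𝓗 →L[ℂ] HTensor ι 𝓗} {F : Finset ι → ℝ}
    (h : ∀ A, X * sector S A = (F A : ℂ) • sector S A) : X = diagOp S F := by
  rw [← mul_one X, ← sum_sector ι S, Finset.mul_sum]
  exact Finset.sum_congr rfl fun A _ => h A

lemma sector_mul_diagOp (F : Finset ι → ℝ) (A : Finset ι) :
    sector S A * diagOp S F = (F A : ℂ) • sector S A := by
  simp [diagOp_eq_sum, Finset.mul_sum, sector_mul_sector]

lemma sector_diagOp_apply (F : Finset ι → ℝ) (A : Finset ι) (x : HTensor ι 𝓗) :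
    sector S A (diagOp S F x) = (F A : ℂ) • sector S A x :=
  DFunLike.congr_fun (sector_mul_diagOp S F A) x

lemma sector_eq_diagOp (B : Finset ι) :
    sector S B = diagOp S fun A => if A = B then 1 else 0 := by
  simp [diagOp_eq_sum]

lemma projMinus_eq_diagOp (B : Finset ι) :
    projMinus S B = diagOp S fun A => if Disjoint A B then 1 else 0 :=
  eq_diagOp S fun A => by
    rw [projMinus_mul_sector]
    split_ifs <;> simp

lemma projPlus_eq_diagOp (B : Finset ι) :
    projPlus S B = diagOp S fun A => if Disjoint A B then 0 else 1 :=
  eq_diagOp S fun A => by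
    rw [projPlus, sub_mul, one_mul, projMinus_mul_sector]
    split_ifs <;> simp

lemma numberOp_eq_diagOp (B : Finset ι) :
    numberOp S B = diagOp S fun A => ((A ∩ B).card : ℝ) :=
  eq_diagOp S fun A => by
    have h : ∀ i, (1 - siteOp i S.projΩ) * sector S A =
        (if i ∈ A then (1 : ℂ) else 0) • sector S A := fun i => by
      rw [sub_mul, one_mul, siteOp_projΩ_mul_sector]
      split_ifs <;> simp
    simp only [numberOp, Finset.sum_mul, h, ← Finset.sum_smul, Finset.sum_boole,
      Finset.filter_mem_eq_inter, Finset.inter_comm B A, Complex.ofReal_natCast]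

lemma spectrum_diagOp_subset (F : Finset ι → ℝ) : spectrum ℝ (diagOp S F) ⊆ Set.range F := by
  refine (AlgHom.spectrum_apply_subset (diagHom S) F).trans fun r hr => ?_
  rw [Pi.spectrum_eq] at hr
  obtain ⟨A, hA⟩ := Set.mem_iUnion.1 hr
  exact ⟨A, ((spectrum.scalar_eq (A := ℝ) (F A)).subset hA).symm⟩

lemma cfc_diagOp (f : ℝ → ℝ) (F : Finset ι → ℝ) : cfc f (diagOp S F) = diagOp S (f ∘ F) := by
  let p : Polynomial ℝ := Lagrange.interpolate (Finset.univ.image F) id f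
  have hp : ∀ A, p.eval (F A) = f (F A) := fun A =>
    Lagrange.eval_interpolate_at_node f Function.injective_id.injOn
      (Finset.mem_image_of_mem F (Finset.mem_univ A))
  have hspec : (spectrum ℝ (diagOp S F)).EqOn f p.eval := fun r hr => by
    obtain ⟨A, rfl⟩ := spectrum_diagOp_subset S F hr
    exact (hp A).symm
  rw [cfc_congr hspec, cfc_polynomial p _ (isSelfAdjoint_diagOp S F), diagOp,
    Polynomial.aeval_algHom_apply]
  congr 1 with A : 1
  simp [hp]

lemma numberWeight_eq_diagOp (B : Finset ι) :
    numberWeight S B = diagOp S fun A => (((A ∩ B).card : ℝ) + 1) ^ (-(1 / 2) : ℝ) := by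
  rw [numberWeight, numberOp_eq_diagOp, cfc_diagOp]
  rfl

lemma inner_sector_of_ne {A B : Finset ι} (h : A ≠ B) (x y : HTensor ι 𝓗) :
    inner ℂ (sector S A x) (sector S B y) = 0 := by
  rw [← ContinuousLinearMap.adjoint_inner_right, adjoint_sector, ← mul_apply_eq_comp,
    sector_mul_sector_of_ne S h, zero_apply, inner_zero_right]

lemma norm_sq_eq_sum_sector (x : HTensor ι 𝓗) :
    ‖x‖ ^ 2 = ∑ A : Finset ι, ‖sector S A x‖ ^ 2 := by
  conv_lhs => rw [← re_inner_self, ← sum_sector_apply S x, sum_inner]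
  simp_rw [inner_sum]
  rw [Complex.re_sum]
  refine Finset.sum_congr rfl fun A _ => ?_
  rw [Finset.sum_eq_single A (fun B _ hB => inner_sector_of_ne S hB.symm _ _) (by simp),
    re_inner_self]

lemma norm_sq_diagOp (F : Finset ι → ℝ) (x : HTensor ι 𝓗) :
    ‖diagOp S F x‖ ^ 2 = ∑ A : Finset ι, F A ^ 2 * ‖sector S A x‖ ^ 2 := by
  simp only [norm_sq_eq_sum_sector S (diagOp S F x), sector_diagOp_apply, norm_smul, mul_pow,
    Complex.norm_real, Real.norm_eq_abs, sq_abs]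

lemma commute_siteOp_sector {i : ι} {b : 𝓗 →L[ℂ] 𝓗} (h : Commute b S.projΩ) (A : Finset ι) :
    Commute (siteOp i b) (sector S A) := by
  refine commute_siteOp_tensorMap ?_
  split_ifs
  · exact (Commute.one_right b).sub_right h
  · exact h

lemma commute_siteOp_diagOp {i : ι} {b : 𝓗 →L[ℂ] 𝓗} (h : Commute b S.projΩ)
    (F : Finset ι → ℝ) : Commute (siteOp i b) (diagOp S F) :=
  Commute.sum_right _ _ _ fun A _ => (commute_siteOp_sector S h A).smul_right _

lemma SiteData.commute_invSqrt_projΩ : Commute S.invSqrt S.projΩ :=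
  S.invSqrt_mul_projΩ.trans S.projΩ_mul_invSqrt.symm

end Sectors

section FormDomain

variable {ι : Type*} [Fintype ι] [DecidableEq ι]
variable {𝓗 : Type*} [NormedAddCommGroup 𝓗] [InnerProductSpace ℂ 𝓗] [CompleteSpace 𝓗]

lemma SiteData.denseRange_invSqrt (S : SiteData 𝓗) : DenseRange S.invSqrt := by
  have h : S.invSqrt.rangeᗮ = ⊥ := (Submodule.eq_bot_iff _).2 fun z hz => by
    apply S.invSqrt_injective
    rw [map_zero, ← inner_self_eq_zero (𝕜 := ℂ), S.inner_invSqrt_left]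
    exact (Submodule.mem_orthogonal' _ _).1 hz _ ⟨_, rfl⟩
  exact Submodule.dense_iff_topologicalClosure_eq_top.2
    (Submodule.topologicalClosure_eq_top_iff.2 h)

variable {S : SiteData 𝓗}

lemma injective_siteOp_invSqrt (i : ι) : Function.Injective (siteOp i S.invSqrt) :=
  injective_siteOp (S.adjoint_invSqrt.symm ▸ S.denseRange_invSqrt)

lemma mem_domain_sqrtSite {i : ι} {x : HTensor ι 𝓗} :
    x ∈ (sqrtSite S i).domain ↔ ∃ ξ, siteOp i S.invSqrt ξ = x := by
  rw [sqrtSite, LinearPMap.inverse_domain]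
  exact ⟨fun ⟨ξ, h⟩ => ⟨ξ, h⟩, fun ⟨ξ, h⟩ => ⟨⟨ξ, trivial⟩, h⟩⟩

lemma sqrtSite_apply {i : ι} {ξ : HTensor ι 𝓗} (x : (sqrtSite S i).domain)
    (h : siteOp i S.invSqrt ξ = x) : sqrtSite S i x = ξ := by
  refine LinearPMap.inverse_apply_eq (f := (siteOp i S.invSqrt :
    HTensor ι 𝓗 →ₗ[ℂ] HTensor ι 𝓗).toPMap ⊤) ?_ (x := ⟨ξ, trivial⟩) h
  rw [LinearMap.ker_eq_bot']
  intro z hz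
  refine Subtype.ext (injective_siteOp_invSqrt (S := S) i ?_)
  rw [Submodule.coe_zero, map_zero]
  exact hz

variable (S) in
open Classical in
/-- The vector `(H_i + 1) ^ (1/2) x`, set to `0` when `x` is not in the domain. -/
def root (i : ι) (x : HTensor ι 𝓗) : HTensor ι 𝓗 :=
  if h : x ∈ (sqrtSite S i).domain then sqrtSite S i ⟨x, h⟩ else 0

lemma root_of_mem {i : ι} {x : HTensor ι 𝓗} (h : x ∈ (sqrtSite S i).domain) :
    root S i x = sqrtSite S i ⟨x, h⟩ := dif_pos h

lemma root_eq {i : ι} {x ξ : HTensor ι 𝓗} (h : siteOp i S.invSqrt ξ = x) :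
    root S i x = ξ := by
  rw [root_of_mem (mem_domain_sqrtSite.2 ⟨ξ, h⟩)]
  exact sqrtSite_apply _ h

lemma siteOp_root {i : ι} {x : HTensor ι 𝓗} (h : x ∈ (sqrtSite S i).domain) :
    siteOp i S.invSqrt (root S i x) = x := by
  obtain ⟨ξ, hξ⟩ := mem_domain_sqrtSite.1 h
  rw [root_eq hξ, hξ]

section Commute

variable {X : HTensor ι 𝓗 →L[ℂ] HTensor ι 𝓗} {i : ι} {x : HTensor ι 𝓗}

lemma map_mem_domain_sqrtSite (hX : Commute (siteOp i S.invSqrt) X)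
    (h : x ∈ (sqrtSite S i).domain) : X x ∈ (sqrtSite S i).domain := by
  obtain ⟨ξ, rfl⟩ := mem_domain_sqrtSite.1 h
  exact mem_domain_sqrtSite.2 ⟨X ξ, DFunLike.congr_fun hX.eq ξ⟩

lemma root_map (hX : Commute (siteOp i S.invSqrt) X) (h : x ∈ (sqrtSite S i).domain) :
    root S i (X x) = X (root S i x) :=
  root_eq <| (DFunLike.congr_fun hX.eq _).trans (congrArg X (siteOp_root h))

lemma mem_formDomain {A : Finset ι} :
    x ∈ formDomain S A ↔ ∀ i ∈ A, x ∈ (sqrtSite S i).domain := by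
  simp only [formDomain, Submodule.mem_iInf]

lemma map_mem_formDomain {A : Finset ι} (hX : ∀ i ∈ A, Commute (siteOp i S.invSqrt) X)
    (h : x ∈ formDomain S A) : X x ∈ formDomain S A :=
  mem_formDomain.2 fun i hi => map_mem_domain_sqrtSite (hX i hi) (mem_formDomain.1 h i hi)

end Commute

lemma commute_siteOp_invSqrt_diagOp (i : ι) (F : Finset ι → ℝ) :
    Commute (siteOp i S.invSqrt) (diagOp S F) :=
  commute_siteOp_diagOp S S.commute_invSqrt_projΩ F

lemma commute_siteOp_invSqrt_sector (i : ι) (A : Finset ι) :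
    Commute (siteOp i S.invSqrt) (sector S A) :=
  commute_siteOp_sector S S.commute_invSqrt_projΩ A

lemma diagOp_mem_formDomain {A : Finset ι} (F : Finset ι → ℝ) {x : HTensor ι 𝓗}
    (h : x ∈ formDomain S A) : diagOp S F x ∈ formDomain S A :=
  map_mem_formDomain (fun i _ => commute_siteOp_invSqrt_diagOp i F) h

lemma projPlus_mem_formDomain {A : Finset ι} (B : Finset ι) {x : HTensor ι 𝓗}
    (h : x ∈ formDomain S A) : projPlus S B x ∈ formDomain S A := by
  rw [projPlus_eq_diagOp]
  exact diagOp_mem_formDomain _ h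

lemma siteOp_mem_formDomain {A : Finset ι} {j : ι} (hj : j ∉ A) (b : 𝓗 →L[ℂ] 𝓗)
    {x : HTensor ι 𝓗} (h : x ∈ formDomain S A) : siteOp j b x ∈ formDomain S A :=
  map_mem_formDomain (fun _ hi => commute_siteOp_of_ne (ne_of_mem_of_not_mem hi hj) _ _) h

lemma siteOp_invSqrt_mul_tensorMap {i : ι} {B : ι → 𝓗 →L[ℂ] 𝓗} (h : B i = S.projΩ) :
    siteOp i S.invSqrt * tensorMap B = tensorMap B := by
  rw [siteOp, tensorMap_mul]
  congr 1 with j : 1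
  rcases eq_or_ne j i with rfl | hj
  · rw [Function.update_self, h, S.invSqrt_mul_projΩ]
  · rw [Function.update_of_ne hj, Pi.one_apply, one_mul]

lemma siteOp_invSqrt_projMinus {A : Finset ι} {i : ι} (hi : i ∈ A) (x : HTensor ι 𝓗) :
    siteOp i S.invSqrt (projMinus S A x) = projMinus S A x := by
  have h : siteOp i S.invSqrt * projMinus S A = projMinus S A :=
    siteOp_invSqrt_mul_tensorMap (if_pos hi)
  exact DFunLike.congr_fun h x

lemma projMinus_mem_formDomain (A : Finset ι) (x : HTensor ι 𝓗) :
    projMinus S A x ∈ formDomain S A :=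
  mem_formDomain.2 fun _ hi => mem_domain_sqrtSite.2 ⟨_, siteOp_invSqrt_projMinus hi x⟩

lemma root_projMinus {A : Finset ι} {i : ι} (hi : i ∈ A) (x : HTensor ι 𝓗) :
    root S i (projMinus S A x) = projMinus S A x :=
  root_eq (siteOp_invSqrt_projMinus hi x)

lemma projMinus_vacuum (A : Finset ι) : projMinus S A (vacuum S) = vacuum S := by
  rw [projMinus, vacuum, tensorMap_htprod]
  congr 1 with i : 1
  split_ifs
  exacts [S.projΩ_Ω, rfl]

lemma vacuum_mem_formDomain (A : Finset ι) : vacuum S ∈ formDomain S A :=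
  projMinus_vacuum (S := S) A ▸ projMinus_mem_formDomain A _

lemma projMinus_add_projPlus (A : Finset ι) (x : HTensor ι 𝓗) :
    projMinus S A x + projPlus S A x = x := by
  simp [projPlus]

lemma adjoint_projPlus (A : Finset ι) :
    ContinuousLinearMap.adjoint (projPlus S A) = projPlus S A := by
  rw [projPlus_eq_diagOp, adjoint_diagOp]

lemma adjoint_projMinus (A : Finset ι) :
    ContinuousLinearMap.adjoint (projMinus S A) = projMinus S A := by
  rw [projMinus_eq_diagOp, adjoint_diagOp]

lemma projMinus_mul_self (A : Finset ι) : projMinus S A * projMinus S A = projMinus S A := by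
  rw [projMinus, tensorMap_mul]
  congr 1 with i : 1
  split_ifs
  exacts [S.projΩ_mul_self, one_mul 1]

lemma projMinus_projPlus (A : Finset ι) (x : HTensor ι 𝓗) :
    projMinus S A (projPlus S A x) = 0 := by
  rw [← mul_apply_eq_comp, projPlus, mul_sub, mul_one, projMinus_mul_self, sub_self, zero_apply]

lemma projPlus_projMinus (A : Finset ι) (x : HTensor ι 𝓗) :
    projPlus S A (projMinus S A x) = 0 := by
  rw [← mul_apply_eq_comp, projPlus, sub_mul, one_mul, projMinus_mul_self, sub_self, zero_apply]

end FormDomain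

section Energy

variable {ι : Type*} [Fintype ι] [DecidableEq ι]
variable {𝓗 : Type*} [NormedAddCommGroup 𝓗] [InnerProductSpace ℂ 𝓗] [CompleteSpace 𝓗]

/-- The form `⟪x, H_i y⟫`. -/
def siteForm (S : SiteData 𝓗) (i : ι) (x y : HTensor ι 𝓗) : ℂ :=
  inner ℂ (root S i x) (root S i y) - inner ℂ x y

/-- The quadratic form `⟪x, H_i x⟫`. -/
def siteEnergy (S : SiteData 𝓗) (i : ι) (x : HTensor ι 𝓗) : ℝ := ‖root S i x‖ ^ 2 - ‖x‖ ^ 2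

/-- The quadratic form `⟪x, H⁰_B x⟫`. -/
def energyOn (S : SiteData 𝓗) (B : Finset ι) (x : HTensor ι 𝓗) : ℝ := ∑ i ∈ B, siteEnergy S i x

/-- The norm `‖(H⁰_A + 1) ^ (1/2) x‖` of a vector of the form domain, as a real number. -/
def formNorm (S : SiteData 𝓗) (A : Finset ι) (x : HTensor ι 𝓗) : ℝ := √(energyOn S A x + ‖x‖ ^ 2)

variable {S : SiteData 𝓗} {i : ι} {A B : Finset ι} {x y : HTensor ι 𝓗}

lemma siteForm_self (i : ι) (x : HTensor ι 𝓗) : siteForm S i x x = siteEnergy S i x := by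
  rw [siteForm, siteEnergy, inner_self_eq_norm_sq_to_K, inner_self_eq_norm_sq_to_K]
  push_cast
  rfl

lemma Form.eval_of_mem (v : Form S A) (hx : x ∈ formDomain S A) (hy : y ∈ formDomain S A) :
    v.eval x y = v ⟨x, hx⟩ ⟨y, hy⟩ := dif_pos ⟨hx, hy⟩

lemma Form.eval_add (v w : Form S A) (x y : HTensor ι 𝓗) :
    (v + w).eval x y = v.eval x y + w.eval x y := by
  unfold Form.eval
  split_ifs <;> simp

lemma formOne_eval (hx : x ∈ formDomain S A) (hy : y ∈ formDomain S A) :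
    (formOne S A).eval x y = inner ℂ x y :=
  (formOne S A).eval_of_mem hx hy

lemma formH0_eval (hx : x ∈ formDomain S A) (hy : y ∈ formDomain S A) :
    (formH0 S A).eval x y = ∑ i ∈ A, siteForm S i x y := by
  rw [Form.eval_of_mem _ hx hy, formH0, LinearMap.sum_apply, LinearMap.sum_apply,
    ← Finset.sum_coe_sort A]
  refine Finset.sum_congr rfl fun i _ => ?_
  rw [siteForm, root_of_mem (formDomain_le S i.2 hx), root_of_mem (formDomain_le S i.2 hy)]
  rfl

lemma weight_of_mem (hx : x ∈ formDomain S A) :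
    weight S A x = ENNReal.ofReal (formNorm S A x) := by
  rw [formNorm, weight, if_pos hx, Form.eval_add, formH0_eval hx hx, formOne_eval hx hx,
    Complex.add_re, Complex.re_sum, re_inner_self, energyOn]
  simp only [siteForm_self, Complex.ofReal_re]

lemma siteEnergy_diagOp (hx : x ∈ (sqrtSite S i).domain) (F : Finset ι → ℝ) :
    siteEnergy S i (diagOp S F x) = ∑ A, F A ^ 2 * siteEnergy S i (sector S A x) := by
  simp only [siteEnergy, root_map (commute_siteOp_invSqrt_diagOp i _) hx, norm_sq_diagOp,
    root_map (commute_siteOp_invSqrt_sector i _) hx, mul_sub, Finset.sum_sub_distrib]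

lemma siteEnergy_eq_sum_sector (hx : x ∈ (sqrtSite S i).domain) :
    siteEnergy S i x = ∑ A : Finset ι, siteEnergy S i (sector S A x) := by
  simpa [diagOp_one] using siteEnergy_diagOp hx 1

lemma siteEnergy_sector_of_notMem (hi : i ∉ A) (x : HTensor ι 𝓗) :
    siteEnergy S i (sector S A x) = 0 := by
  have h : siteOp i S.invSqrt * sector S A = sector S A :=
    siteOp_invSqrt_mul_tensorMap (if_neg hi)
  rw [siteEnergy, root_eq (DFunLike.congr_fun h x)]
  exact sub_self _

lemma siteOp_one_sub_projΩ_sector (hi : i ∈ A) (x : HTensor ι 𝓗) :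
    siteOp i (1 - S.projΩ) (sector S A x) = sector S A x := by
  rw [siteOp_sub, siteOp_one, ← mul_apply_eq_comp, sub_mul, siteOp_projΩ_mul_sector, if_pos hi,
    one_mul, sub_zero]

lemma two_mul_norm_sq_siteOp_invSqrt_sector_le (hi : i ∈ A) (x : HTensor ι 𝓗) :
    2 * ‖siteOp i S.invSqrt (sector S A x)‖ ^ 2 ≤ ‖sector S A x‖ ^ 2 := by
  rw [← siteOp_one_sub_projΩ_sector hi, ← mul_apply_eq_comp, ← siteOp_mul,
    siteOp_one_sub_projΩ_sector hi]
  calc 2 * ‖siteOp i (S.invSqrt * (1 - S.projΩ)) (sector S A x)‖ ^ 2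
      ≤ 2 * (‖S.invSqrt * (1 - S.projΩ)‖ ^ 2 * ‖sector S A x‖ ^ 2) := by
        rw [← mul_pow]
        gcongr
        exact norm_siteOp_apply_le _ _ _
    _ ≤ 2 * (1 / 2 * ‖sector S A x‖ ^ 2) := by
        gcongr
        exact S.norm_invSqrt_mul_one_sub_projΩ_sq_le
    _ = ‖sector S A x‖ ^ 2 := by ring

lemma norm_sq_le_siteEnergy_sector (hi : i ∈ A) (hx : x ∈ (sqrtSite S i).domain) :
    ‖sector S A x‖ ^ 2 ≤ siteEnergy S i (sector S A x) := by
  have hc := commute_siteOp_invSqrt_sector (S := S) i A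
  have h := two_mul_norm_sq_siteOp_invSqrt_sector_le (S := S) hi (root S i x)
  have hcomm : siteOp i S.invSqrt (sector S A (root S i x)) =
      sector S A (siteOp i S.invSqrt (root S i x)) := DFunLike.congr_fun hc.eq _
  rw [hcomm, siteOp_root hx, ← root_map hc hx] at h
  rw [siteEnergy]
  linarith

lemma siteEnergy_sector_nonneg (A : Finset ι) (hx : x ∈ (sqrtSite S i).domain) :
    0 ≤ siteEnergy S i (sector S A x) := by
  by_cases hi : i ∈ A
  · exact (sq_nonneg _).trans (norm_sq_le_siteEnergy_sector hi hx)
  · rw [siteEnergy_sector_of_notMem hi]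

lemma siteEnergy_nonneg (hx : x ∈ (sqrtSite S i).domain) : 0 ≤ siteEnergy S i x := by
  rw [siteEnergy_eq_sum_sector hx]
  exact Finset.sum_nonneg fun A _ => siteEnergy_sector_nonneg A hx

lemma energyOn_nonneg (hx : x ∈ formDomain S B) : 0 ≤ energyOn S B x :=
  Finset.sum_nonneg fun _ hi => siteEnergy_nonneg (formDomain_le S hi hx)

lemma energyOn_diagOp_le (hx : x ∈ formDomain S B) {F : Finset ι → ℝ} {c : ℝ}
    (hF : ∀ A, F A ^ 2 ≤ c) : energyOn S B (diagOp S F x) ≤ c * energyOn S B x := by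
  rw [energyOn, energyOn, Finset.mul_sum]
  refine Finset.sum_le_sum fun i hi => ?_
  have hxi := formDomain_le S hi hx
  rw [siteEnergy_diagOp hxi, siteEnergy_eq_sum_sector hxi, Finset.mul_sum]
  exact Finset.sum_le_sum fun A _ =>
    mul_le_mul_of_nonneg_right (hF A) (siteEnergy_sector_nonneg A hxi)

lemma norm_sq_sector_le_energyOn (h : ¬Disjoint A B) (hx : x ∈ formDomain S B) :
    ‖sector S A x‖ ^ 2 ≤ energyOn S B (sector S A x) := by
  obtain ⟨j, hA, hB⟩ := Finset.not_disjoint_iff.1 h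
  exact (norm_sq_le_siteEnergy_sector hA (formDomain_le S hB hx)).trans <|
    Finset.single_le_sum (f := fun i => siteEnergy S i (sector S A x))
      (fun i hi => siteEnergy_sector_nonneg A (formDomain_le S hi hx)) hB

lemma norm_sq_projPlus_le_energyOn (hx : x ∈ formDomain S B) :
    ‖projPlus S B x‖ ^ 2 ≤ energyOn S B (projPlus S B x) := by
  rw [projPlus_eq_diagOp, norm_sq_diagOp, energyOn,
    Finset.sum_congr rfl fun i hi => siteEnergy_diagOp (formDomain_le S hi hx) _,
    Finset.sum_comm]
  refine Finset.sum_le_sum fun A _ => ?_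
  rw [← Finset.mul_sum, ← energyOn]
  split_ifs with h
  · simp
  · exact mul_le_mul_of_nonneg_left (norm_sq_sector_le_energyOn h hx) (by positivity)

lemma energyOn_projPlus_le (A : Finset ι) (hx : x ∈ formDomain S B) :
    energyOn S B (projPlus S A x) ≤ energyOn S B x := by
  rw [projPlus_eq_diagOp]
  refine (energyOn_diagOp_le hx (c := 1) fun A => ?_).trans_eq (one_mul _)
  split_ifs <;> simp

end Energy

section Locality

variable {ι : Type*} [Fintype ι] [DecidableEq ι]
variable {𝓗 : Type*} [NormedAddCommGroup 𝓗] [InnerProductSpace ℂ 𝓗] [CompleteSpace 𝓗]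
variable {S : SiteData 𝓗} {A B : Finset ι} {x y z : HTensor ι 𝓗}

namespace Form

/-- Evaluation `v ↦ v(x, y)` as a linear functional on forms. -/
def evalHom (S : SiteData 𝓗) (A : Finset ι) (x y : HTensor ι 𝓗) : Form S A →ₗ[ℂ] ℂ where
  toFun v := v.eval x y
  map_add' v w := v.eval_add w x y
  map_smul' c v := by
    unfold Form.eval
    split_ifs <;> simp

lemma evalHom_apply (v : Form S A) : evalHom S A x y v = v.eval x y := rfl

lemma eval_sub (v w : Form S A) : (v - w).eval x y = v.eval x y - w.eval x y :=
  map_sub (evalHom S A x y) v w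

lemma eval_smul (c : ℂ) (v : Form S A) : (c • v).eval x y = c * v.eval x y :=
  map_smul (evalHom S A x y) c v

lemma eval_sum {κ : Type*} (s : Finset κ) (v : κ → Form S A) :
    (∑ k ∈ s, v k).eval x y = ∑ k ∈ s, (v k).eval x y :=
  map_sum (evalHom S A x y) v s

lemma eval_add_right (v : Form S A) (hx : x ∈ formDomain S A) (hy : y ∈ formDomain S A)
    (hz : z ∈ formDomain S A) : v.eval x (y + z) = v.eval x y + v.eval x z := by
  rw [v.eval_of_mem hx hy, v.eval_of_mem hx hz, v.eval_of_mem hx (add_mem hy hz), ← map_add]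
  rfl

lemma eval_add_left (v : Form S A) (hx : x ∈ formDomain S A) (hy : y ∈ formDomain S A)
    (hz : z ∈ formDomain S A) : v.eval (x + y) z = v.eval x z + v.eval y z := by
  rw [v.eval_of_mem hx hz, v.eval_of_mem hy hz, v.eval_of_mem (add_mem hx hy) hz,
    ← LinearMap.add_apply, ← map_add]
  rfl

lemma eval_smul_right (v : Form S A) (c : ℂ) (hx : x ∈ formDomain S A)
    (hy : y ∈ formDomain S A) : v.eval x (c • y) = c * v.eval x y := by
  rw [v.eval_of_mem hx hy, v.eval_of_mem hx (Submodule.smul_mem _ c hy), ← smul_eq_mul,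
    ← map_smul]
  rfl

lemma eval_smul_left (v : Form S A) (c : ℂ) (hx : x ∈ formDomain S A)
    (hy : y ∈ formDomain S A) : v.eval (c • x) y = starRingEnd ℂ c * v.eval x y := by
  rw [v.eval_of_mem hx hy, v.eval_of_mem (Submodule.smul_mem _ c hx) hy, ← smul_eq_mul,
    ← LinearMap.smul_apply, ← LinearMap.map_smulₛₗ]
  rfl

lemma eval_zero_right (v : Form S A) (hx : x ∈ formDomain S A) : v.eval x 0 = 0 := by
  simpa using v.eval_smul_right 0 hx (zero_mem _)

lemma eval_zero_left (v : Form S A) (hy : y ∈ formDomain S A) : v.eval 0 y = 0 := by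
  simpa using v.eval_smul_left 0 (zero_mem _) hy

lemma eval_extend (v : Form S A) (h : A ⊆ B) (hx : x ∈ formDomain S B)
    (hy : y ∈ formDomain S B) : (v.extend B).eval x y = v.eval x y := by
  rw [Form.eval_of_mem _ hx hy, Form.extend, dif_pos h,
    v.eval_of_mem (formDomain_anti S h hx) (formDomain_anti S h hy)]
  rfl

lemma eval_tsum {v : ℕ → Form S A} (h : ∀ x y, Summable fun n => v n x y)
    (hx : x ∈ formDomain S A) (hy : y ∈ formDomain S A) :
    (Form.tsum v).eval x y = ∑' n, (v n).eval x y := by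
  rw [Form.eval_of_mem _ hx hy, Form.tsum, dif_pos h]
  exact tsum_congr fun n => ((v n).eval_of_mem hx hy).symm

lemma eval_sandwich (v : Form S A) {X Y : HTensor ι 𝓗 →L[ℂ] HTensor ι 𝓗}
    (hX : ∀ x ∈ formDomain S A, ContinuousLinearMap.adjoint X x ∈ formDomain S A)
    (hY : ∀ x ∈ formDomain S A, Y x ∈ formDomain S A)
    (hx : x ∈ formDomain S A) (hy : y ∈ formDomain S A) :
    (v.sandwich X Y).eval x y = v.eval (ContinuousLinearMap.adjoint X x) (Y y) := by
  rw [Form.eval_of_mem _ hx hy, Form.sandwich, dif_pos ⟨hX, hY⟩,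
    v.eval_of_mem (hX x hx) (hY y hy)]
  rfl

variable (S A) in
/-- The forms acting as the identity on the factors outside `A`, as a subspace. -/
def localForms : Submodule ℂ (Form S A) where
  carrier := {v | v.IsLocal}
  zero_mem' j _ b x _ y _ := by
    rw [← evalHom_apply, ← evalHom_apply, map_zero, map_zero]
  add_mem' hv hw j hj b x hx y hy := by
    rw [Form.eval_add, Form.eval_add, hv j hj b x hx y hy, hw j hj b x hx y hy]
  smul_mem' c v hv j hj b x hx y hy := by
    rw [eval_smul, eval_smul, hv j hj b x hx y hy]

end Form

variable (𝓗) in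
/-- The bounded operators acting as the identity on the factors outside `A`. -/
def localOps (A : Finset ι) : StarSubalgebra ℂ (HTensor ι 𝓗 →L[ℂ] HTensor ι 𝓗) :=
  StarSubalgebra.centralizer ℂ {T | ∃ j ∉ A, ∃ b : 𝓗 →L[ℂ] 𝓗, siteOp j b = T}

section LocalOps

variable {X Y : HTensor ι 𝓗 →L[ℂ] HTensor ι 𝓗}

lemma mem_localOps :
    X ∈ localOps 𝓗 A ↔ ∀ j ∉ A, ∀ b : 𝓗 →L[ℂ] 𝓗, Commute (siteOp j b) X := by
  rw [localOps, StarSubalgebra.mem_centralizer_iff]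
  constructor
  · exact fun h j hj b => (h _ ⟨j, hj, b, rfl⟩).1
  · rintro h _ ⟨j, hj, b, rfl⟩
    refine ⟨h j hj b, ?_⟩
    rw [ContinuousLinearMap.star_eq_adjoint, adjoint_siteOp]
    exact h j hj _

lemma apply_siteOp_of_mem_localOps (hX : X ∈ localOps 𝓗 A) {j : ι} (hj : j ∉ A)
    (b : 𝓗 →L[ℂ] 𝓗) (x : HTensor ι 𝓗) : X (siteOp j b x) = siteOp j b (X x) :=
  have h : X * siteOp j b = siteOp j b * X := (mem_localOps.1 hX j hj b).symm.eq
  DFunLike.congr_fun h x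

lemma projMinus_mem_localOps (S : SiteData 𝓗) (A : Finset ι) :
    projMinus S A ∈ localOps 𝓗 A := by
  refine mem_localOps.2 fun j hj b => commute_siteOp_tensorMap ?_
  rw [if_neg hj]
  exact Commute.one_right _

lemma projPlus_mem_localOps (S : SiteData 𝓗) (A : Finset ι) : projPlus S A ∈ localOps 𝓗 A :=
  sub_mem (one_mem _) (projMinus_mem_localOps S A)

lemma tsum_mem_localOps {X : ℕ → HTensor ι 𝓗 →L[ℂ] HTensor ι 𝓗}
    (h : ∀ n, X n ∈ localOps 𝓗 A) : ∑' n, X n ∈ localOps 𝓗 A := by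
  refine mem_localOps.2 fun j hj b => ?_
  by_cases hs : Summable X
  · rw [Commute, SemiconjBy, ← hs.tsum_mul_left, ← hs.tsum_mul_right]
    exact tsum_congr fun n => (mem_localOps.1 (h n) j hj b).eq
  · rw [tsum_eq_zero_of_not_summable hs]
    exact Commute.zero_right _

end LocalOps

lemma adjoint_siteOp_mem_formDomain {j : ι} (hj : j ∉ A) (b : 𝓗 →L[ℂ] 𝓗)
    (hx : x ∈ formDomain S A) :
    ContinuousLinearMap.adjoint (siteOp j b) x ∈ formDomain S A := by
  rw [adjoint_siteOp]
  exact siteOp_mem_formDomain hj _ hx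

namespace Form

variable {v : Form S A} {X Y : HTensor ι 𝓗 →L[ℂ] HTensor ι 𝓗}

lemma isLocal_zero : (0 : Form S A).IsLocal := zero_mem (localForms S A)

lemma isLocal_tsum {v : ℕ → Form S A} (h : ∀ n, (v n).IsLocal) : (Form.tsum v).IsLocal := by
  by_cases hs : ∀ x y, Summable fun n => v n x y
  · intro j hj b x hx y hy
    rw [eval_tsum hs hx (siteOp_mem_formDomain hj b hy),
      eval_tsum hs (adjoint_siteOp_mem_formDomain hj b hx) hy]
    exact tsum_congr fun n => h n j hj b x hx y hy
  · rw [Form.tsum, dif_neg hs]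
    exact isLocal_zero

lemma IsLocal.extend (hv : v.IsLocal) (B : Finset ι) : (v.extend B).IsLocal := by
  by_cases h : A ⊆ B
  · intro j hj b x hx y hy
    rw [v.eval_extend h hx (siteOp_mem_formDomain hj b hy),
      v.eval_extend h (adjoint_siteOp_mem_formDomain hj b hx) hy]
    exact hv j (fun hA => hj (h hA)) b x (formDomain_anti S h hx) y (formDomain_anti S h hy)
  · rw [Form.extend, dif_neg h]
    exact isLocal_zero

lemma IsLocal.sandwich (hv : v.IsLocal) (hX : X ∈ localOps 𝓗 A) (hY : Y ∈ localOps 𝓗 A) :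
    (v.sandwich X Y).IsLocal := by
  by_cases h : (∀ x ∈ formDomain S A, ContinuousLinearMap.adjoint X x ∈ formDomain S A) ∧
      ∀ x ∈ formDomain S A, Y x ∈ formDomain S A
  · intro j hj b x hx y hy
    have hX' : ContinuousLinearMap.adjoint X ∈ localOps 𝓗 A := star_mem hX
    rw [v.eval_sandwich h.1 h.2 hx (siteOp_mem_formDomain hj b hy),
      v.eval_sandwich h.1 h.2 (adjoint_siteOp_mem_formDomain hj b hx) hy,
      apply_siteOp_of_mem_localOps hY hj, hv j hj b _ (h.1 x hx) _ (h.2 y hy), adjoint_siteOp,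
      apply_siteOp_of_mem_localOps hX' hj]
  · rw [show v.sandwich X Y = 0 from dif_neg h]
    exact isLocal_zero

lemma IsLocal.ad (hv : v.IsLocal) (hX : X ∈ localOps 𝓗 A) : (Form.ad X v).IsLocal :=
  (localForms S A).sub_mem (hv.sandwich hX (one_mem _)) (hv.sandwich (one_mem _) hX)

lemma IsLocal.diag (hv : v.IsLocal) : v.diag.IsLocal :=
  (localForms S A).add_mem
    (hv.sandwich (projPlus_mem_localOps S A) (projPlus_mem_localOps S A))
    (hv.sandwich (projMinus_mem_localOps S A) (projMinus_mem_localOps S A))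

lemma IsLocal.foldr_ad {κ : Type*} {X : κ → HTensor ι 𝓗 →L[ℂ] HTensor ι 𝓗} (hv : v.IsLocal)
    (hX : ∀ k, X k ∈ localOps 𝓗 A) (l : List κ) :
    (l.foldr (fun k w => Form.ad (X k) w) v).IsLocal := by
  induction l with
  | nil => exact hv
  | cons k l ih => exact ih.ad (hX k)

lemma IsLocal.iterate_ad (hv : v.IsLocal) (hX : X ∈ localOps 𝓗 A) (n : ℕ) :
    ((Form.ad X)^[n] v).IsLocal := by
  induction n with
  | zero => exact hv
  | succ n ih =>
    rw [Function.iterate_succ_apply']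
    exact ih.ad hX

lemma IsLocal.adExp (hv : v.IsLocal) (hX : X ∈ localOps 𝓗 A) : (adExp X v).IsLocal :=
  isLocal_tsum fun n => (localForms S A).smul_mem _ (hv.iterate_ad hX (n + 1))

lemma isLocal_formOne (S : SiteData 𝓗) (A : Finset ι) : (formOne S A).IsLocal := by
  intro j hj b x hx y hy
  rw [formOne_eval hx (siteOp_mem_formDomain hj b hy),
    formOne_eval (adjoint_siteOp_mem_formDomain hj b hx) hy,
    ContinuousLinearMap.adjoint_inner_left]

lemma isLocal_formH0 (S : SiteData 𝓗) (A : Finset ι) : (formH0 S A).IsLocal := by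
  intro j hj b x hx y hy
  rw [formH0_eval hx (siteOp_mem_formDomain hj b hy),
    formH0_eval (adjoint_siteOp_mem_formDomain hj b hx) hy]
  refine Finset.sum_congr rfl fun i hi => ?_
  have hcomm (c : 𝓗 →L[ℂ] 𝓗) : Commute (siteOp i S.invSqrt) (siteOp j c) :=
    commute_siteOp_of_ne (ne_of_mem_of_not_mem hi hj) _ _
  unfold siteForm
  rw [root_map (hcomm b) (formDomain_le S hi hy), adjoint_siteOp,
    root_map (hcomm _) (formDomain_le S hi hx), ← adjoint_siteOp,
    ContinuousLinearMap.adjoint_inner_left, ContinuousLinearMap.adjoint_inner_left]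

end Form

section LieSchwingerSeries

variable {g v : Form S A} {E : ℂ} {T : HTensor ι 𝓗 →L[ℂ] HTensor ι 𝓗}

lemma IsResolventTerm.eval_siteOp_comm (hT : IsResolventTerm g E v T) (hg : g.IsLocal)
    (hv : v.IsLocal) {j : ι} (hj : j ∉ A) (b : 𝓗 →L[ℂ] 𝓗) (hz : z ∈ formDomain S A) :
    g.eval z (siteOp j b (T y)) - E * inner ℂ z (siteOp j b (T y)) =
      g.eval z (T (siteOp j b y)) - E * inner ℂ z (T (siteOp j b y)) := by
  have hz' := adjoint_siteOp_mem_formDomain hj b hz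
  rw [hg j hj b z hz _ (hT y).1, ← ContinuousLinearMap.adjoint_inner_left, (hT y).2.2 _ hz',
    (hT _).2.2 z hz, apply_siteOp_of_mem_localOps (projMinus_mem_localOps S A) hj,
    hv j hj b _ (projPlus_mem_formDomain A hz) _ (projMinus_mem_formDomain A y), adjoint_siteOp,
    apply_siteOp_of_mem_localOps (projPlus_mem_localOps S A) hj]

lemma IsResolventTerm.add_commutator_siteOp (hT : IsResolventTerm g E v T) (hg : g.IsLocal)
    (hv : v.IsLocal) {j : ι} (hj : j ∉ A) (b : 𝓗 →L[ℂ] 𝓗) :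
    IsResolventTerm g E v (T + (siteOp j b * T - T * siteOp j b)) := by
  intro y
  obtain ⟨hmem, hplus, heq⟩ := hT y
  obtain ⟨hmem', hplus', -⟩ := hT (siteOp j b y)
  have hmem'' := siteOp_mem_formDomain hj b hmem
  simp only [add_apply, sub_apply, mul_apply_eq_comp]
  refine ⟨add_mem hmem (sub_mem hmem'' hmem'), ?_, fun z hz => ?_⟩
  · rw [map_add, map_sub, hplus, hplus',
      apply_siteOp_of_mem_localOps (projPlus_mem_localOps S A) hj, hplus]
  · have h := hT.eval_siteOp_comm (y := y) hg hv hj b hz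
    rw [← sub_add_cancel (siteOp j b (T y)) (T (siteOp j b y)),
      g.eval_add_right hz (sub_mem hmem'' hmem') hmem', inner_add_right] at h
    rw [← heq z hz, g.eval_add_right hz hmem (sub_mem hmem'' hmem'), inner_add_right]
    linear_combination h

lemma resolventTerm_mem_localOps (hg : g.IsLocal) (hv : v.IsLocal) (E : ℂ) :
    resolventTerm g E v ∈ localOps 𝓗 A := by
  by_cases h : ∃! T, IsResolventTerm g E v T
  · rw [resolventTerm, dif_pos h]
    obtain ⟨hT, -⟩ := h.choose_spec
    refine mem_localOps.2 fun j hj b => sub_eq_zero.1 ?_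
    exact add_eq_left.1 (h.unique (hT.add_commutator_siteOp hg hv hj b) hT)
  · rw [resolventTerm, dif_neg h]
    exact zero_mem _

lemma antiTerm_mem_localOps (hg : g.IsLocal) (hv : v.IsLocal) (E : ℂ) :
    antiTerm g E v ∈ localOps 𝓗 A :=
  sub_mem (resolventTerm_mem_localOps hg hv E) (star_mem (resolventTerm_mem_localOps hg hv E))

lemma Form.IsLocal.seriesV (hg : g.IsLocal) (hv : v.IsLocal) (E : ℂ) (n : ℕ) :
    (seriesV g E v n).IsLocal := by
  induction n using Nat.strong_induction_on with
  | _ n ih =>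
    match n with
    | 0 =>
      rw [LieSchwinger.seriesV]
      exact isLocal_zero
    | 1 =>
      rw [LieSchwinger.seriesV]
      exact hv
    | j + 2 =>
      have hX (r : ℕ) : (if _h : r < j + 2 then antiTerm g E (LieSchwinger.seriesV g E v r)
          else 0) ∈ localOps 𝓗 A := by
        split_ifs with h
        exacts [antiTerm_mem_localOps hg (ih r h) E, zero_mem _]
      rw [LieSchwinger.seriesV]
      refine (localForms S A).add_mem ((localForms S A).sum_mem fun c _ => ?_)
        ((localForms S A).sum_mem fun c _ => ?_)
      · split_ifs
        exacts [(localForms S A).smul_mem _ (hg.foldr_ad hX _), isLocal_zero]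
      · exact (localForms S A).smul_mem _ (hv.foldr_ad hX _)

lemma generator_mem_localOps (hg : g.IsLocal) (hv : v.IsLocal) (E : ℂ) (t : ℝ) :
    generator t g E v ∈ localOps 𝓗 A :=
  tsum_mem_localOps fun n =>
    (localOps 𝓗 A).smul_mem (antiTerm_mem_localOps hg (hg.seriesV hv E (n + 1)) E) _

lemma Form.IsLocal.diagonalized (hg : g.IsLocal) (hv : v.IsLocal) (E : ℂ) (t : ℝ) :
    (diagonalized t g E v).IsLocal :=
  isLocal_tsum fun n => (localForms S A).smul_mem _ (hg.seriesV hv E (n + 1)).diag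

end LieSchwingerSeries

section BlockDiagonal

/-- The form `v` is block diagonal: `P⁺ v P⁻ = P⁻ v P⁺ = 0`. -/
def Form.IsBlockDiag (v : Form S A) : Prop :=
  ∀ x ∈ formDomain S A, ∀ y ∈ formDomain S A,
    v.eval (projPlus S A x) (projMinus S A y) = 0 ∧
    v.eval (projMinus S A x) (projPlus S A y) = 0

lemma Form.isBlockDiag_zero : (0 : Form S A).IsBlockDiag := fun _ _ _ _ =>
  ⟨map_zero (evalHom S A _ _), map_zero (evalHom S A _ _)⟩

lemma Form.eval_diag (v : Form S A) (hx : x ∈ formDomain S A) (hy : y ∈ formDomain S A) :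
    v.diag.eval x y = v.eval (projPlus S A x) (projPlus S A y) +
      v.eval (projMinus S A x) (projMinus S A y) := by
  rw [Form.diag, Form.eval_add, v.eval_sandwich _ _ hx hy, v.eval_sandwich _ _ hx hy,
    adjoint_projPlus, adjoint_projMinus]
  · exact fun x _ => by rw [adjoint_projMinus]; exact projMinus_mem_formDomain A x
  · exact fun x _ => projMinus_mem_formDomain A x
  · exact fun x hx => by rw [adjoint_projPlus]; exact projPlus_mem_formDomain A hx
  · exact fun x hx => projPlus_mem_formDomain A hx

lemma Form.isBlockDiag_diag (v : Form S A) : v.diag.IsBlockDiag := by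
  intro x hx y hy
  have hpx := projPlus_mem_formDomain A hx
  have hpy := projPlus_mem_formDomain A hy
  have hmx := projMinus_mem_formDomain (S := S) A
  rw [v.eval_diag hpx (hmx y), v.eval_diag (hmx x) hpy]
  simp only [projMinus_projPlus, projPlus_projMinus]
  rw [v.eval_zero_right (projPlus_mem_formDomain A hpx), v.eval_zero_left (hmx _),
    v.eval_zero_left (projPlus_mem_formDomain A hpy), v.eval_zero_right (hmx _)]
  exact ⟨add_zero 0, add_zero 0⟩

lemma Form.IsBlockDiag.smul {v : Form S A} (hv : v.IsBlockDiag) (c : ℂ) :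
    (c • v).IsBlockDiag := fun x hx y hy => by
  rw [eval_smul, eval_smul, (hv x hx y hy).1, (hv x hx y hy).2, mul_zero]
  exact ⟨rfl, rfl⟩

lemma Form.isBlockDiag_tsum {v : ℕ → Form S A} (h : ∀ n, (v n).IsBlockDiag) :
    (Form.tsum v).IsBlockDiag := by
  by_cases hs : ∀ x y, Summable fun n => v n x y
  · intro x hx y hy
    rw [eval_tsum hs (projPlus_mem_formDomain A hx) (projMinus_mem_formDomain A y),
      eval_tsum hs (projMinus_mem_formDomain A x) (projPlus_mem_formDomain A hy)]
    simp only [(h _ x hx y hy).1, (h _ x hx y hy).2, tsum_zero, and_self]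
  · rw [Form.tsum, dif_neg hs]
    exact isBlockDiag_zero

lemma isBlockDiag_diagonalized (t : ℝ) (g : Form S A) (E : ℂ) (v : Form S A) :
    (diagonalized t g E v).IsBlockDiag :=
  Form.isBlockDiag_tsum fun _ => (Form.isBlockDiag_diag _).smul _

end BlockDiagonal

end Locality

section BoundedForms

variable {ι : Type*} [Fintype ι]
variable {𝓗 : Type*} [NormedAddCommGroup 𝓗] [InnerProductSpace ℂ 𝓗] [CompleteSpace 𝓗]
variable {S : SiteData 𝓗}

lemma norm_vacuum : ‖(vacuum S : HTensor ι 𝓗)‖ = 1 := by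
  simp only [vacuum, norm_htprod, S.norm_Ω, Finset.prod_const_one]

variable [DecidableEq ι] {A : Finset ι} {x y : HTensor ι 𝓗} {C : ℝ}

lemma formNorm_nonneg (x : HTensor ι 𝓗) : 0 ≤ formNorm S A x := Real.sqrt_nonneg _

lemma energyOn_projMinus (x : HTensor ι 𝓗) : energyOn S A (projMinus S A x) = 0 :=
  Finset.sum_eq_zero fun i hi => by rw [siteEnergy, root_projMinus hi, sub_self]

lemma formNorm_projMinus (x : HTensor ι 𝓗) :
    formNorm S A (projMinus S A x) = ‖projMinus S A x‖ := by
  rw [formNorm, energyOn_projMinus, zero_add, Real.sqrt_sq (norm_nonneg _)]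

lemma norm_projMinus_le (x : HTensor ι 𝓗) : ‖projMinus S A x‖ ≤ ‖x‖ := by
  refine le_of_sq_le_sq ?_ (norm_nonneg _)
  rw [projMinus_eq_diagOp, norm_sq_diagOp, norm_sq_eq_sum_sector S x]
  refine Finset.sum_le_sum fun B _ => ?_
  split_ifs <;> simp

lemma formNorm_vacuum (S : SiteData 𝓗) (A : Finset ι) : formNorm S A (vacuum S) = 1 := by
  rw [← projMinus_vacuum A, formNorm_projMinus, projMinus_vacuum, norm_vacuum]

lemma norm_projPlus_le_sqrt (hx : x ∈ formDomain S A) : ‖projPlus S A x‖ ≤ √(energyOn S A x) :=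
  Real.le_sqrt_of_sq_le ((norm_sq_projPlus_le_energyOn hx).trans (energyOn_projPlus_le A hx))

lemma formNorm_projPlus_le (hx : x ∈ formDomain S A) :
    formNorm S A (projPlus S A x) ≤ √2 * √(energyOn S A x) := by
  rw [← Real.sqrt_mul (by norm_num)]
  refine Real.sqrt_le_sqrt ?_
  linarith [norm_sq_projPlus_le_energyOn hx, energyOn_projPlus_le A hx]

namespace Form

variable {v : Form S A}

/-- The estimate `|v(x, y)| ≤ C ‖(H⁰_A + 1) ^ (1/2) x‖ ‖(H⁰_A + 1) ^ (1/2) y‖` on the form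
domain: the real-valued counterpart of `v.normH0 ≤ C`. -/
def BoundedBy (v : Form S A) (C : ℝ) : Prop :=
  ∀ x ∈ formDomain S A, ∀ y ∈ formDomain S A,
    ‖v.eval x y‖ ≤ C * formNorm S A x * formNorm S A y

lemma boundedBy_toReal_normH0 (h : v.normH0 ≠ ⊤) : v.BoundedBy v.normH0.toReal := by
  intro x hx y hy
  have hle : ‖v.eval x y‖ₑ ≤ v.normH0 * (weight S A x * weight S A y) := by
    have hW : weight S A x * weight S A y ≠ ⊤ := by
      rw [weight_of_mem hx, weight_of_mem hy]
      exact ENNReal.mul_ne_top ENNReal.ofReal_ne_top ENNReal.ofReal_ne_top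
    rw [← ENNReal.div_le_iff_le_mul (.inr h) (.inl hW)]
    exact le_sInf fun C hC =>
      ENNReal.div_le_of_le_mul ((hC x hx y hy).trans_eq (mul_assoc _ _ _))
  rw [weight_of_mem hx, weight_of_mem hy, ← ENNReal.ofReal_mul (formNorm_nonneg _)] at hle
  have := ENNReal.toReal_mono (ENNReal.mul_ne_top h ENNReal.ofReal_ne_top) hle
  rwa [toReal_enorm, ENNReal.toReal_mul, ENNReal.toReal_ofReal
    (mul_nonneg (formNorm_nonneg _) (formNorm_nonneg _)), ← mul_assoc] at this

lemma BoundedBy.mono (hv : v.BoundedBy C) {C' : ℝ} (h : C ≤ C') : v.BoundedBy C' :=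
  fun x hx y hy => (hv x hx y hy).trans <| by
    gcongr <;> exact formNorm_nonneg _

lemma boundedBy_of_normH0_le (hC : 0 ≤ C) (h : v.normH0 ≤ ENNReal.ofReal C) : v.BoundedBy C :=
  (boundedBy_toReal_normH0 (ne_top_of_le_ne_top ENNReal.ofReal_ne_top h)).mono
    (ENNReal.toReal_le_of_le_ofReal hC h)

lemma BoundedBy.norm_vacuum_le (hv : v.BoundedBy C) : ‖v.eval (vacuum S) (vacuum S)‖ ≤ C := by
  simpa only [formNorm_vacuum, mul_one] using
    hv _ (vacuum_mem_formDomain A) _ (vacuum_mem_formDomain A)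

lemma BoundedBy.nonneg (hv : v.BoundedBy C) : 0 ≤ C := (norm_nonneg _).trans hv.norm_vacuum_le

end Form

end BoundedForms

section Representation

lemma exists_inner_eq {E F : Type*} [NormedAddCommGroup E] [InnerProductSpace ℂ E]
    [CompleteSpace E] [NormedAddCommGroup F] [InnerProductSpace ℂ F] [CompleteSpace F]
    (B : E →L⋆[ℂ] F →L[ℂ] ℂ) : ∃ R : F →L[ℂ] E, ∀ x y, inner ℂ x (R y) = B x y := by
  let R' : E →L[ℂ] F := ((InnerProductSpace.toDual ℂ F).symm : _ →L⋆[ℂ] F).comp B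
  refine ⟨ContinuousLinearMap.adjoint R', fun x y => ?_⟩
  rw [ContinuousLinearMap.adjoint_inner_right]
  exact InnerProductSpace.toDual_symm_apply

variable {ι : Type*} [Fintype ι] [DecidableEq ι]
variable {𝓗 : Type*} [NormedAddCommGroup 𝓗] [InnerProductSpace ℂ 𝓗] [CompleteSpace 𝓗]
variable {S : SiteData 𝓗} {A : Finset ι} {v : Form S A} {C : ℝ}

lemma Form.exists_inner_eq (v : Form S A) {E F : Type*} [NormedAddCommGroup E]
    [InnerProductSpace ℂ E] [CompleteSpace E] [NormedAddCommGroup F] [InnerProductSpace ℂ F]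
    [CompleteSpace F] (L : E →ₗ[ℂ] HTensor ι 𝓗) (hL : ∀ e, L e ∈ formDomain S A)
    (M : F →ₗ[ℂ] HTensor ι 𝓗) (hM : ∀ f, M f ∈ formDomain S A)
    (h : ∀ e f, ‖v.eval (L e) (M f)‖ ≤ C * ‖e‖ * ‖f‖) :
    ∃ R : F →L[ℂ] E, ∀ e f, inner ℂ e (R f) = v.eval (L e) (M f) := by
  let B : E →ₗ⋆[ℂ] F →ₗ[ℂ] ℂ := (v.comp (L.codRestrict _ hL)).compl₂ (M.codRestrict _ hM)
  have hB : ∀ e f, B e f = v.eval (L e) (M f) := fun e f => (v.eval_of_mem (hL e) (hM f)).symm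
  obtain ⟨R, hR⟩ := LieSchwinger.exists_inner_eq <| B.mkContinuous₂ C fun e f => by
    rw [hB]
    exact h e f
  exact ⟨R, fun e f => (hR e f).trans (hB e f)⟩

lemma tensorMap_mem_formDomain {b : ι → 𝓗 →L[ℂ] 𝓗} (hb : ∀ i ∈ A, b i = 1)
    {x : HTensor ι 𝓗} (hx : x ∈ formDomain S A) : tensorMap b x ∈ formDomain S A :=
  map_mem_formDomain (fun i hi => commute_siteOp_tensorMap (by
    rw [hb i hi]
    exact Commute.one_right _)) hx

lemma Form.IsLocal.eval_tensorMap (hv : v.IsLocal) {b : ι → 𝓗 →L[ℂ] 𝓗}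
    (hb : ∀ i ∈ A, b i = 1) {x y : HTensor ι 𝓗} (hx : x ∈ formDomain S A)
    (hy : y ∈ formDomain S A) :
    v.eval x (tensorMap b y) = v.eval (ContinuousLinearMap.adjoint (tensorMap b) x) y := by
  suffices h : ∀ s : Finset ι, Disjoint s A → ∀ x ∈ formDomain S A, ∀ y ∈ formDomain S A,
      v.eval x (tensorMap (s.piecewise b 1) y) =
        v.eval (ContinuousLinearMap.adjoint (tensorMap (s.piecewise b 1)) x) y by
    have hb' : Aᶜ.piecewise b 1 = b := by
      ext1 i
      by_cases hi : i ∈ A <;> simp [hi, hb]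
    simpa only [hb'] using h Aᶜ disjoint_compl_left x hx y hy
  intro s
  induction s using Finset.induction_on with
  | empty =>
    intro _ x _ y _
    have h : (1 : HTensor ι 𝓗 →L[ℂ] HTensor ι 𝓗) = tensorMap 1 := tensorMap_one.symm
    rw [Finset.piecewise_empty, ← h, ← ContinuousLinearMap.star_eq_adjoint, star_one]
    rfl
  | insert j s hj ih =>
    intro hs x hx y hy
    rw [Finset.disjoint_insert_left] at hs
    have h : tensorMap ((insert j s).piecewise b 1) =
        siteOp j (b j) * tensorMap (s.piecewise b 1) := by
      rw [siteOp, tensorMap_mul, Finset.piecewise_insert]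
      congr 1
      ext1 i
      rcases eq_or_ne i j with rfl | hij
      · simp [hj]
      · simp [hij]
    have hmem : tensorMap (s.piecewise b 1) y ∈ formDomain S A :=
      tensorMap_mem_formDomain (fun i hi => s.piecewise_eq_of_notMem _ _
        fun his => Finset.disjoint_left.1 hs.2 his hi) hy
    rw [h, ← ContinuousLinearMap.star_eq_adjoint, star_mul, mul_apply_eq_comp, mul_apply_eq_comp,
      ContinuousLinearMap.star_eq_adjoint, ContinuousLinearMap.star_eq_adjoint,
      hv j hs.1 _ x hx _ hmem, ih hs.2 _ (adjoint_siteOp_mem_formDomain hs.1 _ hx) y hy]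

lemma projMinus_htprod (A : Finset ι) (x : ι → 𝓗) : projMinus S A (htprod x) =
    (∏ i ∈ A, inner ℂ S.Ω (x i)) • htprod (A.piecewise (fun _ => S.Ω) x) := by
  rw [projMinus, tensorMap_htprod, ← Finset.prod_ite_mem_eq, ← htprod_smul]
  congr 1
  ext1 i
  by_cases hi : i ∈ A <;> simp [hi, S.projΩ_apply]

lemma htprod_piecewise_mem_formDomain (A : Finset ι) (x : ι → 𝓗) :
    htprod (A.piecewise (fun _ => S.Ω) x) ∈ formDomain S A := by
  have h : projMinus S A (htprod (A.piecewise (fun _ => S.Ω) x)) =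
      htprod (A.piecewise (fun _ => S.Ω) x) := by
    rw [projMinus_htprod, Finset.prod_eq_one, one_smul]
    · simp
    · intro i hi
      rw [A.piecewise_eq_of_mem _ _ hi, S.inner_Ω_self]
  exact h ▸ projMinus_mem_formDomain A _

/-- Off `A` the local form `v` commutes with the maps `⟪x i, ·⟫ Ω`, which send `y i` to a multiple
of `Ω`. -/
lemma Form.IsLocal.eval_htprod_piecewise (hv : v.IsLocal) (x y : ι → 𝓗) :
    v.eval (htprod (A.piecewise (fun _ => S.Ω) x)) (htprod (A.piecewise (fun _ => S.Ω) y)) =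
      v.eval (vacuum S) (vacuum S) * inner ℂ (htprod (A.piecewise (fun _ => S.Ω) x))
        (htprod (A.piecewise (fun _ => S.Ω) y)) := by
  let b : ι → 𝓗 →L[ℂ] 𝓗 := A.piecewise 1 fun i => InnerProductSpace.rankOne ℂ S.Ω (x i)
  have hb : ∀ i ∈ A, b i = 1 := fun i hi => A.piecewise_eq_of_mem _ _ hi
  have hx : htprod (A.piecewise (fun _ => S.Ω) x) =
      ContinuousLinearMap.adjoint (tensorMap b) (vacuum S) := by
    rw [adjoint_tensorMap, vacuum, tensorMap_htprod]
    congr 1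
    ext1 i
    by_cases hi : i ∈ A
    · simp [hi, b, ← ContinuousLinearMap.star_eq_adjoint]
    · simp [hi, b, S.norm_Ω]
  have hy : tensorMap b (htprod (A.piecewise (fun _ => S.Ω) y)) =
      (inner ℂ (htprod (A.piecewise (fun _ => S.Ω) x))
        (htprod (A.piecewise (fun _ => S.Ω) y)) : ℂ) • vacuum S := by
    rw [tensorMap_htprod, inner_htprod, vacuum, ← htprod_smul]
    congr 1
    ext1 i
    by_cases hi : i ∈ A <;> simp [hi, b, S.norm_Ω]
  conv_lhs => rw [hx]
  rw [← hv.eval_tensorMap hb (vacuum_mem_formDomain A)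
    (htprod_piecewise_mem_formDomain A y), hy,
    v.eval_smul_right _ (vacuum_mem_formDomain A) (vacuum_mem_formDomain A), mul_comm]

lemma Form.IsLocal.eval_projMinus (hv : v.IsLocal) (hb : v.BoundedBy C) (x y : HTensor ι 𝓗) :
    v.eval (projMinus S A x) (projMinus S A y) =
      v.eval (vacuum S) (vacuum S) * inner ℂ (projMinus S A x) (projMinus S A y) := by
  obtain ⟨R, hR⟩ := v.exists_inner_eq (projMinus S A : HTensor ι 𝓗 →ₗ[ℂ] HTensor ι 𝓗)
    (projMinus_mem_formDomain A) (projMinus S A : HTensor ι 𝓗 →ₗ[ℂ] HTensor ι 𝓗)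
    (projMinus_mem_formDomain A) fun x y => (hb _ (projMinus_mem_formDomain A x) _
      (projMinus_mem_formDomain A y)).trans <| by
        rw [formNorm_projMinus, formNorm_projMinus]
        have := hb.nonneg
        gcongr <;> exact norm_projMinus_le _
  have hP (x y : HTensor ι 𝓗) : inner ℂ (projMinus S A x) (projMinus S A y) =
      inner ℂ x ((projMinus S A * projMinus S A) y) := by
    rw [mul_apply_eq_comp, ← ContinuousLinearMap.adjoint_inner_left _ _ x, adjoint_projMinus]
  have hR' : R = v.eval (vacuum S) (vacuum S) • (projMinus S A * projMinus S A) :=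
    inner_ext_htprod fun x y => by
      have hmem (x : ι → 𝓗) := htprod_piecewise_mem_formDomain (S := S) A x
      rw [hR, smul_apply, inner_smul_right, ← hP, ContinuousLinearMap.coe_coe, projMinus_htprod,
        projMinus_htprod, v.eval_smul_left _ (hmem x) (Submodule.smul_mem _ _ (hmem y)),
        v.eval_smul_right _ (hmem x) (hmem y), hv.eval_htprod_piecewise, inner_smul_left,
        inner_smul_right]
      ring
  have := hR x y
  rwa [hR', smul_apply, inner_smul_right, ← hP, eq_comm] at this

end Representation

section VacuumShift

variable {ι : Type*} [Fintype ι] [DecidableEq ι]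
variable {𝓗 : Type*} [NormedAddCommGroup 𝓗] [InnerProductSpace ℂ 𝓗] [CompleteSpace 𝓗]
variable {S : SiteData 𝓗} {A : Finset ι} {x y : HTensor ι 𝓗} {v u : Form S A} {C c : ℝ}

lemma inner_projMinus_projPlus (x y : HTensor ι 𝓗) :
    inner ℂ (projMinus S A x) (projPlus S A y) = 0 := by
  rw [← adjoint_projMinus, ContinuousLinearMap.adjoint_inner_left, projMinus_projPlus,
    inner_zero_right]

namespace Form

lemma isBlockDiag_formOne (S : SiteData 𝓗) (A : Finset ι) : (formOne S A).IsBlockDiag :=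
  fun x hx y hy => by
    rw [formOne_eval (projPlus_mem_formDomain A hx) (projMinus_mem_formDomain A y),
      formOne_eval (projMinus_mem_formDomain A x) (projPlus_mem_formDomain A hy),
      inner_projMinus_projPlus, ← inner_conj_symm, inner_projMinus_projPlus, map_zero]
    exact ⟨rfl, rfl⟩

lemma IsBlockDiag.sub (hv : v.IsBlockDiag) (hu : u.IsBlockDiag) : (v - u).IsBlockDiag :=
  fun x hx y hy => by
    rw [eval_sub, eval_sub, (hv x hx y hy).1, (hv x hx y hy).2, (hu x hx y hy).1,
      (hu x hx y hy).2, sub_zero]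
    exact ⟨rfl, rfl⟩

lemma IsBlockDiag.eval_eq (hv : v.IsBlockDiag) (hx : x ∈ formDomain S A)
    (hy : y ∈ formDomain S A) : v.eval x y =
      v.eval (projPlus S A x) (projPlus S A y) + v.eval (projMinus S A x) (projMinus S A y) := by
  have hpx := projPlus_mem_formDomain A hx
  have hpy := projPlus_mem_formDomain A hy
  have hmx := projMinus_mem_formDomain (S := S) A x
  have hmy := projMinus_mem_formDomain (S := S) A y
  conv_lhs => rw [← projMinus_add_projPlus (S := S) A x, ← projMinus_add_projPlus (S := S) A y]
  rw [v.eval_add_left hmx hpx (add_mem hmy hpy), v.eval_add_right hmx hmy hpy,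
    v.eval_add_right hpx hmy hpy, (hv x hx y hy).1, (hv x hx y hy).2, add_zero, zero_add,
    add_comm]

/-- The form `v - ⟪Ω, v Ω⟫`, whose vacuum expectation value vanishes. -/
def vacuumShift (v : Form S A) : Form S A := v - v.eval (vacuum S) (vacuum S) • formOne S A

lemma vacuumShift_eval (hx : x ∈ formDomain S A) (hy : y ∈ formDomain S A) :
    v.vacuumShift.eval x y = v.eval x y - v.eval (vacuum S) (vacuum S) * inner ℂ x y := by
  rw [vacuumShift, eval_sub, eval_smul, formOne_eval hx hy]

lemma IsLocal.vacuumShift (hv : v.IsLocal) : v.vacuumShift.IsLocal :=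
  (localForms S A).sub_mem hv ((localForms S A).smul_mem _ (isLocal_formOne S A))

lemma IsBlockDiag.vacuumShift (hv : v.IsBlockDiag) : v.vacuumShift.IsBlockDiag :=
  hv.sub ((isBlockDiag_formOne S A).smul _)

/-- The estimate `|u(x, y)| ≤ c ‖(H⁰_A) ^ (1/2) x‖ ‖(H⁰_A) ^ (1/2) y‖` on the form domain. -/
def EnergyBoundedBy (u : Form S A) (c : ℝ) : Prop :=
  ∀ x ∈ formDomain S A, ∀ y ∈ formDomain S A,
    ‖u.eval x y‖ ≤ c * √(energyOn S A x) * √(energyOn S A y)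

/-- The shift kills the block `P⁻ v P⁻`, and on the range of `P⁺` the energy is at least `1`. -/
lemma BoundedBy.energyBoundedBy_vacuumShift (hb : v.BoundedBy C) (hv : v.IsLocal)
    (hd : v.IsBlockDiag) : v.vacuumShift.EnergyBoundedBy (3 * C) := by
  intro x hx y hy
  have hpx := projPlus_mem_formDomain A hx
  have hpy := projPlus_mem_formDomain A hy
  have hC := hb.nonneg
  rw [hd.vacuumShift.eval_eq hx hy, vacuumShift_eval hpx hpy,
    vacuumShift_eval (projMinus_mem_formDomain A x) (projMinus_mem_formDomain A y),
    hv.eval_projMinus hb, sub_self, add_zero]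
  calc _ ≤ ‖v.eval (projPlus S A x) (projPlus S A y)‖ +
        ‖v.eval (vacuum S) (vacuum S)‖ * ‖inner ℂ (projPlus S A x) (projPlus S A y)‖ := by
        rw [← norm_mul]
        exact norm_sub_le _ _
    _ ≤ C * (√2 * √(energyOn S A x)) * (√2 * √(energyOn S A y)) +
        C * (√(energyOn S A x) * √(energyOn S A y)) := by
        refine add_le_add ((hb _ hpx _ hpy).trans ?_) ?_
        · gcongr
          · exact formNorm_nonneg _
          · exact formNorm_projPlus_le hx
          · exact formNorm_projPlus_le hy
        · gcongr
          · exact hb.norm_vacuum_le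
          · refine (norm_inner_le_norm _ _).trans ?_
            gcongr
            · exact norm_projPlus_le_sqrt hx
            · exact norm_projPlus_le_sqrt hy
    _ = (√2 * √2 + 1) * C * √(energyOn S A x) * √(energyOn S A y) := by ring
    _ = 3 * C * √(energyOn S A x) * √(energyOn S A y) := by
        rw [Real.mul_self_sqrt (by norm_num)]
        norm_num

end Form

end VacuumShift

section NumberWeight

variable {ι : Type*} [Fintype ι] [DecidableEq ι]
variable {𝓗 : Type*} [NormedAddCommGroup 𝓗] [InnerProductSpace ℂ 𝓗] [CompleteSpace 𝓗]
variable {S : SiteData 𝓗} {A B B' : Finset ι} {x y : HTensor ι 𝓗} {v : Form S A} {c : ℝ}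

lemma sector_mem_formDomain (B : Finset ι) (h : x ∈ formDomain S A) :
    sector S B x ∈ formDomain S A :=
  sector_eq_diagOp S B ▸ diagOp_mem_formDomain _ h

namespace Form

lemma IsLocal.eval_sector (hv : v.IsLocal) (h : B \ A ≠ B' \ A) (hx : x ∈ formDomain S A)
    (hy : y ∈ formDomain S A) : v.eval (sector S B x) (sector S B' y) = 0 := by
  obtain ⟨j, hjA, hj⟩ : ∃ j ∉ A, ¬(j ∈ B ↔ j ∈ B') := by
    contrapose! h
    ext j
    have := h j
    simp only [Finset.mem_sdiff]
    tauto
  have hP (D : Finset ι) (z : HTensor ι 𝓗) : siteOp j S.projΩ (sector S D z) =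
      if j ∈ D then 0 else sector S D z := by
    rw [← mul_apply_eq_comp, siteOp_projΩ_mul_sector]
    split_ifs <;> rfl
  have hl := hv j hjA S.projΩ _ (sector_mem_formDomain B hx) _ (sector_mem_formDomain B' hy)
  rw [adjoint_siteOp, S.adjoint_projΩ, hP, hP] at hl
  by_cases hB : j ∈ B
  · have hB' : j ∉ B' := fun hB' => hj (by simp [hB, hB'])
    rwa [if_neg hB', if_pos hB, v.eval_zero_left (sector_mem_formDomain B' hy)] at hl
  · have hB' : j ∈ B' := by_contra fun hB' => hj (by simp [hB, hB'])
    rwa [if_pos hB', if_neg hB, v.eval_zero_right (sector_mem_formDomain B hx), eq_comm] at hl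

lemma eval_diagOp_diagOp (v : Form S A) (F G : Finset ι → ℝ) (hx : x ∈ formDomain S A)
    (hy : y ∈ formDomain S A) : v.eval (diagOp S F x) (diagOp S G y) =
      ∑ B, ∑ B', (F B : ℂ) * G B' * v.eval (sector S B x) (sector S B' y) := by
  have hsum {z : HTensor ι 𝓗} (hz : z ∈ formDomain S A) (F : Finset ι → ℝ) :
      (⟨diagOp S F z, diagOp_mem_formDomain F hz⟩ : formDomain S A) =
        ∑ B, (F B : ℂ) • ⟨sector S B z, sector_mem_formDomain B hz⟩ := by
    ext1
    simp [diagOp_eq_sum, sum_apply]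
  rw [v.eval_of_mem (diagOp_mem_formDomain F hx) (diagOp_mem_formDomain G hy), hsum hx, hsum hy]
  simp only [map_sum, LinearMap.sum_apply, map_smulₛₗ, LinearMap.smul_apply, Complex.conj_ofReal,
    smul_eq_mul, RingHom.id_apply, Finset.mul_sum]
  rw [Finset.sum_comm]
  refine Finset.sum_congr rfl fun B _ => Finset.sum_congr rfl fun B' _ => ?_
  rw [v.eval_of_mem (sector_mem_formDomain B hx) (sector_mem_formDomain B' hy)]
  ring

lemma IsLocal.eval_diagOp (hv : v.IsLocal) {F : Finset ι → ℝ}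
    (hF : ∀ B B', B \ A = B' \ A → F B = F B') (hx : x ∈ formDomain S A)
    (hy : y ∈ formDomain S A) : v.eval x (diagOp S F y) = v.eval (diagOp S F x) y := by
  have h1 (z : HTensor ι 𝓗) : z = diagOp S 1 z := by rw [diagOp_one]; rfl
  conv_lhs => rw [h1 x]
  conv_rhs => rw [h1 y]
  rw [v.eval_diagOp_diagOp _ _ hx hy, v.eval_diagOp_diagOp _ _ hx hy]
  refine Finset.sum_congr rfl fun B _ => Finset.sum_congr rfl fun B' _ => ?_
  by_cases h : B \ A = B' \ A
  · rw [hF B B' h, Pi.one_apply, Pi.one_apply, mul_comm (_ : ℂ) (F B' : ℂ)]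
  · rw [hv.eval_sector h hx hy, mul_zero, mul_zero]

end Form

/-- The operator `(π_K + 1) ^ (1/2)`, the inverse of `numberWeight S K`. -/
def numberRoot (S : SiteData 𝓗) (K : Finset ι) : HTensor ι 𝓗 →L[ℂ] HTensor ι 𝓗 :=
  diagOp S fun B => √((B ∩ K).card + 1)

lemma numberWeight_eq_diagOp_inv_sqrt (S : SiteData 𝓗) (K : Finset ι) :
    numberWeight S K = diagOp S fun B => (√((B ∩ K).card + 1))⁻¹ := by
  rw [numberWeight_eq_diagOp]
  congr 1
  ext B
  rw [Real.rpow_neg (by positivity), ← Real.sqrt_eq_rpow]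

lemma numberWeight_mem_formDomain (K : Finset ι) (hx : x ∈ formDomain S A) :
    numberWeight S K x ∈ formDomain S A :=
  numberWeight_eq_diagOp S K ▸ diagOp_mem_formDomain _ hx

lemma card_inter_add_one_le {α : Type*} [DecidableEq α] (A B K : Finset α) :
    ((B ∩ K).card : ℝ) + 1 ≤ (A.card + 1) * (((B \ A) ∩ K).card + 1) := by
  have hcover : (B ∩ K).card ≤ ((B \ A) ∩ K).card + A.card := by
    refine (Finset.card_le_card fun i hi => ?_).trans (Finset.card_union_le _ _)
    simp only [Finset.mem_inter, Finset.mem_union, Finset.mem_sdiff] at *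
    tauto
  have hcover' : ((B ∩ K).card : ℝ) ≤ ((B \ A) ∩ K).card + A.card := by exact_mod_cast hcover
  have hmul : (0 : ℝ) ≤ A.card * ((B \ A) ∩ K).card := by positivity
  linarith

/-- A local form commutes with `(π_{K \ A} + 1) ^ (1/2)`, which is moved here from right to left. -/
lemma Form.IsLocal.eval_numberWeight_numberRoot (hv : v.IsLocal) (K : Finset ι)
    (hx : x ∈ formDomain S A) : v.eval (numberWeight S K x) (numberRoot S K x) =
      v.eval (diagOp S (fun B => √(((B \ A) ∩ K).card + 1) * (√((B ∩ K).card + 1))⁻¹) x)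
        (diagOp S (fun B => √((B ∩ K).card + 1) * (√(((B \ A) ∩ K).card + 1))⁻¹) x) := by
  let q (B : Finset ι) : ℝ := ((B \ A) ∩ K).card + 1
  have hroot : numberRoot S K x = diagOp S (fun B => √(q B))
      (diagOp S (fun B => √((B ∩ K).card + 1) * (√(q B))⁻¹) x) := by
    rw [← mul_apply_eq_comp, diagOp_mul, numberRoot]
    congr 2
    ext B
    have hq : 0 < √(q B) := Real.sqrt_pos.2 (by positivity)
    exact (mul_div_cancel₀ _ hq.ne').symm
  rw [hroot, hv.eval_diagOp (fun B B' h => by simp only [q, h]) (numberWeight_mem_formDomain K hx)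
    (diagOp_mem_formDomain _ hx), numberWeight_eq_diagOp_inv_sqrt, ← mul_apply_eq_comp, diagOp_mul]
  rfl

lemma Form.EnergyBoundedBy.norm_eval_numberWeight_le (hu : v.EnergyBoundedBy c) (hc : 0 ≤ c)
    (hv : v.IsLocal) (K : Finset ι) (hx : x ∈ formDomain S A) :
    ‖v.eval (numberWeight S K x) (numberRoot S K x)‖ ≤ c * (A.card + 1) * energyOn S A x := by
  have hE := energyOn_nonneg hx
  have hsq {a b : ℝ} (ha : 0 ≤ a) (hb : 0 ≤ b) : (√a * (√b)⁻¹) ^ 2 = a / b := by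
    rw [mul_pow, inv_pow, Real.sq_sqrt ha, Real.sq_sqrt hb, div_eq_mul_inv]
  rw [hv.eval_numberWeight_numberRoot K hx]
  set y := diagOp S (fun B => √(((B \ A) ∩ K).card + 1) * (√((B ∩ K).card + 1))⁻¹) x
  set z := diagOp S (fun B => √((B ∩ K).card + 1) * (√(((B \ A) ∩ K).card + 1))⁻¹) x
  have hy : y ∈ formDomain S A := diagOp_mem_formDomain _ hx
  have hz : z ∈ formDomain S A := diagOp_mem_formDomain _ hx
  have hEy : energyOn S A y ≤ 1 * energyOn S A x := energyOn_diagOp_le hx fun B => by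
    rw [hsq (by positivity) (by positivity), div_le_one (by positivity)]
    gcongr
    exact Finset.sdiff_subset
  have hEz : energyOn S A z ≤ (A.card + 1) * energyOn S A x := energyOn_diagOp_le hx fun B => by
    rw [hsq (by positivity) (by positivity), div_le_iff₀ (by positivity)]
    exact card_inter_add_one_le A B K
  have hEy' : energyOn S A y ≤ (A.card + 1) * energyOn S A x :=
    hEy.trans (by gcongr; simp)
  calc ‖v.eval y z‖ ≤ c * √(energyOn S A y) * √(energyOn S A z) := hu _ hy _ hz
    _ ≤ c * √((A.card + 1) * energyOn S A x) * √((A.card + 1) * energyOn S A x) := by gcongr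
    _ = c * (A.card + 1) * energyOn S A x := by
        rw [mul_assoc, Real.mul_self_sqrt (by positivity), ← mul_assoc]

end NumberWeight

section Coercivity

variable {ι : Type*} [Fintype ι] [DecidableEq ι]
variable {𝓗 : Type*} [NormedAddCommGroup 𝓗] [InnerProductSpace ℂ 𝓗] [CompleteSpace 𝓗]
variable {S : SiteData 𝓗} {A : Finset ι} {x : HTensor ι 𝓗} {h : Form S A}

lemma numberRoot_mem_formDomain (K : Finset ι) (hx : x ∈ formDomain S A) :
    numberRoot S K x ∈ formDomain S A :=
  diagOp_mem_formDomain _ hx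

lemma numberRoot_numberWeight (K : Finset ι) (x : HTensor ι 𝓗) :
    numberRoot S K (numberWeight S K x) = x := by
  rw [numberWeight_eq_diagOp_inv_sqrt, numberRoot, ← mul_apply_eq_comp, diagOp_mul]
  have h : ((fun B : Finset ι => √((B ∩ K).card + 1)) * fun B => (√((B ∩ K).card + 1))⁻¹) = 1 :=
    funext fun B => mul_inv_cancel₀ (Real.sqrt_pos.2 (by positivity)).ne'
  rw [h, diagOp_one, one_apply_eq_self]

lemma inner_numberWeight_numberRoot (K : Finset ι) (x y : HTensor ι 𝓗) :
    inner ℂ (numberWeight S K x) (numberRoot S K y) = inner ℂ x y := by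
  rw [← ContinuousLinearMap.adjoint_inner_left, numberRoot, adjoint_diagOp, ← numberRoot,
    numberRoot_numberWeight]

lemma siteForm_numberWeight_numberRoot {i : ι} (hi : x ∈ (sqrtSite S i).domain) (K : Finset ι) :
    siteForm S i (numberWeight S K x) (numberRoot S K x) = siteEnergy S i x := by
  have hw : root S i (numberWeight S K x) = numberWeight S K (root S i x) := by
    rw [numberWeight_eq_diagOp_inv_sqrt, root_map (commute_siteOp_invSqrt_diagOp i _) hi]
  have hr : root S i (numberRoot S K x) = numberRoot S K (root S i x) :=
    root_map (commute_siteOp_invSqrt_diagOp i _) hi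
  rw [siteForm, hw, hr, inner_numberWeight_numberRoot, inner_numberWeight_numberRoot, ← siteForm,
    siteForm_self]

lemma formH0_eval_self (hx : x ∈ formDomain S A) : (formH0 S A).eval x x = energyOn S A x := by
  simp only [formH0_eval hx hx, siteForm_self, energyOn, Complex.ofReal_sum]

lemma formH0_eval_numberWeight_numberRoot (K : Finset ι) (hx : x ∈ formDomain S A) :
    (formH0 S A).eval (numberWeight S K x) (numberRoot S K x) = energyOn S A x := by
  rw [formH0_eval (numberWeight_mem_formDomain K hx) (numberRoot_mem_formDomain K hx), energyOn,
    Complex.ofReal_sum]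
  exact Finset.sum_congr rfl fun i hi =>
    siteForm_numberWeight_numberRoot (mem_formDomain.1 hx i hi) K

/-- The form `h` is `H⁰_A` plus a perturbation of relative size `1/2`, also after conjugating with
`(π_A + 1) ^ (1/2)`. The forms `G_K - E_K` are of this kind for small couplings. -/
structure Form.IsPerturbedH0 (h : Form S A) : Prop where
  energyBoundedBy : (h - formH0 S A).EnergyBoundedBy (1 / 2)
  norm_eval_numberWeight_le : ∀ x ∈ formDomain S A,
    ‖(h - formH0 S A).eval (numberWeight S A x) (numberRoot S A x)‖ ≤ 1 / 2 * energyOn S A x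

namespace Form.IsPerturbedH0

lemma half_energyOn_le_norm_eval (hh : h.IsPerturbedH0) (hx : x ∈ formDomain S A) :
    1 / 2 * energyOn S A x ≤ ‖h.eval x x‖ := by
  have hE := energyOn_nonneg hx
  have hw := hh.energyBoundedBy x hx x hx
  rw [eval_sub, formH0_eval_self hx, mul_assoc, Real.mul_self_sqrt hE] at hw
  have := norm_sub_norm_le (energyOn S A x : ℂ) (h.eval x x)
  rw [norm_sub_rev, Complex.norm_real, Real.norm_of_nonneg hE] at this
  linarith

lemma half_energyOn_le_norm_eval_numberWeight (hh : h.IsPerturbedH0) (hx : x ∈ formDomain S A) :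
    1 / 2 * energyOn S A x ≤ ‖h.eval (numberWeight S A x) (numberRoot S A x)‖ := by
  have hE := energyOn_nonneg hx
  have hw := hh.norm_eval_numberWeight_le x hx
  rw [eval_sub, formH0_eval_numberWeight_numberRoot A hx] at hw
  have := norm_sub_norm_le (energyOn S A x : ℂ) (h.eval (numberWeight S A x) (numberRoot S A x))
  rw [norm_sub_rev, Complex.norm_real, Real.norm_of_nonneg hE] at this
  linarith

end Form.IsPerturbedH0

section Sum

variable {κ : Type*} {s : Finset κ} {B : κ → Finset ι} {c : κ → ℝ} {a : ℝ}

lemma sum_mul_energyOn_le (hB : ∀ k ∈ s, B k ⊆ A)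
    (h : ∀ i ∈ A, ∑ k ∈ s with i ∈ B k, c k ≤ a) (hx : x ∈ formDomain S A) :
    ∑ k ∈ s, c k * energyOn S (B k) x ≤ a * energyOn S A x := by
  calc ∑ k ∈ s, c k * energyOn S (B k) x
      = ∑ k ∈ s, ∑ i ∈ A, if i ∈ B k then c k * siteEnergy S i x else 0 := by
        refine Finset.sum_congr rfl fun k hk => ?_
        rw [← Finset.sum_filter, Finset.filter_mem_eq_inter, Finset.inter_eq_right.2 (hB k hk),
          energyOn, Finset.mul_sum]
    _ = ∑ i ∈ A, (∑ k ∈ s with i ∈ B k, c k) * siteEnergy S i x := by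
        rw [Finset.sum_comm]
        simp only [← Finset.sum_filter, Finset.sum_mul]
    _ ≤ ∑ i ∈ A, a * siteEnergy S i x := Finset.sum_le_sum fun i hi =>
        mul_le_mul_of_nonneg_right (h i hi) (siteEnergy_nonneg (mem_formDomain.1 hx i hi))
    _ = a * energyOn S A x := (Finset.mul_sum ..).symm

variable {u : ∀ k, Form S (B k)}

namespace Form

lemma EnergyBoundedBy.sum_extend (ha : 0 ≤ a) (hB : ∀ k ∈ s, B k ⊆ A) (hc : ∀ k ∈ s, 0 ≤ c k)
    (hu : ∀ k ∈ s, (u k).EnergyBoundedBy (c k)) (h : ∀ i ∈ A, ∑ k ∈ s with i ∈ B k, c k ≤ a) :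
    (∑ k ∈ s, (u k).extend A).EnergyBoundedBy a := by
  intro x hx y hy
  let f (x : HTensor ι 𝓗) (k : κ) : ℝ := √(c k) * √(energyOn S (B k) x)
  have hf {x : HTensor ι 𝓗} (hx : x ∈ formDomain S A) :
      √(∑ k ∈ s, f x k ^ 2) ≤ √a * √(energyOn S A x) := by
    rw [← Real.sqrt_mul ha]
    refine Real.sqrt_le_sqrt (le_trans (Finset.sum_le_sum fun k hk => ?_)
      (sum_mul_energyOn_le hB h hx))
    rw [mul_pow, Real.sq_sqrt (hc k hk),
      Real.sq_sqrt (energyOn_nonneg (formDomain_anti S (hB k hk) hx))]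
  calc ‖(∑ k ∈ s, (u k).extend A).eval x y‖ ≤ ∑ k ∈ s, ‖((u k).extend A).eval x y‖ := by
        rw [eval_sum]
        exact norm_sum_le _ _
    _ ≤ ∑ k ∈ s, f x k * f y k := by
        refine Finset.sum_le_sum fun k hk => ?_
        rw [eval_extend _ (hB k hk) hx hy, mul_mul_mul_comm, Real.mul_self_sqrt (hc k hk),
          ← mul_assoc]
        exact hu k hk x (formDomain_anti S (hB k hk) hx) y (formDomain_anti S (hB k hk) hy)
    _ ≤ √(∑ k ∈ s, f x k ^ 2) * √(∑ k ∈ s, f y k ^ 2) := Real.sum_mul_le_sqrt_mul_sqrt ..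
    _ ≤ (√a * √(energyOn S A x)) * (√a * √(energyOn S A y)) := by
        gcongr
        exacts [hf hx, hf hy]
    _ = a * √(energyOn S A x) * √(energyOn S A y) := by
        rw [mul_mul_mul_comm, Real.mul_self_sqrt ha, mul_assoc]

lemma isPerturbedH0_of_sum (hB : ∀ k ∈ s, B k ⊆ A) (hc : ∀ k ∈ s, 0 ≤ c k)
    (hu : ∀ k ∈ s, (u k).EnergyBoundedBy (c k)) (hl : ∀ k ∈ s, (u k).IsLocal)
    (hs : ∀ i ∈ A, ∑ k ∈ s with i ∈ B k, c k * ((B k).card + 1) ≤ 1 / 2)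
    (hh : h - formH0 S A = ∑ k ∈ s, (u k).extend A) : h.IsPerturbedH0 where
  energyBoundedBy := by
    rw [hh]
    refine EnergyBoundedBy.sum_extend (by norm_num) hB hc hu fun i hi =>
      (Finset.sum_le_sum fun k hk => ?_).trans (hs i hi)
    exact le_mul_of_one_le_right (hc k (Finset.mem_filter.1 hk).1) (by simp)
  norm_eval_numberWeight_le x hx := by
    rw [hh, eval_sum]
    refine (norm_sum_le _ _).trans ((Finset.sum_le_sum fun k hk => ?_).trans
      (sum_mul_energyOn_le hB hs hx))
    rw [eval_extend _ (hB k hk) (numberWeight_mem_formDomain A hx) (numberRoot_mem_formDomain A hx)]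
    exact (hu k hk).norm_eval_numberWeight_le (hc k hk) (hl k hk) A
      (formDomain_anti S (hB k hk) hx)

end Form

end Sum

end Coercivity

section ExcitedSpace

variable {ι : Type*} [Fintype ι] [DecidableEq ι]
variable {𝓗 : Type*} [NormedAddCommGroup 𝓗] [InnerProductSpace ℂ 𝓗] [CompleteSpace 𝓗]

/-- The subspace `D((H⁰_A) ^ (1/2)) ∩ ran P⁺_A` as a Hilbert space for the energy norm: its vector
`x` is encoded by the family of `x` and of the `(H_i + 1) ^ (1/2) x`, `i ∈ A`. -/
def excitedSpace (S : SiteData 𝓗) (A : Finset ι) :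
    Submodule ℂ (PiLp 2 fun _ : Option A => HTensor ι 𝓗) :=
  (⨅ i : A, (siteOp i.1 S.invSqrt ∘L PiLp.proj 2 (fun _ => HTensor ι 𝓗) (some i) -
    PiLp.proj 2 (fun _ => HTensor ι 𝓗) none).ker) ⊓
    (projMinus S A ∘L PiLp.proj 2 (fun _ => HTensor ι 𝓗) none).ker

variable {S : SiteData 𝓗} {A : Finset ι} {x y z : HTensor ι 𝓗}

lemma mem_excitedSpace {f : PiLp 2 fun _ : Option A => HTensor ι 𝓗} : f ∈ excitedSpace S A ↔
    (∀ i : A, siteOp i.1 S.invSqrt (f (some i)) = f none) ∧ projMinus S A (f none) = 0 := by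
  simp [excitedSpace, sub_eq_zero]

instance : CompleteSpace (excitedSpace S A) := by
  suffices h : IsClosed (excitedSpace S A : Set (PiLp 2 fun _ : Option A => HTensor ι 𝓗)) from
    h.completeSpace_coe
  rw [excitedSpace, Submodule.coe_inf, Submodule.coe_iInf]
  exact (isClosed_iInter fun i => ContinuousLinearMap.isClosed_ker _).inter
    (ContinuousLinearMap.isClosed_ker _)

/-- The vector of `⨂ 𝓗` encoded by an element of `excitedSpace S A`. -/
def excitedVec (S : SiteData 𝓗) (A : Finset ι) : excitedSpace S A →L[ℂ] HTensor ι 𝓗 :=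
  PiLp.proj 2 (fun _ => HTensor ι 𝓗) none ∘L (excitedSpace S A).subtypeL

lemma excitedVec_mem_formDomain (f : excitedSpace S A) : excitedVec S A f ∈ formDomain S A :=
  mem_formDomain.2 fun i hi => mem_domain_sqrtSite.2 ⟨_, (mem_excitedSpace.1 f.2).1 ⟨i, hi⟩⟩

lemma projPlus_eq_self_iff : projPlus S A x = x ↔ projMinus S A x = 0 := by
  rw [projPlus, sub_apply, one_apply_eq_self, sub_eq_self]

lemma projPlus_excitedVec (f : excitedSpace S A) :
    projPlus S A (excitedVec S A f) = excitedVec S A f :=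
  projPlus_eq_self_iff.2 (mem_excitedSpace.1 f.2).2

lemma exists_excitedVec_eq (hx : x ∈ formDomain S A) (h : projPlus S A x = x) :
    ∃ f : excitedSpace S A, excitedVec S A f = x := by
  refine ⟨⟨WithLp.toLp 2 fun j => j.elim x fun i => root S i.1 x, mem_excitedSpace.2
    ⟨fun i => ?_, projPlus_eq_self_iff.1 h⟩⟩, rfl⟩
  exact siteOp_root (formDomain_le S i.2 hx)

lemma norm_sq_excitedSpace (f : excitedSpace S A) :
    ‖f‖ ^ 2 = energyOn S A (excitedVec S A f) + (A.card + 1) * ‖excitedVec S A f‖ ^ 2 := by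
  have hroot (i : A) : root S i.1 (excitedVec S A f) = f.1 (some i) :=
    root_eq ((mem_excitedSpace.1 f.2).1 i)
  have hnorm : ‖f‖ ^ 2 = ‖excitedVec S A f‖ ^ 2 + ∑ i : A, ‖root S i.1 (excitedVec S A f)‖ ^ 2 := by
    rw [Submodule.coe_norm, PiLp.norm_sq_eq_of_L2, Fintype.sum_option]
    simp only [hroot]
    rfl
  have henergy : energyOn S A (excitedVec S A f) =
      ∑ i : A, (‖root S i.1 (excitedVec S A f)‖ ^ 2 - ‖excitedVec S A f‖ ^ 2) := by
    rw [energyOn, ← Finset.sum_coe_sort A]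
    rfl
  rw [hnorm, henergy, Finset.sum_sub_distrib, Finset.sum_const, nsmul_eq_mul, Finset.card_univ,
    Fintype.card_coe]
  ring

lemma formNorm_excitedVec_le (f : excitedSpace S A) : formNorm S A (excitedVec S A f) ≤ ‖f‖ := by
  refine Real.sqrt_le_iff.2 ⟨norm_nonneg _, ?_⟩
  rw [norm_sq_excitedSpace]
  have : (0 : ℝ) ≤ A.card * ‖excitedVec S A f‖ ^ 2 := by positivity
  linarith

lemma norm_sq_le_energyOn (hx : x ∈ formDomain S A) (h : projPlus S A x = x) :
    ‖x‖ ^ 2 ≤ energyOn S A x := by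
  simpa only [h] using norm_sq_projPlus_le_energyOn hx

lemma norm_sq_excitedSpace_le (f : excitedSpace S A) :
    ‖f‖ ^ 2 ≤ (A.card + 2) * energyOn S A (excitedVec S A f) := by
  have h := norm_sq_le_energyOn (excitedVec_mem_formDomain f) (projPlus_excitedVec f)
  rw [norm_sq_excitedSpace]
  calc _ ≤ energyOn S A (excitedVec S A f) + (A.card + 1) * energyOn S A (excitedVec S A f) := by
        gcongr
    _ = _ := by ring

end ExcitedSpace

section Resolvent

variable {ι : Type*} [Fintype ι] [DecidableEq ι]
variable {𝓗 : Type*} [NormedAddCommGroup 𝓗] [InnerProductSpace ℂ 𝓗] [CompleteSpace 𝓗]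
variable {S : SiteData 𝓗} {A : Finset ι} {x y z u : HTensor ι 𝓗} {h v : Form S A} {C : ℝ}

lemma sqrt_energyOn_le_formNorm (x : HTensor ι 𝓗) : √(energyOn S A x) ≤ formNorm S A x :=
  Real.sqrt_le_sqrt (le_add_of_nonneg_right (sq_nonneg _))

lemma norm_le_formNorm (hx : x ∈ formDomain S A) : ‖x‖ ≤ formNorm S A x :=
  Real.le_sqrt_of_sq_le (le_add_of_nonneg_left (energyOn_nonneg hx))

lemma norm_root_le_formNorm {i : ι} (hi : i ∈ A) (hx : x ∈ formDomain S A) :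
    ‖root S i x‖ ≤ formNorm S A x := by
  have h : siteEnergy S i x ≤ energyOn S A x :=
    Finset.single_le_sum (f := fun i => siteEnergy S i x)
      (fun i hi => siteEnergy_nonneg (formDomain_le S hi hx)) hi
  refine Real.le_sqrt_of_sq_le ?_
  rw [siteEnergy] at h
  linarith

lemma boundedBy_formH0 (S : SiteData 𝓗) (A : Finset ι) :
    (formH0 S A).BoundedBy (A.card * 2) := by
  intro x hx y hy
  rw [formH0_eval hx hy, mul_assoc, mul_assoc, ← nsmul_eq_mul]
  refine (norm_sum_le _ _).trans (Finset.sum_le_card_nsmul _ _ _ fun i hi => ?_)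
  have hroot := (norm_inner_le_norm (𝕜 := ℂ) (root S i x) (root S i y)).trans
    (mul_le_mul (norm_root_le_formNorm hi hx) (norm_root_le_formNorm hi hy) (norm_nonneg _)
      (formNorm_nonneg x))
  have hvec := (norm_inner_le_norm (𝕜 := ℂ) x y).trans
    (mul_le_mul (norm_le_formNorm hx) (norm_le_formNorm hy) (norm_nonneg _) (formNorm_nonneg x))
  exact (norm_sub_le _ _).trans ((add_le_add hroot hvec).trans_eq (two_mul _).symm)

lemma inner_projMinus_eq_zero (hu : projPlus S A u = u) (z : HTensor ι 𝓗) :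
    inner ℂ (projMinus S A z) u = 0 :=
  hu ▸ inner_projMinus_projPlus z u

lemma siteForm_projMinus {i : ι} (hi : i ∈ A) (hu : u ∈ formDomain S A)
    (hu' : projPlus S A u = u) (z : HTensor ι 𝓗) : siteForm S i (projMinus S A z) u = 0 := by
  have hr : projPlus S A (root S i u) = root S i u := by
    conv_rhs => rw [← hu']
    rw [projPlus_eq_diagOp, root_map (commute_siteOp_invSqrt_diagOp i _) (formDomain_le S hi hu)]
  rw [siteForm, root_projMinus hi, inner_projMinus_eq_zero hu', inner_projMinus_eq_zero hr,
    sub_self]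

lemma commute_projPlus_numberWeight (S : SiteData 𝓗) (A B : Finset ι) :
    Commute (projPlus S A) (numberWeight S B) := by
  rw [numberWeight_eq_diagOp, projPlus_eq_diagOp, Commute, SemiconjBy, diagOp_mul, diagOp_mul,
    mul_comm]

namespace Form.IsPerturbedH0

lemma eval_projMinus (hh : h.IsPerturbedH0) (hu : u ∈ formDomain S A) (hu' : projPlus S A u = u)
    (z : HTensor ι 𝓗) : h.eval (projMinus S A z) u = 0 := by
  have hz := projMinus_mem_formDomain (S := S) A z
  have hb := hh.energyBoundedBy _ hz u hu
  rw [energyOn_projMinus, Real.sqrt_zero, mul_zero, zero_mul, norm_le_zero_iff, eval_sub,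
    sub_eq_zero] at hb
  rw [hb, formH0_eval hz hu, Finset.sum_eq_zero fun i hi => siteForm_projMinus hi hu hu' z]

lemma boundedBy (hh : h.IsPerturbedH0) : h.BoundedBy (A.card * 2 + 1 / 2) := by
  intro x hx y hy
  have hsplit : h.eval x y = (formH0 S A).eval x y + (h - formH0 S A).eval x y := by
    rw [eval_sub, add_sub_cancel]
  rw [hsplit, add_mul, add_mul]
  refine (norm_add_le _ _).trans (add_le_add (boundedBy_formH0 S A x hx y hy)
    ((hh.energyBoundedBy x hx y hy).trans ?_))
  have hnonneg := formNorm_nonneg (S := S) (A := A) x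
  gcongr
  · exact sqrt_energyOn_le_formNorm x
  · exact sqrt_energyOn_le_formNorm y

lemma exists_unit (hh : h.IsPerturbedH0) :
    ∃ b : (excitedSpace S A →L[ℂ] excitedSpace S A)ˣ, ∀ e f,
      inner ℂ e (b.1 f) = h.eval (excitedVec S A e) (excitedVec S A f) := by
  obtain ⟨b, hb⟩ := h.exists_inner_eq (excitedVec S A : excitedSpace S A →ₗ[ℂ] HTensor ι 𝓗)
    excitedVec_mem_formDomain (excitedVec S A : excitedSpace S A →ₗ[ℂ] HTensor ι 𝓗)
    excitedVec_mem_formDomain fun e f =>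
      (hh.boundedBy _ (excitedVec_mem_formDomain e) _ (excitedVec_mem_formDomain f)).trans <| by
        have := hh.boundedBy.nonneg
        gcongr
        · exact formNorm_nonneg _
        · exact formNorm_excitedVec_le e
        · exact formNorm_excitedVec_le f
  have hunit : IsUnit b := by
    refine ContinuousLinearMap.isUnit_of_forall_le_norm_inner_map b
      (c := (1 / (2 * (A.card + 2)) : NNReal)) (by positivity) fun f => ?_
    have hcoer := hh.half_energyOn_le_norm_eval (excitedVec_mem_formDomain f)
    have hnorm := norm_sq_excitedSpace_le f
    rw [norm_inner_symm, hb]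
    refine le_trans ?_ hcoer
    push_cast
    rw [mul_one_div, div_le_iff₀ (by positivity)]
    linarith
  obtain ⟨b, rfl⟩ := hunit
  exact ⟨b, hb⟩

/-- The Lax-Milgram argument on `D((H⁰_A) ^ (1/2)) ∩ ran P⁺_A`. -/
lemma exists_isResolventTerm (hh : h.IsPerturbedH0) (hv : v.BoundedBy C) :
    ∃ T, IsResolventTerm h 0 v T := by
  obtain ⟨b, hb⟩ := hh.exists_unit
  obtain ⟨R, hR⟩ := v.exists_inner_eq (excitedVec S A : excitedSpace S A →ₗ[ℂ] HTensor ι 𝓗)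
    excitedVec_mem_formDomain (projMinus S A : HTensor ι 𝓗 →ₗ[ℂ] HTensor ι 𝓗)
    (projMinus_mem_formDomain A) fun e y =>
      (hv _ (excitedVec_mem_formDomain e) _ (projMinus_mem_formDomain A y)).trans <| by
        rw [formNorm_projMinus]
        have := hv.nonneg
        gcongr
        · exact formNorm_excitedVec_le e
        · exact norm_projMinus_le y
  refine ⟨excitedVec S A ∘L b⁻¹.1 ∘L R, fun y => ?_⟩
  let f : excitedSpace S A := b⁻¹.1 (R y)
  have hbf : b.1 f = R y := DFunLike.congr_fun b.mul_inv (R y)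
  have hf := excitedVec_mem_formDomain f
  have hf' := projPlus_excitedVec f
  refine ⟨hf, hf', fun z hz => ?_⟩
  have hz' := projPlus_mem_formDomain A hz
  obtain ⟨e, he⟩ := exists_excitedVec_eq hz' (projPlus_eq_self_iff.2 (projMinus_projPlus A z))
  rw [zero_mul, sub_zero]
  calc h.eval z (excitedVec S A f)
      = h.eval (projMinus S A z + projPlus S A z) (excitedVec S A f) := by
        rw [projMinus_add_projPlus]
    _ = h.eval (excitedVec S A e) (excitedVec S A f) := by
        rw [h.eval_add_left (projMinus_mem_formDomain A z) hz' hf, hh.eval_projMinus hf hf',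
          zero_add, he]
    _ = v.eval (projPlus S A z) (projMinus S A y) := by
        rw [← hb, hbf, hR, ← he]
        rfl

lemma isResolventTerm_unique (hh : h.IsPerturbedH0) {T T' : HTensor ι 𝓗 →L[ℂ] HTensor ι 𝓗}
    (hT : IsResolventTerm h 0 v T) (hT' : IsResolventTerm h 0 v T') : T = T' := by
  ext1 y
  obtain ⟨hmem, hplus, heq⟩ := hT y
  obtain ⟨hmem', hplus', heq'⟩ := hT' y
  have hw : T y - T' y ∈ formDomain S A := sub_mem hmem hmem'
  have hzero : h.eval (T y - T' y) (T y - T' y) = 0 := by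
    have hadd := h.eval_add_right hw hmem' hw
    rw [add_sub_cancel] at hadd
    simp only [zero_mul, sub_zero] at *
    linear_combination -hadd + heq _ hw - heq' _ hw
  have hcoer := hh.half_energyOn_le_norm_eval hw
  rw [hzero, norm_zero] at hcoer
  have hgap := norm_sq_le_energyOn hw (by rw [map_sub, hplus, hplus'])
  have hnorm : ‖T y - T' y‖ ^ 2 ≤ 0 := by linarith
  exact sub_eq_zero.1 (norm_eq_zero.1 (pow_eq_zero_iff two_ne_zero |>.1
    (hnorm.antisymm (sq_nonneg _))))

lemma existsUnique_isResolventTerm (hh : h.IsPerturbedH0) (hv : v.BoundedBy C) :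
    ∃! T, IsResolventTerm h 0 v T :=
  (hh.exists_isResolventTerm hv).imp fun _ hT => ⟨hT, fun _ hT' => hh.isResolventTerm_unique hT' hT⟩

lemma formNorm_numberWeight_le (hh : h.IsPerturbedH0) {C : NNReal}
    (hC : ∀ x ∈ formDomain S A, ∀ y,
      ‖v.eval (projPlus S A (numberWeight S A x)) (projMinus S A y)‖ ≤ C * formNorm S A x * ‖y‖)
    {T : HTensor ι 𝓗 →L[ℂ] HTensor ι 𝓗} (hT : IsResolventTerm h 0 v T) (y : HTensor ι 𝓗) :
    formNorm S A (numberWeight S A (T y)) ≤ 4 * C * ‖y‖ := by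
  obtain ⟨hmem, hplus, heq⟩ := hT y
  let w := numberWeight S A (T y)
  have hw : w ∈ formDomain S A := numberWeight_mem_formDomain A hmem
  have hw' : projPlus S A w = w := by
    simp only [w]
    conv_rhs => rw [← hplus]
    exact DFunLike.congr_fun (commute_projPlus_numberWeight S A A) (T y)
  have hsq : formNorm S A w ^ 2 ≤ 2 * energyOn S A w := by
    rw [formNorm, Real.sq_sqrt (add_nonneg (energyOn_nonneg hw) (sq_nonneg _)), two_mul]
    exact add_le_add_right (norm_sq_le_energyOn hw hw') _
  have hcoer := hh.half_energyOn_le_norm_eval_numberWeight hw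
  have hres := heq _ (numberWeight_mem_formDomain A hw)
  rw [zero_mul, sub_zero] at hres
  rw [numberRoot_numberWeight, hres] at hcoer
  have hmul : formNorm S A w * formNorm S A w ≤ 4 * C * ‖y‖ * formNorm S A w := by
    linarith [hC w hw y]
  rcases (formNorm_nonneg (S := S) (A := A) w).eq_or_lt with hzero | hpos
  · exact hzero.symm.trans_le (by positivity)
  · exact le_of_mul_le_mul_right hmul hpos

lemma weightedNorm_le (hh : h.IsPerturbedH0) {T : HTensor ι 𝓗 →L[ℂ] HTensor ι 𝓗}
    (hT : IsResolventTerm h 0 v T) : weightedNorm S A T ≤ 4 * v.doublyWeightedNorm := by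
  have h4 : (4 : ℝ≥0∞) ≠ 0 := by simp
  have h4' : (4 : ℝ≥0∞) ≠ ⊤ := by simp
  rw [Form.doublyWeightedNorm, sInf_eq_iInf, ENNReal.mul_iInf_of_ne h4 h4']
  refine le_iInf fun C => ?_
  rw [ENNReal.mul_iInf_of_ne h4 h4']
  refine le_iInf fun hC => ?_
  induction C with
  | top => simp
  | coe C =>
    refine sInf_le fun y => ?_
    have hw := numberWeight_mem_formDomain (S := S) A (hT y).1
    have hle := hh.formNorm_numberWeight_le (C := C) (fun x hx y => ?_) hT y
    · rw [weight_of_mem hw]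
      refine ENNReal.ofReal_le_of_le_toReal (hle.trans_eq ?_)
      simp
    · have hxy := hC x hx y
      rw [weight_of_mem hx] at hxy
      simpa [formNorm_nonneg] using ENNReal.toReal_mono (by finiteness) hxy

end Form.IsPerturbedH0

lemma isResolventTerm_sub_smul_formOne {g : Form S A} {E : ℂ} {T : HTensor ι 𝓗 →L[ℂ] HTensor ι 𝓗} :
    IsResolventTerm (g - E • formOne S A) 0 v T ↔ IsResolventTerm g E v T := by
  refine forall_congr' fun y => and_congr_right fun hT => and_congr_right fun _ =>
    forall₂_congr fun z hz => ?_
  rw [Form.eval_sub, Form.eval_smul, formOne_eval hz hT, zero_mul, sub_zero]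

lemma Form.IsPerturbedH0.existsUnique_and_weightedNorm_le {g : Form S A}
    (hg : g.vacuumShift.IsPerturbedH0) (hv : v.BoundedBy C) :
    (∃! T, IsResolventTerm g (g.eval (vacuum S) (vacuum S)) v T) ∧
      weightedNorm S A (resolventTerm g (g.eval (vacuum S) (vacuum S)) v) ≤
        4 * v.doublyWeightedNorm := by
  have hex : ∃! T, IsResolventTerm g (g.eval (vacuum S) (vacuum S)) v T := by
    simpa only [Form.vacuumShift, isResolventTerm_sub_smul_formOne] using
      hg.existsUnique_isResolventTerm hv
  refine ⟨hex, ?_⟩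
  rw [resolventTerm, dif_pos hex]
  exact hg.weightedNorm_le (isResolventTerm_sub_smul_formOne.2 hex.choose_spec.1)

end Resolvent

section Rectangles

namespace Rect

variable {d N : ℕ} {J K : Rect d N}

/-- The order of the rectangles as a lexicographic order: by the size, then by the side lengths
(reversed, and compared from the first on), then by the corner (compared from the last coordinate
on). -/
def lexEmbedding : (LT.lt : Rect d N → Rect d N → Prop) ↪r
    (LT.lt : ℕ ×ₗ (Lex (Fin d → ℕᵒᵈ) ×ₗ Lex ((Fin d)ᵒᵈ → ℕ)) → _ → Prop) where
  toFun J := toLex (J.size, toLex (toLex fun j => OrderDual.toDual (J.k j),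
    toLex fun j => J.q (OrderDual.ofDual j)))
  inj' J L h := by
    simp only [EmbeddingLike.apply_eq_iff_eq, Prod.mk.injEq] at h
    exact Rect.ext h.2.1 h.2.2
  map_rel_iff' {J L} := by
    have hk : (toLex fun j => OrderDual.toDual (J.k j) : Lex (Fin d → ℕᵒᵈ)) =
        toLex (fun j => OrderDual.toDual (L.k j)) ↔ ∀ l, L.k l = J.k l :=
      funext_iff.trans (forall_congr' fun _ => eq_comm)
    have hsize (h : ∀ l, L.k l = J.k l) : J.size = L.size :=
      Finset.sum_congr rfl fun l _ => (h l).symm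
    have hk_lt : (toLex fun j => OrderDual.toDual (J.k j) : Lex (Fin d → ℕᵒᵈ)) <
        toLex (fun j => OrderDual.toDual (L.k j)) ↔ ∃ j, (∀ l < j, L.k l = J.k l) ∧ L.k j < J.k j :=
      exists_congr fun j => and_congr_left' (forall₂_congr fun _ _ => eq_comm)
    have hq_lt : (toLex fun j => J.q (OrderDual.ofDual j) : Lex ((Fin d)ᵒᵈ → ℕ)) <
        toLex (fun j => L.q (OrderDual.ofDual j)) ↔
        ∃ j, (∀ l, j < l → L.q l = J.q l) ∧ J.q j < L.q j :=
      exists_congr fun j => and_congr_left' (forall₂_congr fun _ _ => eq_comm)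
    change toLex (J.size, toLex (toLex _, toLex _)) < toLex (L.size, toLex (toLex _, toLex _)) ↔ _
    rw [Prod.Lex.toLex_lt_toLex, Prod.Lex.toLex_lt_toLex, hk, hk_lt, hq_lt, and_or_left,
      and_iff_right_of_imp (b := (∀ l, L.k l = J.k l) ∧ _) fun h => hsize h.1]
    rfl

instance : IsStrictTotalOrder (Rect d N) (· < ·) :=
  lexEmbedding.isStrictTotalOrder

lemma index_lt_index (h : J < K) : J.index < K.index :=
  Set.ncard_lt_ncard (s := {L | L < J}) (t := {L | L < K})
    ⟨fun _ hL => trans_of (· < ·) hL h, fun hs => irrefl_of (· < ·) J (hs h)⟩ (Set.toFinite _)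

lemma index_mono (h : J ≤ L) : J.index ≤ L.index := by
  rcases h with rfl | hlt
  exacts [le_rfl, (index_lt_index hlt).le]

lemma index_injective : Function.Injective (index : Rect d N → ℕ) := by
  intro J L h
  rcases trichotomous_of LT.lt J L with h' | h' | h'
  · exact absurd h (index_lt_index h').ne
  · exact h'
  · exact absurd h (index_lt_index h').ne'

lemma le_of_not_lt (h : ¬ J < K) : K ≤ J := by
  rcases trichotomous_of LT.lt J K with h' | h' | h'
  exacts [absurd h' h, Or.inl h'.symm, Or.inr h']

lemma le_of_lt_of_covBy {s : Rect d N} (hs : s ⋖ K) (h : J < K) : J ≤ s :=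
  le_of_not_lt fun hsJ => hs.2 hsJ h

lemma mem_sites {i : Site d N} :
    i ∈ J.sites ↔ ∀ j, J.q j ≤ (i j : ℕ) ∧ (i j : ℕ) ≤ J.q j + J.k j := by
  simp [sites]

lemma k_le_size (J : Rect d N) (j : Fin d) : J.k j ≤ J.size :=
  Finset.single_le_sum (f := J.k) (fun _ _ => Nat.zero_le _) (Finset.mem_univ j)

lemma bounds_of_sites_subset (h : J.sites ⊆ K.sites) (j : Fin d) :
    K.q j ≤ J.q j ∧ J.q j + J.k j ≤ K.q j + K.k j := by
  have hlower : (fun j => ⟨J.q j, Finset.mem_Icc.2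
      ⟨J.one_le j, (Nat.le_add_right _ _).trans (J.le_N j)⟩⟩ : Site d N) ∈ J.sites :=
    mem_sites.2 fun j => by simp
  have hupper : (fun j => ⟨J.q j + J.k j, Finset.mem_Icc.2
      ⟨(J.one_le j).trans (Nat.le_add_right _ _), J.le_N j⟩⟩ : Site d N) ∈ J.sites :=
    mem_sites.2 fun j => by simp
  exact ⟨(mem_sites.1 (h hlower) j).1, (mem_sites.1 (h hupper) j).2⟩

lemma size_lt_of_sites_ssubset (h : J.sites ⊂ K.sites) : J.size < K.size := by
  have hbounds := bounds_of_sites_subset h.1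
  have hk j : J.k j ≤ K.k j := by have := hbounds j; omega
  refine lt_of_le_of_ne (Finset.sum_le_sum fun j _ => hk j) fun heq => h.2 fun i hi => ?_
  have hk' := (Finset.sum_eq_sum_iff_of_le fun j _ => hk j).1 heq
  refine mem_sites.2 fun j => ?_
  have := hbounds j
  have := hk' j (Finset.mem_univ j)
  have := mem_sites.1 hi j
  omega

lemma lt_of_sites_ssubset (h : J.sites ⊂ K.sites) : J < K :=
  Or.inl (size_lt_of_sites_ssubset h)

lemma index_pos (hJ : 1 ≤ J.size) : 0 < J.index := by
  let L : Rect d N := ⟨fun _ => 0, J.q, J.one_le, fun j => (Nat.le_add_right _ _).trans (J.le_N j)⟩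
  have hL : L.size = 0 := by simp [L, size]
  exact (Nat.zero_le _).trans_lt (index_lt_index (Or.inl (hL.trans_lt hJ) : L < J))

lemma card_sites_le (J : Rect d N) : J.sites.card ≤ (J.size + 1) ^ d := by
  let side j : Finset (Finset.Icc 1 N) := {i | J.q j ≤ (i : ℕ) ∧ (i : ℕ) ≤ J.q j + J.k j}
  have hside j : (side j).card ≤ J.size + 1 :=
    calc (side j).card ≤ (Finset.Icc (J.q j) (J.q j + J.k j)).card :=
          Finset.card_le_card_of_injOn Subtype.val (fun i hi => by simpa [side] using hi)
            Subtype.val_injective.injOn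
      _ ≤ J.size + 1 := by
          have := J.k_le_size j
          rw [Nat.card_Icc]
          omega
  calc J.sites.card ≤ (Fintype.piFinset side).card :=
        Finset.card_le_card fun i hi => by simpa [side] using mem_sites.1 hi
    _ = ∏ j, (side j).card := Fintype.card_piFinset _
    _ ≤ (J.size + 1) ^ d := by
        simpa using Finset.prod_le_pow_card Finset.univ _ _ fun j _ => hside j

lemma card_sites_add_one_div_le (J : Rect d N) (hJ : 1 ≤ J.size) :
    ((J.sites.card : ℝ) + 1) / (J.size : ℝ) ^ (20 * d) ≤
      2 ^ (5 * d + 1) / ((J.size : ℝ) + 1) ^ (4 * d) := by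
  have hr : (1 : ℝ) ≤ J.size := by exact_mod_cast hJ
  have hcard : (J.sites.card : ℝ) ≤ (J.size + 1) ^ d := by exact_mod_cast card_sites_le J
  have hone : (1 : ℝ) ≤ (J.size + 1) ^ d := one_le_pow₀ (by linarith)
  rw [div_le_div_iff₀ (by positivity) (by positivity)]
  calc ((J.sites.card : ℝ) + 1) * (J.size + 1) ^ (4 * d)
      ≤ (2 * (J.size + 1) ^ d) * (J.size + 1) ^ (4 * d) := by
        gcongr
        linarith
    _ = 2 * (J.size + 1 : ℝ) ^ (5 * d) := by ring
    _ ≤ 2 * (2 * J.size : ℝ) ^ (5 * d) := by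
        gcongr
        linarith
    _ = 2 ^ (5 * d + 1) * (J.size : ℝ) ^ (5 * d) := by ring
    _ ≤ 2 ^ (5 * d + 1) * (J.size : ℝ) ^ (20 * d) := by
        gcongr
        norm_num

lemma sum_range_inv_sq_le (n : ℕ) : ∑ m ∈ Finset.range n, (((m : ℝ) + 1) ^ 2)⁻¹ ≤ 2 := by
  calc ∑ m ∈ Finset.range n, (((m : ℝ) + 1) ^ 2)⁻¹
      = ∑ m ∈ Finset.Ioo 0 (n + 1), ((m : ℝ) ^ 2)⁻¹ := by
        rw [Finset.range_eq_Ico, show Finset.Ioo 0 (n + 1) = Finset.Ico (0 + 1) (n + 1) from rfl,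
          ← Finset.sum_Ico_add']
        simp only [Nat.cast_add, Nat.cast_one]
    _ ≤ 2 := by simpa using sum_Ioo_inv_sq_le (α := ℝ) 0 (n + 1)

/-- The distances of `i` from the two ends of `J`, in each direction. -/
def gaps (i : Site d N) (J : Rect d N) (j : Fin d) : ℕ × ℕ :=
  (i j - J.q j, J.q j + J.k j - i j)

lemma injOn_gaps (i : Site d N) : Set.InjOn (gaps i) {J | i ∈ J.sites} := by
  intro J hJ L hL h
  have heq j : J.k j = L.k j ∧ J.q j = L.q j := by
    have hj := congrFun h j
    simp only [gaps, Prod.mk.injEq] at hj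
    have := mem_sites.1 hJ j
    have := mem_sites.1 hL j
    omega
  exact Rect.ext (funext fun j => (heq j).1) (funext fun j => (heq j).2)

lemma gaps_le_size {i : Site d N} (hi : i ∈ J.sites) (j : Fin d) :
    (gaps i J j).1 ≤ J.size ∧ (gaps i J j).2 ≤ J.size := by
  have := mem_sites.1 hi j
  have := J.k_le_size j
  simp only [gaps]
  omega

lemma gaps_mem {i : Site d N} (hi : i ∈ J.sites) (j : Fin d) :
    gaps i J j ∈ Finset.range N ×ˢ Finset.range N := by
  have := mem_sites.1 hi j
  have := J.one_le j
  have := J.le_N j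
  simp only [gaps, Finset.mem_product, Finset.mem_range]
  omega

lemma one_div_size_pow_le {i : Site d N} (hi : i ∈ J.sites) :
    1 / ((J.size : ℝ) + 1) ^ (4 * d) ≤
      ∏ j, (((gaps i J j).1 + 1 : ℝ) ^ 2)⁻¹ * (((gaps i J j).2 + 1 : ℝ) ^ 2)⁻¹ := by
  calc 1 / ((J.size : ℝ) + 1) ^ (4 * d)
      = ∏ _j : Fin d, (((J.size : ℝ) + 1) ^ 2)⁻¹ * (((J.size : ℝ) + 1) ^ 2)⁻¹ := by
        rw [Finset.prod_const, Finset.card_univ, Fintype.card_fin, pow_mul, ← one_div_pow]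
        congr 1
        field_simp
    _ ≤ _ := by
        refine Finset.prod_le_prod (fun _ _ => by positivity) fun j _ => ?_
        gcongr
        exacts [(gaps_le_size hi j).1, (gaps_le_size hi j).2]

open Classical in
/-- Summing over the `gaps` instead of the rectangles gives a product of `2 d` convergent series. -/
lemma sum_one_div_size_pow_le (i : Site d N) :
    ∑ J : Rect d N with i ∈ J.sites, 1 / ((J.size : ℝ) + 1) ^ (4 * d) ≤ 4 ^ d := by
  let w (c : ℕ × ℕ) : ℝ := (((c.1 : ℝ) + 1) ^ 2)⁻¹ * (((c.2 : ℝ) + 1) ^ 2)⁻¹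
  let R := Finset.range N ×ˢ Finset.range N
  have hw c : 0 ≤ w c := by positivity
  have hR : 0 ≤ ∑ c ∈ R, w c := Finset.sum_nonneg fun c _ => hw c
  have hR4 : ∑ c ∈ R, w c ≤ 4 := by
    have h := sum_range_inv_sq_le N
    simp only [R, w, Finset.sum_product, ← Finset.sum_mul_sum]
    exact (mul_self_le_mul_self (by positivity) h).trans (by norm_num)
  calc ∑ J : Rect d N with i ∈ J.sites, 1 / ((J.size : ℝ) + 1) ^ (4 * d)
      ≤ ∑ J : Rect d N with i ∈ J.sites, ∏ j, w (gaps i J j) :=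
        Finset.sum_le_sum fun J hJ => one_div_size_pow_le (Finset.mem_filter.1 hJ).2
    _ = ∑ c ∈ ({J | i ∈ J.sites} : Finset (Rect d N)).image (gaps i), ∏ j, w (c j) := by
        rw [Finset.sum_image]
        simpa using injOn_gaps i
    _ ≤ ∑ c ∈ Fintype.piFinset fun _ => R, ∏ j, w (c j) := by
        refine Finset.sum_le_sum_of_subset_of_nonneg (Finset.image_subset_iff.2 fun J hJ => ?_)
          fun c _ _ => Finset.prod_nonneg fun j _ => hw _
        exact Fintype.mem_piFinset.2 (gaps_mem (Finset.mem_filter.1 hJ).2)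
    _ = (∑ c ∈ R, w c) ^ d := by
        rw [← Finset.prod_univ_sum, Finset.prod_const, Finset.card_univ, Fintype.card_fin]
    _ ≤ 4 ^ d := by gcongr

end Rect

end Rectangles

section Flow

variable {d N : ℕ}
variable {𝓗 : Type*} [NormedAddCommGroup 𝓗] [InnerProductSpace ℂ 𝓗] [CompleteSpace 𝓗]
variable {S : SiteData 𝓗} {V W : Potentials S d N} {s K : Rect d N}

lemma localOps_mono {ι : Type*} [Fintype ι] [DecidableEq ι] {A B : Finset ι} (h : A ⊆ B) :
    localOps 𝓗 A ≤ localOps 𝓗 B :=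
  fun _ hX => mem_localOps.2 fun j hj => mem_localOps.1 hX j fun hjA => hj (h hjA)

lemma isLocal_formG (t : ℝ) (hW : ∀ J, (W J).IsLocal) (K : Rect d N) :
    (formG t W K).IsLocal :=
  (Form.localForms S _).add_mem (Form.isLocal_formH0 S _) <|
    (Form.localForms S _).smul_mem _ <|
      (Form.localForms S _).sum_mem fun J _ => (hW J).extend K.sites

lemma isLocal_initial (hV : ∀ J, J.size = 1 → (V J).IsLocal) (J : Rect d N) :
    (initial V J).IsLocal := by
  unfold initial
  split_ifs with h0 h1
  exacts [Form.isLocal_formH0 S J.sites, hV J h1, Form.isLocal_zero]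

lemma isLocal_step (t : ℝ) (s : Rect d N) (hW : ∀ J, (W J).IsLocal) (J : Rect d N) :
    (step t s W J).IsLocal := by
  unfold step
  split_ifs with hJs hsub
  · exact (isLocal_formG t hW J).diagonalized (hW J) _ t
  · have hX : stepGenerator t W s ∈ localOps 𝓗 J.sites :=
      localOps_mono hsub.1 (generator_mem_localOps (isLocal_formG t hW s) (hW s) _ t)
    exact (Form.localForms S _).add_mem (hW J) <|
      (Form.localForms S _).sum_mem fun L _ => ((hW L).extend J.sites).adExp hX
  · exact hW J

lemma isLocal_effectiveAux (t : ℝ) (hV : ∀ J, J.size = 1 → (V J).IsLocal) (n : ℕ)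
    (J : Rect d N) : (effectiveAux t V n J).IsLocal := by
  induction n generalizing J with
  | zero => exact isLocal_initial hV J
  | succ n ih =>
    rw [effectiveAux]
    split_ifs with h
    exacts [isLocal_step t _ ih J, ih J]

lemma step_eq_self_of_not_le (t : ℝ) (W : Potentials S d N) {J : Rect d N} (h : ¬s ≤ J) :
    step t s W J = W J := by
  have hne : J ≠ s := fun heq => h (Or.inl heq.symm)
  have hsub : ¬s.sites ⊂ J.sites := fun hc => h (Or.inr (Rect.lt_of_sites_ssubset hc))
  rw [step, if_neg hne, if_neg hsub]

lemma isBlockDiag_effectiveAux (t : ℝ) (V : Potentials S d N) {n : ℕ} {J : Rect d N}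
    (hJ : 1 ≤ J.size) (hn : J.index ≤ n) : (effectiveAux t V n J).IsBlockDiag := by
  induction n with
  | zero => exact absurd (Rect.index_pos hJ) hn.not_gt
  | succ n ih =>
    rw [effectiveAux]
    split_ifs with h
    · obtain ⟨hs, -⟩ := h.choose_spec
      rcases hn.lt_or_eq with hlt | heq
      · have hJs : ¬h.choose ≤ J := fun hle => (Rect.index_mono hle).not_gt (hs.symm ▸ hlt)
        rw [step_eq_self_of_not_le t _ hJs]
        exact ih (Nat.le_of_lt_succ hlt)
      · rw [← Rect.index_injective (heq.trans hs.symm), step, if_pos rfl]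
        exact isBlockDiag_diagonalized t _ _ _
    · exact ih (Nat.le_of_lt_succ (hn.lt_of_ne fun heq => h ⟨J, heq, hJ⟩))

lemma isBlockDiag_effective (t : ℝ) (V : Potentials S d N) {J : Rect d N} (hJ : 1 ≤ J.size)
    (hs : J ≤ s) : (effective t V s J).IsBlockDiag :=
  isBlockDiag_effectiveAux t V hJ (Rect.index_mono hs)

end Flow

section Coupling

variable {d N : ℕ}
variable {𝓗 : Type*} [NormedAddCommGroup 𝓗] [InnerProductSpace ℂ 𝓗] [CompleteSpace 𝓗]
variable {S : SiteData 𝓗} {V W : Potentials S d N} {s J K : Rect d N} {t : ℝ}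

namespace Form

variable {ι : Type*} [Fintype ι] [DecidableEq ι] {A : Finset ι} {u v w : Form S A} {c : ℝ}

lemma ext_eval (h : ∀ x ∈ formDomain S A, ∀ y ∈ formDomain S A, v.eval x y = w.eval x y) :
    v = w :=
  LinearMap.ext₂ fun x y => by
    simpa only [eval_of_mem _ x.2 y.2] using h x x.2 y y.2

lemma EnergyBoundedBy.smul (hu : u.EnergyBoundedBy c) (ht : 0 ≤ t) :
    ((t : ℂ) • u).EnergyBoundedBy (t * c) := fun x hx y hy => by
  rw [eval_smul, norm_mul, Complex.norm_real, Real.norm_of_nonneg ht, mul_assoc t, mul_assoc t]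
  exact mul_le_mul_of_nonneg_left (hu x hx y hy) ht

end Form

open Classical in
lemma formG_eval {x y : HTensor (Site d N) 𝓗} (t : ℝ) (W : Potentials S d N)
    (hx : x ∈ formDomain S K.sites) (hy : y ∈ formDomain S K.sites) :
    (formG t W K).eval x y = (formH0 S K.sites).eval x y +
      t * ∑ J : Rect d N with J.sites ⊂ K.sites ∧ 1 ≤ J.size, (W J).eval x y := by
  rw [formG, Form.eval_add, Form.eval_smul, Form.eval_sum]
  congr 2
  exact Finset.sum_congr rfl fun J hJ =>
    (W J).eval_extend (Finset.mem_filter.1 hJ).2.1.1 hx hy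

open Classical in
lemma vacuumShift_formG_sub (t : ℝ) (W : Potentials S d N) (K : Rect d N) :
    (formG t W K).vacuumShift - formH0 S K.sites =
      ∑ J : Rect d N with J.sites ⊂ K.sites ∧ 1 ≤ J.size,
        ((t : ℂ) • (W J).vacuumShift).extend K.sites := by
  have hΩ := vacuum_mem_formDomain (S := S) K.sites
  have hH : (formH0 S K.sites).eval (vacuum S) (vacuum S) = 0 := by
    rw [formH0_eval_self hΩ, ← projMinus_vacuum K.sites, energyOn_projMinus, Complex.ofReal_zero]
  refine Form.ext_eval fun x hx y hy => ?_
  rw [Form.eval_sub, Form.vacuumShift_eval hx hy, formG_eval t W hx hy, formG_eval t W hΩ hΩ,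
    Form.eval_sum, hH]
  have hterm : ∀ J ∈ ({J | J.sites ⊂ K.sites ∧ 1 ≤ J.size} : Finset (Rect d N)),
      (((t : ℂ) • (W J).vacuumShift).extend K.sites).eval x y =
        t * ((W J).eval x y - (W J).eval (vacuum S) (vacuum S) * inner ℂ x y) := fun J hJ => by
    have hJK := (Finset.mem_filter.1 hJ).2.1.1
    rw [Form.eval_extend _ hJK hx hy, Form.eval_smul,
      Form.vacuumShift_eval (formDomain_anti S hJK hx) (formDomain_anti S hJK hy)]
  rw [Finset.sum_congr rfl hterm, ← Finset.mul_sum, Finset.sum_sub_distrib, ← Finset.sum_mul]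
  ring

/-- The constant `t_d`: with potentials of norm at most `96 / r ^ (20 d)` and the factor `3` lost
in the vacuum shift, it makes the sum over all rectangles through a site at most `1 / 2`. -/
def couplingThreshold (d : ℕ) : ℝ := 1 / (1152 * 2 ^ (7 * d))

lemma couplingThreshold_pos (d : ℕ) : 0 < couplingThreshold d := by
  unfold couplingThreshold
  positivity

lemma couplingThreshold_le_one (d : ℕ) : couplingThreshold d ≤ 1 :=
  div_le_one_of_le₀ (by nlinarith [one_le_pow₀ (n := 7 * d) (one_le_two (α := ℝ))]) (by positivity)

open Classical in
lemma sum_coupling_le (ht : 0 ≤ t) (htd : t ≤ couplingThreshold d) (i : Site d N) :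
    ∑ J : Rect d N with i ∈ J.sites ∧ 1 ≤ J.size,
      t * (3 * (96 / (J.size : ℝ) ^ (20 * d))) * (J.sites.card + 1) ≤ 1 / 2 := by
  have hterm : ∀ J ∈ ({J | i ∈ J.sites ∧ 1 ≤ J.size} : Finset (Rect d N)),
      t * (3 * (96 / (J.size : ℝ) ^ (20 * d))) * (J.sites.card + 1) ≤
        t * 288 * 2 ^ (5 * d + 1) * (1 / ((J.size : ℝ) + 1) ^ (4 * d)) := fun J hJ => by
    have h := mul_le_mul_of_nonneg_left
      (J.card_sites_add_one_div_le (Finset.mem_filter.1 hJ).2.2) (by positivity : 0 ≤ t * 288)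
    calc _ = t * 288 * ((J.sites.card + 1) / (J.size : ℝ) ^ (20 * d)) := by ring
      _ ≤ _ := h
      _ = _ := by ring
  calc _ ≤ ∑ J : Rect d N with i ∈ J.sites ∧ 1 ≤ J.size,
        t * 288 * 2 ^ (5 * d + 1) * (1 / ((J.size : ℝ) + 1) ^ (4 * d)) :=
        Finset.sum_le_sum hterm
    _ ≤ ∑ J : Rect d N with i ∈ J.sites,
        t * 288 * 2 ^ (5 * d + 1) * (1 / ((J.size : ℝ) + 1) ^ (4 * d)) :=
        Finset.sum_le_sum_of_subset_of_nonneg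
          (Finset.monotone_filter_right _ fun _ _ h => h.1) fun _ _ _ => by positivity
    _ ≤ t * 288 * 2 ^ (5 * d + 1) * 4 ^ d := by
        rw [← Finset.mul_sum]
        gcongr
        exact Rect.sum_one_div_size_pow_le i
    _ = t * (576 * 2 ^ (7 * d)) := by
        rw [show (4 : ℝ) ^ d = 2 ^ (2 * d) by rw [pow_mul]; norm_num]
        ring
    _ ≤ couplingThreshold d * (576 * 2 ^ (7 * d)) := by gcongr
    _ = 1 / 2 := by
        unfold couplingThreshold
        field_simp
        norm_num

lemma isPerturbedH0_vacuumShift_formG (ht : 0 ≤ t) (htd : t ≤ couplingThreshold d)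
    (hl : ∀ J, (W J).IsLocal)
    (hd : ∀ J, J.sites ⊂ K.sites → 1 ≤ J.size → (W J).IsBlockDiag)
    (hb : ∀ J, J.sites ⊂ K.sites → 1 ≤ J.size → (W J).BoundedBy (96 / (J.size : ℝ) ^ (20 * d))) :
    (formG t W K).vacuumShift.IsPerturbedH0 := by
  classical
  refine Form.isPerturbedH0_of_sum (c := fun J => t * (3 * (96 / (J.size : ℝ) ^ (20 * d))))
    (fun J hJ => (Finset.mem_filter.1 hJ).2.1.1)
    (fun J _ => by positivity) (fun J hJ => ?_)
    (fun J _ => (Form.localForms S _).smul_mem _ (hl J).vacuumShift) (fun i _ => ?_)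
    (vacuumShift_formG_sub t W K)
  · obtain ⟨-, hJK, hJ1⟩ := Finset.mem_filter.1 hJ
    exact ((hb J hJK hJ1).energyBoundedBy_vacuumShift (hl J) (hd J hJK hJ1)).smul ht
  · refine (Finset.sum_le_sum_of_subset_of_nonneg ?_ fun _ _ _ => by positivity).trans
      (sum_coupling_le ht htd i)
    intro J hJ
    simp only [Finset.mem_filter] at hJ ⊢
    exact ⟨hJ.1.1, hJ.2, hJ.1.2.2⟩

variable {a b : Rect d N} {v : Form S J.sites}

lemma InductiveBounds.normH0_ne_top (h : InductiveBounds t s J a b v) (hs : s < J) :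
    v.normH0 ≠ ⊤ := by
  by_cases hsa : s < a
  · exact ne_top_of_le_ne_top ENNReal.ofReal_ne_top (h.small hsa)
  by_cases hsb : s < b
  · exact ne_top_of_le_ne_top ENNReal.ofReal_ne_top (h.middle (Rect.le_of_not_lt hsa) hsb)
  · exact ne_top_of_le_ne_top ENNReal.ofReal_ne_top (h.large (Rect.le_of_not_lt hsb) hs)

lemma InductiveBounds.normH0_le (h : InductiveBounds t s J a b v) (ht : 0 ≤ t) (ht1 : t ≤ 1)
    (hJ : 1 ≤ J.size) (hs : J ≤ s) :
    v.normH0 ≤ ENNReal.ofReal (96 / (J.size : ℝ) ^ (20 * d)) := by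
  refine (h.final hs).trans (ENNReal.ofReal_le_ofReal ?_)
  have hr : (1 : ℝ) ≤ J.size := mod_cast hJ
  have hpow : t ^ (((J.size : ℝ) - 1) / 3) ≤ 1 := Real.rpow_le_one ht ht1 (by linarith)
  rw [mul_div_assoc', mul_comm]
  gcongr
  linarith

end Coupling

end

end LieSchwinger

open LieSchwinger in
theorem lemma4p3_general {d N : ℕ} {𝓗 : Type*} [NormedAddCommGroup 𝓗] [InnerProductSpace ℂ 𝓗]
    [CompleteSpace 𝓗] {S : SiteData 𝓗} {V : Potentials S d N}
    (hV : ∀ J, J.size = 1 → (V J).IsLocal) {t : ℝ} (ht : 0 ≤ t) (htd : t ≤ couplingThreshold d)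
    {s K : Rect d N} (hs : s ⋖ K)
    (hbound : ∀ J, J.sites ⊂ K.sites → 1 ≤ J.size →
      (effective t V s J).normH0 ≤ ENNReal.ofReal (96 / (J.size : ℝ) ^ (20 * d)))
    (hK : (effective t V s K).normH0 ≠ ⊤) :
    let W := effective t V s
    (∃! T, IsResolventTerm (formG t W K) (energy t W K) (W K) T) ∧
    weightedNorm S K.sites (resolventTerm (formG t W K) (energy t W K) (W K)) ≤
      4 * (W K).doublyWeightedNorm := by
  intro W
  have hpert : (formG t W K).vacuumShift.IsPerturbedH0 :=
    isPerturbedH0_vacuumShift_formG ht htd (isLocal_effectiveAux t hV s.index)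
      (fun J hJK hJ => isBlockDiag_effective t V hJ
        (Rect.le_of_lt_of_covBy hs (Rect.lt_of_sites_ssubset hJK)))
      fun J hJK hJ => Form.boundedBy_of_normH0_le (by positivity) (hbound J hJK hJ)
  exact hpert.existsUnique_and_weightedNorm_le (Form.boundedBy_toReal_normH0 hK)

open LieSchwinger in
/-- For a coupling `t` that is small depending on `d` only, the inductive bounds in the step `s`
preceding `K` imply
`‖[H⁰_K]₁^{1/2} [π_K]₁^{-1/2} (G_K - E_K)⁻¹ P⁺_K V_K P⁻_K‖ ≤
C_d ‖[π_K]₁^{-1/2} [H⁰_K]₁^{-1/2} P⁺_K V_K P⁻_K‖`, where `V` are the potentials in step `s`. -/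
theorem lemma4p3 (d : ℕ) (hd : 2 ≤ d) :
    ∃ t_d : ℝ, 0 < t_d ∧ ∃ C_d : ℝ, 0 < C_d ∧
      ∀ (𝓗 : Type*) [NormedAddCommGroup 𝓗] [InnerProductSpace ℂ 𝓗] [CompleteSpace 𝓗]
        (S : SiteData 𝓗) (N : ℕ) (V : Potentials S d N) (_ : IsInteraction V)
        (t : ℝ) (_ : 0 ≤ t) (_ : t < t_d)
        (a b : Rect d N → Rect d N)
        (_ : ∀ J, 1 ≤ J.size → (a J).size = ⌊(J.size : ℝ) ^ (1 / 4 : ℝ)⌋₊)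
        (_ : ∀ J, 1 ≤ J.size → (b J).size = J.size - ⌊(J.size : ℝ) ^ (1 / 4 : ℝ)⌋₊)
        (s K : Rect d N) (_ : s ⋖ K) (_ : 1 ≤ K.size)
        (_ : ∀ J, J ≤ K → 1 ≤ J.size →
          InductiveBounds t s J (a J) (b J) (effective t V s J)),
        let W := effective t V s
        (∃! T, IsResolventTerm (formG t W K) (energy t W K) (W K) T) ∧
        weightedNorm S K.sites (resolventTerm (formG t W K) (energy t W K) (W K)) ≤
          ENNReal.ofReal C_d * (W K).doublyWeightedNorm :=
  ⟨couplingThreshold d, couplingThreshold_pos d, 4, by norm_num,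
    fun _ _ _ _ _ _ _ hV _ ht htd _ _ _ _ _ _ hs hK hind => by
      simpa only [ENNReal.ofReal_ofNat] using lemma4p3_general hV.isLocal ht htd.le hs
        (fun J hJK hJ => (hind J (Or.inr (Rect.lt_of_sites_ssubset hJK)) hJ).normH0_le ht
          (htd.le.trans (couplingThreshold_le_one d)) hJ
          (Rect.le_of_lt_of_covBy hs (Rect.lt_of_sites_ssubset hJK)))
        ((hind _ (Or.inl rfl) hK).normH0_ne_top hs.1)⟩
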